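/- Let $q=2^e$ with $e>1$, and let $\mathrm{Sp}_4(q)$ be the group of isometries of the alternating form on $\mathbb F_q^4$ for which $e_1,f_1,e_2,f_2$ is a symplectic basis. Let $\mathrm{Sp}_2(q)\wr 2=(\mathrm{Sp}_2(q)\times \mathrm{Sp}_2(q)):2\le \mathrm{Sp}_4(q)$ be the subgroup preserving the decomposition $\langle e_1,f_1\rangle\perp\langle e_2,f_2\rangle$, that is, generated by $\mathrm{Sp}_2(q)\times\mathrm{Sp}_2(q)$ acting on the two planes and the involution exchanging $e_1\leftrightarrow e_2$, $f_1\leftrightarrow f_2$. Let $\mathrm{SO}_4^+(q)\le \mathrm{Sp}_4(q)$ be the group of isometries of determinant $1$ of the quadratic form $x_1y_1+x_2y_2$ (where $x_i,y_i$ are the coordinates along $e_i,f_i$), whose polar form is the given alternating form. A subgroup $H$ of a finite group $G$ is called a strong Gelfand subgroup if for every irreducible complex character $\psi$ of $H$ the induced character $\psi\uparrow G$ is multiplicity free, i.e. $\langle\psi\uparrow G,\chi\rangle\le 1$ for every irreducible complex character $\chi$ of $G$. Then: 1. $\mathrm{Sp}_2(q)\wr 2$ and $\mathrm{SO}_4^+(q)$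 are maximal subgroups of $\mathrm{Sp}_4(q)$; the former is isomorphic to the wreath product of $\mathrm{Sp}_2(q)$ with the cyclic group of order $2$, and $\mathrm{Sp}_2(q)\wr 2\cong \mathrm{SO}_4^+(q)$. 2. Neither $\mathrm{Sp}_2(q)\wr 2$ nor $\mathrm{SO}_4^+(q)$ is a strong Gelfand subgroup of $\mathrm{Sp}_4(q)$. 3. The sum of the degrees of the irreducible complex characters of $\mathrm{Sp}_2(q)\wr 2$ is $q^4+q^3-q$. 4. $\mathrm{Sp}_4(q)$ has an irreducible complex character of degree larger than $q^4+q^3-q$: one of degree $(q+1)^2(q^2+1)$ if $q>4$, and one of degree $340$ if $q=4$. -/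

import Mathlib

/-! ### Complex characters of finite groups -/

/-- The set of irreducible complex characters of `G`. Every finite-dimensional complex
representation is isomorphic to one on some `ℂⁿ`, so nothing is lost by using these spaces. -/
def IrrChar (G : Type*) [Group G] : Set (G → ℂ) :=
  {χ | ∃ (n : ℕ) (ρ : Representation ℂ G (Fin n → ℂ)), ρ.IsIrreducible ∧ χ = ρ.character}

/-- The inner product `⟨χ, ψ⟩ = |G|⁻¹ ∑ g, χ(g) * conj ψ(g)` of complex functions on a finite
group. -/
noncomputable def charInner {G : Type*} [Group G] [Finite G] (χ ψ : G → ℂ) : ℂ :=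
  (Nat.card G : ℂ)⁻¹ * ∑ᶠ g : G, χ g * (starRingEnd ℂ) (ψ g)

/-- A character `χ` of `G` is multiplicity free if `⟨χ, ψ⟩ ≤ 1` for every irreducible character `ψ`.
For characters the inner product is a natural number, so `≤` may be read on real parts. -/
def IsMultiplicityFreeChar {G : Type*} [Group G] [Finite G] (χ : G → ℂ) : Prop :=
  ∀ ψ ∈ IrrChar G, (charInner χ ψ).re ≤ 1

/-- `H` is a strong Gelfand subgroup of `G`: every irreducible character of `H` induces to a
multiplicity-free character of `G`. -/
def IsStrongGelfandSubgroup {G : Type*} [Group G] [Finite G] (H : Subgroup G) : Prop :=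
  ∀ (n : ℕ) (ρ : Representation ℂ H (Fin n → ℂ)), ρ.IsIrreducible →
    IsMultiplicityFreeChar (Representation.ind H.subtype ρ).character

/-- The total character of `G`: the sum of all its irreducible characters. -/
noncomputable def totalCharacter (G : Type*) [Group G] [Finite G] : G → ℂ :=
  ∑ᶠ χ ∈ IrrChar G, χ

/-! ### Symplectic groups and the two subgroups -/

/-- `Sp_{2n}(F)`, for the basis `e_1, …, e_n, f_1, …, f_n` and the form `J`. -/
abbrev Sp (n : ℕ) (F : Type*) [Field F] : Type _ :=
  ↥(Matrix.symplecticGroup (Fin n) F)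

section Wreath

variable {F : Type*} [Field F]

/-- The matrix acting as `a 0` on the plane `⟨e_1, f_1⟩` and as `a 1` on the plane
`⟨e_2, f_2⟩`. -/
def planeDiag (a : Fin 2 → Matrix (Fin 1 ⊕ Fin 1) (Fin 1 ⊕ Fin 1) F) :
    Matrix (Fin 2 ⊕ Fin 2) (Fin 2 ⊕ Fin 2) F :=
  Matrix.fromBlocks
    (Matrix.diagonal fun i => a i (Sum.inl 0) (Sum.inl 0))
    (Matrix.diagonal fun i => a i (Sum.inl 0) (Sum.inr 0))
    (Matrix.diagonal fun i => a i (Sum.inr 0) (Sum.inl 0))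
    (Matrix.diagonal fun i => a i (Sum.inr 0) (Sum.inr 0))

/-- The matrix permuting the planes `⟨e_1, f_1⟩` and `⟨e_2, f_2⟩` by
`e_i ↦ e_{σ i}`, `f_i ↦ f_{σ i}`. -/
def planePerm (σ : Equiv.Perm (Fin 2)) : Matrix (Fin 2 ⊕ Fin 2) (Fin 2 ⊕ Fin 2) F :=
  Matrix.fromBlocks (σ⁻¹.permMatrix F) 0 0 (σ⁻¹.permMatrix F)

theorem planeDiag_mul (a b : Fin 2 → Matrix (Fin 1 ⊕ Fin 1) (Fin 1 ⊕ Fin 1) F) :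
    planeDiag a * planeDiag b = planeDiag (a * b) := by
  simp only [planeDiag, Matrix.fromBlocks_multiply, Matrix.diagonal_mul_diagonal,
    Matrix.diagonal_add, Pi.mul_apply, Matrix.mul_apply, Fintype.sum_sum_type,
    Finset.univ_unique, Finset.sum_singleton, Fin.default_eq_zero]

theorem planeDiag_one :
    planeDiag (1 : Fin 2 → Matrix (Fin 1 ⊕ Fin 1) (Fin 1 ⊕ Fin 1) F) = 1 := by
  simp [planeDiag]

theorem planePerm_mul (σ τ : Equiv.Perm (Fin 2)) :
    (planePerm σ * planePerm τ : Matrix _ _ F) = planePerm (σ * τ) := by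
  simp [planePerm, Matrix.fromBlocks_multiply, Matrix.permMatrix_mul]

theorem planePerm_one : (planePerm 1 : Matrix _ _ F) = 1 := by
  simp [planePerm]

theorem planePerm_mul_planeDiag (σ : Equiv.Perm (Fin 2))
    (a : Fin 2 → Matrix (Fin 1 ⊕ Fin 1) (Fin 1 ⊕ Fin 1) F) :
    planePerm σ * planeDiag a = planeDiag (fun i => a (σ⁻¹ i)) * planePerm σ := by
  have key : ∀ d : Fin 2 → F, σ⁻¹.permMatrix F * Matrix.diagonal d =
      Matrix.diagonal (fun i => d (σ⁻¹ i)) * σ⁻¹.permMatrix F := by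
    intro d
    ext i j
    have h0 : σ⁻¹.permMatrix F i j = if σ⁻¹ i = j then 1 else 0 := by
      simp [Equiv.Perm.permMatrix, PEquiv.toMatrix_apply]
    rw [Matrix.mul_diagonal, Matrix.diagonal_mul, h0]
    split_ifs with h
    · rw [h, mul_comm]
    · simp
  simp [planePerm, planeDiag, Matrix.fromBlocks_multiply, key]

variable (F) in
/-- The subgroup `Sp_2(F) ≀ 2` of `Sp_4(F)`: all products of an element of `Sp_2(F) × Sp_2(F)`,
acting on the orthogonal sum of the planes `⟨e_1, f_1⟩` and `⟨e_2, f_2⟩`, with a permutation of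
the two planes. -/
def sp2Wreath : Subgroup (Sp 2 F) where
  carrier := {g | ∃ (a : Fin 2 → Sp 1 F) (σ : Equiv.Perm (Fin 2)),
    (g : Matrix (Fin 2 ⊕ Fin 2) (Fin 2 ⊕ Fin 2) F) =
      planeDiag (fun i => (a i).1) * planePerm σ}
  one_mem' := ⟨1, 1, by
    have h := planeDiag_one (F := F)
    simp only [planePerm_one, mul_one]
    exact h.symm⟩
  mul_mem' := by
    rintro g h ⟨a, σ, hg⟩ ⟨b, τ, hh⟩
    refine ⟨fun i => a i * b (σ⁻¹ i), σ * τ, ?_⟩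
    rw [Submonoid.coe_mul, hg, hh, Matrix.mul_assoc, ← Matrix.mul_assoc (planePerm σ),
      planePerm_mul_planeDiag, Matrix.mul_assoc, planePerm_mul, ← Matrix.mul_assoc,
      planeDiag_mul]
    rfl
  inv_mem' := by
    rintro g ⟨a, σ, hg⟩
    refine ⟨fun i => (a (σ i))⁻¹, σ⁻¹, ?_⟩
    rw [SymplecticGroup.coe_inv']
    apply Matrix.inv_eq_left_inv
    rw [hg, Matrix.mul_assoc, ← Matrix.mul_assoc (planePerm σ⁻¹), planePerm_mul_planeDiag,
      Matrix.mul_assoc, planePerm_mul, inv_mul_cancel, planePerm_one, Matrix.mul_one,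
      planeDiag_mul, ← planeDiag_one]
    congr 1
    funext i
    simp only [inv_inv, Pi.mul_apply, Pi.one_apply]
    exact congrArg Subtype.val (inv_mul_cancel (a (σ i)))

end Wreath

section Orthogonal

variable (F : Type*) [Field F]

/-- The quadratic form `x_1 y_1 + x_2 y_2` of plus type (two hyperbolic planes) on `F⁴`, in the
coordinates of the basis `e_1, e_2, f_1, f_2`. -/
def plusForm (v : Fin 2 ⊕ Fin 2 → F) : F :=
  ∑ i : Fin 2, v (Sum.inl i) * v (Sum.inr i)

/-- In characteristic two the polar form of `plusForm` is the form `J`, so that every matrix that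
preserves `plusForm` is symplectic. -/
theorem mem_symplecticGroup_of_plusForm [CharP F 2]
    (A : Matrix (Fin 2 ⊕ Fin 2) (Fin 2 ⊕ Fin 2) F)
    (hA : ∀ v, plusForm F (A.mulVec v) = plusForm F v) :
    A ∈ Matrix.symplecticGroup (Fin 2) F := by
  have hneg : ∀ x : F, -x = x := fun x => CharTwo.neg_eq x
  have hpol : ∀ v w, plusForm F (v + w) - plusForm F v - plusForm F w =
      dotProduct v ((Matrix.J (Fin 2) F).mulVec w) := by
    intro v w
    simp [plusForm, Matrix.J, dotProduct, Matrix.mulVec, Fin.sum_univ_two, Matrix.one_apply,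
      hneg]
    ring
  rw [SymplecticGroup.mem_iff']
  apply Matrix.ext_of_mulVec_single
  intro j
  funext i
  have h1 : ∀ v w, dotProduct v ((A.transpose * Matrix.J (Fin 2) F * A).mulVec w) =
      dotProduct v ((Matrix.J (Fin 2) F).mulVec w) := by
    intro v w
    rw [← hpol, ← hA (v + w), ← hA v, ← hA w, Matrix.mulVec_add, hpol, ← Matrix.mulVec_mulVec,
      ← Matrix.mulVec_mulVec, Matrix.dotProduct_mulVec, Matrix.vecMul_transpose]
  simpa using h1 (Pi.single i 1) (Pi.single j 1)

/-- The subgroup `SO_4^+(F)` of `Sp_4(F)`, for `F` of characteristic two: all isometries of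
determinant one of the quadratic form `plusForm`. -/
def soPlus : Subgroup (Sp 2 F) where
  carrier := {g | g.1.det = 1 ∧ ∀ v, plusForm F (g.1.mulVec v) = plusForm F v}
  one_mem' := by simp
  mul_mem' := by
    rintro g h ⟨hg, hg'⟩ ⟨hh, hh'⟩
    refine ⟨by simp [hg, hh], fun v => ?_⟩
    rw [Submonoid.coe_mul, ← Matrix.mulVec_mulVec, hg', hh']
  inv_mem' := by
    rintro g ⟨hg, hg'⟩
    refine ⟨by rw [SymplecticGroup.coe_inv', Matrix.det_nonsing_inv, hg, Ring.inverse_one],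
      fun v => ?_⟩
    rw [← hg', Matrix.mulVec_mulVec, SymplecticGroup.coe_inv',
      Matrix.mul_nonsing_inv _ (by rw [hg]; exact isUnit_one), Matrix.one_mulVec]

end Orthogonal

/-!
Everything is done for a finite field `F` of characteristic two with `q` elements; the form `J` is
then the alternating form `om`.

*Subgroups.* In characteristic two `plusForm` is the determinant of two-by-two matrices. The group
`SL_2 × SL_2` acts on these by `X ↦ A * X * Bᵀ`, and together with the transposition it gives all
isometries (`range_lift_tensorHom`). The wreath product `Sp_2 ≀ 2` acts on the sum of two planes in
the same pattern (`range_lift_planeHom`), so both subgroups are copies of `SL_2 ≀ 2`.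

*Maximality.* The symplectic group is generated by the transvections `tv u : v ↦ v + om v u • u`
(`eq_top_of_tv_mem`), so it suffices that a subgroup that properly contains one of the two contains
all of them. It contains some transvection outside the smaller group, and that group acts
transitively enough on the centres `u` to reach all the others (`isCoatom_sp2Wreath`,
`isCoatom_soPlus`).

*Total degree.* By Clifford theory the irreducible characters of `D ≀ 2` are two extensions of
`ψ ⊗ ψ` for each `ψ` and one character of degree `2ψ(1)φ(1)` for each pair `ψ ≠ φ`; hence the total
degree is the square of the total degree of `D` plus `|D|` (`totalCharacter_wreath_one`). The total
degree of `SL_2(q)` is `q²`, since all irreducible characters but the trivial one occur exactly once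
in the Gelfand–Graev character of degree `q² - 1` (`totalCharacter_one_eq`). This gives
`q⁴ + q(q² - 1)`.

*Strong Gelfand subgroups.* By Frobenius reciprocity, restriction to a strong Gelfand subgroup `H`
is multiplicity free, so no irreducible character of the whole group has a degree larger than the
total degree of `H` (`degree_le_of_isStrongGelfandSubgroup`).

*A character of large degree.* An idempotent `f` of the group algebra with `f * g * f` a multiple of
`f` for all group elements `g` yields an irreducible character of degree `|G|` times the coefficient
of `f` at `1` (`exists_irrChar_of_idempotent`). For `q > 4` the idempotent of the linear character
`(α, α²)` of the Borel subgroup qualifies by Mackey's criterion, where `α` generates the characters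
of the multiplicative group of `F`; the degree is the index `(q + 1)² (q² + 1)` of the Borel
subgroup. For `q = 4` the group of characters is too small for that. Here the character `(α, 1)`
extends to the stabilizer of a line, and the difference of the idempotents of the Borel subgroup and
of this stabilizer qualifies; the degree is the difference `q (q + 1) (q² + 1) = 340` of the two
indices.
-/

/-! ### Irreducible representations and their characters -/

open Representation in
theorem isIrreducible_iff_submodule {k G V : Type*} [Field k] [Monoid G] [AddCommGroup V]
    [Module k V] (ρ : Representation k G V) :
    ρ.IsIrreducible ↔ Nontrivial V ∧
      ∀ W : Submodule k V, (∀ g, ∀ v ∈ W, ρ g v ∈ W) → W = ⊥ ∨ W = ⊤ := by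
  constructor
  · intro h
    refine ⟨?_, fun W hW => ?_⟩
    · obtain ⟨a, b, hab⟩ := h.toNontrivial
      by_contra hV
      rw [not_nontrivial_iff_subsingleton] at hV
      exact hab (Subrepresentation.toSubmodule_injective (Subsingleton.elim _ _))
    · rcases h.eq_bot_or_eq_top (⟨W, fun g v hv => hW g v hv⟩ : Subrepresentation ρ) with h1 | h1
      · exact Or.inl (congrArg Subrepresentation.toSubmodule h1)
      · exact Or.inr (congrArg Subrepresentation.toSubmodule h1)
  · rintro ⟨hV, h⟩
    refine { exists_pair_ne := ⟨⊥, ⊤, fun h1 => ?_⟩, eq_bot_or_eq_top := fun p => ?_ }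
    · have h2 : (⊥ : Submodule k V) = ⊤ := congrArg Subrepresentation.toSubmodule h1
      exact bot_ne_top h2
    · rcases h p.toSubmodule (fun g v hv => p.apply_mem_toSubmodule g hv) with h1 | h1
      · exact Or.inl (Subrepresentation.toSubmodule_injective h1)
      · exact Or.inr (Subrepresentation.toSubmodule_injective h1)

namespace FiniteGroupCharacters

open Representation Module

section Basic

variable {G V W : Type*} [Group G] [AddCommGroup V] [Module ℂ V] [AddCommGroup W] [Module ℂ W]

/-- Transport of a representation along a linear equivalence. -/
def transport (ρ : Representation ℂ G V) (e : V ≃ₗ[ℂ] W) : Representation ℂ G W where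
  toFun g := e.toLinearMap ∘ₗ ρ g ∘ₗ e.symm.toLinearMap
  map_one' := by ext; simp
  map_mul' g h := by ext; simp

theorem transport_apply (ρ : Representation ℂ G V) (e : V ≃ₗ[ℂ] W) (g : G) (w : W) :
    transport ρ e g w = e (ρ g (e.symm w)) := rfl

theorem character_transport (ρ : Representation ℂ G V) (e : V ≃ₗ[ℂ] W) :
    (transport ρ e).character = ρ.character := by
  ext g
  exact LinearMap.trace_conj' (ρ g) e

theorem isIrreducible_transport (ρ : Representation ℂ G V) (e : V ≃ₗ[ℂ] W)
    (h : ρ.IsIrreducible) : (transport ρ e).IsIrreducible := by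
  rw [isIrreducible_iff_submodule] at h ⊢
  obtain ⟨h1, h2⟩ := h
  refine ⟨e.symm.toEquiv.nontrivial, fun U hU => ?_⟩
  rcases h2 (U.comap e.toLinearMap) (fun g v hv => by
    have := hU g (e v) hv
    simpa [transport_apply] using this) with h | h
  · left
    rw [eq_bot_iff]
    intro x hx
    have : e.symm x ∈ U.comap e.toLinearMap := by simpa using hx
    rw [h] at this
    simpa using this
  · right
    rw [eq_top_iff]
    intro x _
    have : e.symm x ∈ U.comap e.toLinearMap := by rw [h]; trivial
    simpa using this

theorem character_mem_irrChar [FiniteDimensional ℂ V] (ρ : Representation ℂ G V)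
    (h : ρ.IsIrreducible) : ρ.character ∈ IrrChar G :=
  ⟨finrank ℂ V, transport ρ (finBasis ℂ V).equivFun, isIrreducible_transport _ _ h,
    (character_transport _ _).symm⟩

open scoped ComplexOrder in
/-- A complex representation of a finite group is unitary for the averaged Hermitian form, so that
inversion of group elements becomes complex conjugation of character values. -/
theorem character_inv [Finite G] [FiniteDimensional ℂ V] (ρ : Representation ℂ G V) (g : G) :
    ρ.character g⁻¹ = (starRingEnd ℂ) (ρ.character g) := by
  classical
  have := Fintype.ofFinite G
  let b := finBasis ℂ V
  let M : G → Matrix _ _ ℂ := fun g => LinearMap.toMatrix b b (ρ g)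
  have hM : ∀ g h, M (g * h) = M g * M h := fun g h => by
    simp only [M, map_mul, LinearMap.toMatrix_mul]
  have hM1 : M 1 = 1 := by simp [M]
  have htr : ∀ g, ρ.character g = (M g).trace := fun g =>
    (LinearMap.trace_eq_matrix_trace ℂ b (ρ g))
  let P : Matrix _ _ ℂ := ∑ h : G, (M h).conjTranspose * M h
  have hP : P.PosDef := by
    have : P = (M 1).conjTranspose * M 1 + ∑ h ∈ Finset.univ.erase 1, (M h).conjTranspose * M h :=
      (Finset.add_sum_erase _ _ (Finset.mem_univ _)).symm
    rw [this]
    refine Matrix.PosDef.add_posSemidef ?_ (Matrix.posSemidef_sum _ fun h _ =>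
      Matrix.posSemidef_conjTranspose_mul_self _)
    simpa [hM1] using Matrix.PosDef.one
  have hinv : (M g).conjTranspose * P * M g = P := by
    simp only [P, Finset.mul_sum, Finset.sum_mul]
    refine Fintype.sum_equiv (Equiv.mulRight g) _ _ fun h => ?_
    simp only [Equiv.coe_mulRight, hM, Matrix.conjTranspose_mul, Matrix.mul_assoc]
  have hgi : M g * M g⁻¹ = 1 := by rw [← hM, mul_inv_cancel, hM1]
  have hu : IsUnit P.det := (Matrix.isUnit_iff_isUnit_det _).1 hP.isUnit
  have h3 : (M g).conjTranspose * P = P * M g⁻¹ := by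
    calc (M g).conjTranspose * P = (M g).conjTranspose * P * (M g * M g⁻¹) := by
          rw [hgi, Matrix.mul_one]
      _ = ((M g).conjTranspose * P * M g) * M g⁻¹ := by simp only [Matrix.mul_assoc]
      _ = _ := by rw [hinv]
  have h4 : M g⁻¹ = P⁻¹ * ((M g).conjTranspose * P) := by
    rw [h3, Matrix.nonsing_inv_mul_cancel_left _ _ hu]
  rw [htr, htr, h4, Matrix.trace_mul_comm, Matrix.mul_assoc, Matrix.mul_nonsing_inv _ hu,
    Matrix.mul_one, Matrix.trace_conjTranspose]
  rfl

theorem character_prod [FiniteDimensional ℂ V] [FiniteDimensional ℂ W]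
    (ρ : Representation ℂ G V) (σ : Representation ℂ G W) :
    (ρ.prod σ).character = ρ.character + σ.character := by
  ext g
  exact LinearMap.trace_prodMap' (ρ g) (σ g)

theorem character_eq_add_of_isCompl [FiniteDimensional ℂ V] (ρ : Representation ℂ G V)
    (p q : Subrepresentation ρ) (h : IsCompl p q) :
    ρ.character = p.toRepresentation.character + q.toRepresentation.character := by
  have h' : IsCompl p.toSubmodule q.toSubmodule := by
    constructor
    · rw [disjoint_iff, ← Subrepresentation.toSubmodule_inf, h.inf_eq_bot]; rfl
    · rw [codisjoint_iff, ← Subrepresentation.toSubmodule_sup, h.sup_eq_top]; rfl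
  rw [← character_prod, ← character_transport _ (Submodule.prodEquivOfIsCompl _ _ h')]
  congr 1
  ext g v
  rw [transport_apply]
  obtain ⟨x, rfl⟩ := (Submodule.prodEquivOfIsCompl _ _ h').surjective v
  rw [LinearEquiv.symm_apply_apply]
  simp [Representation.prod, Subrepresentation.toRepresentation]

/-- Complete reducibility, on the level of characters. -/
theorem exists_multiset_irrChar [Finite G] [FiniteDimensional ℂ V] (ρ : Representation ℂ G V) :
    ∃ s : Multiset (G → ℂ), (∀ χ ∈ s, χ ∈ IrrChar G) ∧ ρ.character = s.sum := by
  induction hn : finrank ℂ V using Nat.strong_induction_on generalizing V with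
  | _ n ih =>
  by_cases hirr : ρ.IsIrreducible
  · exact ⟨{ρ.character}, by simpa using character_mem_irrChar ρ hirr, by simp⟩
  rcases subsingleton_or_nontrivial V with hV | hV
  · refine ⟨0, by simp, ?_⟩
    ext g
    have : ρ g = 0 := Subsingleton.elim _ _
    simp [character, this]
  have hnt : Nontrivial (Subrepresentation ρ) := ⟨⊥, ⊤, fun h1 => by
    have h2 : (⊥ : Submodule ℂ V) = ⊤ := congrArg Subrepresentation.toSubmodule h1
    exact bot_ne_top h2⟩
  obtain ⟨p, hp⟩ : ∃ p : Subrepresentation ρ, ¬ (p = ⊥ ∨ p = ⊤) := by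
    by_contra! h
    exact hirr ⟨h⟩
  push Not at hp
  have : NeZero (Nat.card G : ℂ) := ⟨Nat.cast_ne_zero.2 Nat.card_pos.ne'⟩
  have hss : IsSemisimpleRepresentation ρ := inferInstance
  obtain ⟨q, hpq⟩ := hss.exists_isCompl p
  have hlt : ∀ r : Subrepresentation ρ, r ≠ ⊤ → finrank ℂ r.toSubmodule < n := fun r hr => by
    rw [← hn]
    refine Submodule.finrank_lt ?_
    exact fun h => hr (Subrepresentation.toSubmodule_injective h)
  have hq : q ≠ ⊤ := fun hq => hp.1 (by
    have := hpq.inf_eq_bot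
    rw [hq, inf_top_eq] at this
    exact this)
  obtain ⟨s, hs, hs'⟩ := ih _ (hlt p hp.2) p.toRepresentation rfl
  obtain ⟨t, ht, ht'⟩ := ih _ (hlt q hq) q.toRepresentation rfl
  refine ⟨s + t, fun χ hχ => ?_, ?_⟩
  · rcases Multiset.mem_add.1 hχ with h | h
    exacts [hs _ h, ht _ h]
  · rw [character_eq_add_of_isCompl ρ p q hpq, hs', ht', Multiset.sum_add]

end Basic

section Inner

variable {G V W : Type*} [Group G] [Finite G] [AddCommGroup V] [Module ℂ V] [AddCommGroup W]
  [Module ℂ W] [FiniteDimensional ℂ V] [FiniteDimensional ℂ W]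

theorem charInner_eq_sum [Fintype G] (χ ψ : G → ℂ) :
    charInner χ ψ = (Nat.card G : ℂ)⁻¹ * ∑ g : G, χ g * (starRingEnd ℂ) (ψ g) := by
  rw [charInner, finsum_eq_sum_of_fintype]

theorem charInner_add_left (χ₁ χ₂ ψ : G → ℂ) :
    charInner (χ₁ + χ₂) ψ = charInner χ₁ ψ + charInner χ₂ ψ := by
  have := Fintype.ofFinite G
  simp [charInner_eq_sum, add_mul, Finset.sum_add_distrib, mul_add]

theorem charInner_zero_left (ψ : G → ℂ) : charInner 0 ψ = 0 := by
  simp [charInner]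

theorem charInner_multiset_sum (s : Multiset (G → ℂ)) (ψ : G → ℂ) :
    charInner s.sum ψ = (s.map fun χ => charInner χ ψ).sum := by
  induction s using Multiset.induction_on with
  | empty => simp [charInner_zero_left]
  | cons a s ih => simp [charInner_add_left, ih]

theorem charInner_comm (χ ψ : G → ℂ) : charInner ψ χ = (starRingEnd ℂ) (charInner χ ψ) := by
  have := Fintype.ofFinite G
  simp [charInner_eq_sum, map_sum, mul_comm]

theorem charInner_character (ρ : Representation ℂ G V) (σ : Representation ℂ G W) :
    charInner ρ.character σ.character = finrank ℂ (IntertwiningMap σ ρ) := by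
  have := Fintype.ofFinite G
  have : Invertible (Nat.card G : ℂ) :=
    invertibleOfNonzero (Nat.cast_ne_zero.2 Nat.card_pos.ne')
  rw [charInner_eq_sum, ← card_inv_mul_sum_char_mul_char_eq_finrank]
  simp_rw [character_inv]

open Classical in
theorem charInner_irrChar {χ ψ : G → ℂ} (hχ : χ ∈ IrrChar G) (hψ : ψ ∈ IrrChar G) :
    charInner χ ψ = if χ = ψ then 1 else 0 := by
  have := Fintype.ofFinite G
  have : Invertible (Nat.card G : ℂ) :=
    invertibleOfNonzero (Nat.cast_ne_zero.2 Nat.card_pos.ne')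
  obtain ⟨n, ρ, hρ, rfl⟩ := hχ
  obtain ⟨m, σ, hσ, rfl⟩ := hψ
  have h1 := char_orthonormal ρ σ
  simp_rw [character_inv] at h1
  rw [← charInner_eq_sum] at h1
  by_cases he : Nonempty (Representation.Equiv σ ρ)
  · rw [h1, if_pos he, if_pos (char_iso he.some).symm]
  · rw [h1, if_neg he, if_neg]
    intro heq
    rw [heq, charInner_character] at h1
    simp [he] at h1

theorem charInner_multiset_irrChar [DecidableEq (G → ℂ)] (s : Multiset (G → ℂ))
    (hs : ∀ χ ∈ s, χ ∈ IrrChar G) {ψ : G → ℂ} (hψ : ψ ∈ IrrChar G) :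
    charInner s.sum ψ = s.count ψ := by
  induction s using Multiset.induction_on with
  | empty => simp [charInner_zero_left]
  | cons a s ih =>
    rw [Multiset.sum_cons, charInner_add_left, ih fun χ h => hs χ (Multiset.mem_cons_of_mem h),
      charInner_irrChar (hs a (Multiset.mem_cons_self a s)) hψ, Multiset.count_cons]
    push_cast
    rw [add_comm]
    simp [eq_comm]

/-- The regular character as the character of the group algebra. -/
theorem character_leftRegular [DecidableEq G] (g : G) :
    (leftRegular ℂ G).character g = if g = 1 then (Nat.card G : ℂ) else 0 := by
  have := Fintype.ofFinite G
  let b : Basis G ℂ (MonoidAlgebra ℂ G) := ⟨MonoidAlgebra.coeffLinearEquiv ℂ⟩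
  have hb : ∀ h, b h = MonoidAlgebra.single h 1 := fun h => rfl
  rw [character, LinearMap.trace_eq_matrix_trace ℂ b, Matrix.trace]
  simp only [Matrix.diag_apply, LinearMap.toMatrix_apply, hb, leftRegular, ofMulAction_single]
  have : ∀ h : G, b.repr (MonoidAlgebra.single (g • h) 1) h = if g = 1 then (1 : ℂ) else 0 := by
    intro h
    change Finsupp.single (g • h) (1 : ℂ) h = _
    rw [Finsupp.single_apply]
    simp
  simp only [this]
  split_ifs <;> simp

end Inner
end FiniteGroupCharacters

/-! ### Degrees of irreducible characters, idempotents and strong Gelfand subgroups -/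

namespace FiniteGroupCharacters

open Representation Module

section Sums

variable {G : Type*} [Group G] [Finite G]

omit [Finite G] in
theorem irrChar_one {χ : G → ℂ} (hχ : χ ∈ IrrChar G) : ∃ n : ℕ, 0 < n ∧ χ 1 = n := by
  obtain ⟨n, ρ, hρ, rfl⟩ := hχ
  have hV := ((isIrreducible_iff_submodule ρ).1 hρ).1
  refine ⟨finrank ℂ (Fin n → ℂ), finrank_pos, by simp⟩

theorem charInner_leftRegular (χ : G → ℂ) :
    charInner (leftRegular ℂ G).character χ = (starRingEnd ℂ) (χ 1) := by
  classical
  have := Fintype.ofFinite G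
  have h : (Nat.card G : ℂ) ≠ 0 := Nat.cast_ne_zero.2 Nat.card_pos.ne'
  rw [charInner_eq_sum]
  simp only [character_leftRegular, ite_mul, zero_mul, Finset.sum_ite_eq', Finset.mem_univ,
    if_true]
  field_simp

instance : FiniteDimensional ℂ (MonoidAlgebra ℂ G) :=
  Module.Finite.equiv (MonoidAlgebra.coeffLinearEquiv ℂ).symm

theorem irrChar_finite (G : Type*) [Group G] [Finite G] : (IrrChar G).Finite := by
  classical
  obtain ⟨s, hs, hs'⟩ := exists_multiset_irrChar (leftRegular ℂ G)
  refine s.toFinset.finite_toSet.subset fun χ hχ => ?_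
  have h1 := charInner_multiset_irrChar s hs hχ
  obtain ⟨n, hn, hn'⟩ := irrChar_one hχ
  rw [← hs', charInner_leftRegular, hn', Complex.conj_natCast] at h1
  rw [Finset.mem_coe, Multiset.mem_toFinset, ← Multiset.count_pos]
  have : n = s.count χ := by exact_mod_cast h1
  omega

/-- The finite set of irreducible characters. -/
noncomputable def irrFinset (G : Type*) [Group G] [Finite G] : Finset (G → ℂ) :=
  (irrChar_finite G).toFinset

@[simp] theorem mem_irrFinset {χ : G → ℂ} : χ ∈ irrFinset G ↔ χ ∈ IrrChar G :=
  Set.Finite.mem_toFinset _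

theorem totalCharacter_eq_sum : totalCharacter G = ∑ χ ∈ irrFinset G, χ :=
  finsum_mem_eq_finite_toFinset_sum _ (irrChar_finite G)

theorem totalCharacter_one : totalCharacter G 1 = ∑ χ ∈ irrFinset G, χ 1 := by
  rw [totalCharacter_eq_sum, Finset.sum_apply]

theorem character_eq_sum_charInner {V : Type*} [AddCommGroup V] [Module ℂ V]
    [FiniteDimensional ℂ V] (ρ : Representation ℂ G V) :
    ρ.character = ∑ χ ∈ irrFinset G, charInner ρ.character χ • χ := by
  classical
  obtain ⟨s, hs, hs'⟩ := exists_multiset_irrChar ρ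
  have h1 : s.sum = ∑ χ ∈ irrFinset G, s.count χ • χ :=
    Finset.sum_multiset_count_of_subset _ _ fun χ hχ => by
      rw [mem_irrFinset]
      exact hs χ (Multiset.mem_toFinset.1 hχ)
  conv_lhs => rw [hs', h1]
  refine Finset.sum_congr rfl fun χ hχ => ?_
  rw [hs', charInner_multiset_irrChar s hs (mem_irrFinset.1 hχ), Nat.cast_smul_eq_nsmul]

/-- The second orthogonality relation for the column of the identity element. -/
theorem sum_irrChar_one_mul [DecidableEq G] (g : G) :
    ∑ χ ∈ irrFinset G, χ 1 * χ g = if g = 1 then (Nat.card G : ℂ) else 0 := by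
  rw [← character_leftRegular, character_eq_sum_charInner (leftRegular ℂ G), Finset.sum_apply]
  refine Finset.sum_congr rfl fun χ hχ => ?_
  obtain ⟨n, -, hn⟩ := irrChar_one (mem_irrFinset.1 hχ)
  rw [Pi.smul_apply, charInner_leftRegular, hn, Complex.conj_natCast, smul_eq_mul]

theorem sum_irrChar_one_sq : ∑ χ ∈ irrFinset G, χ 1 ^ 2 = (Nat.card G : ℂ) := by
  classical
  have := sum_irrChar_one_mul (1 : G)
  simpa [sq] using this

theorem character_mem_irrChar_of_charInner_self {V : Type*} [AddCommGroup V] [Module ℂ V]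
    [FiniteDimensional ℂ V] (ρ : Representation ℂ G V)
    (h : charInner ρ.character ρ.character = 1) : ρ.character ∈ IrrChar G := by
  classical
  obtain ⟨s, hs, hs'⟩ := exists_multiset_irrChar ρ
  have h1 : charInner s.sum s.sum = ((s.map fun a => s.count a).sum : ℕ) := by
    rw [charInner_multiset_sum, Nat.cast_multiset_sum, Multiset.map_map]
    congr 1
    refine Multiset.map_congr rfl fun a ha => ?_
    rw [charInner_comm, charInner_multiset_irrChar s hs (hs a ha), Complex.conj_natCast]
    rfl
  rw [← hs', h] at h1
  have h2 : (s.map fun a => s.count a).sum = 1 := by exact_mod_cast h1.symm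
  have h3 : Multiset.card s ≤ 1 := by
    rw [← h2, ← smul_eq_mul _ 1 |>.trans (mul_one (Multiset.card s)), ← Multiset.sum_replicate,
      ← Multiset.map_const']
    exact Multiset.sum_map_le_sum_map _ _ fun a ha => Multiset.one_le_count_iff_mem.2 ha
  have h4 : Multiset.card s ≠ 0 := by
    rw [Ne, Multiset.card_eq_zero]
    rintro rfl
    simp at h2
  obtain ⟨a, rfl⟩ := Multiset.card_eq_one.1 (show Multiset.card s = 1 by omega)
  rw [hs', Multiset.sum_singleton]
  exact hs a (by simp)

/-- A set of irreducible characters whose squared degrees add up to the group order contains all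
irreducible characters. -/
theorem eq_irrFinset_of_sum_sq (L : Finset (G → ℂ)) (hL : ∀ χ ∈ L, χ ∈ IrrChar G)
    (hsum : ∑ χ ∈ L, χ 1 ^ 2 = (Nat.card G : ℂ)) : L = irrFinset G := by
  classical
  have hsub : L ⊆ irrFinset G := fun χ hχ => mem_irrFinset.2 (hL χ hχ)
  refine hsub.antisymm fun χ hχ => ?_
  by_contra hn
  have h1 := Finset.sum_sdiff hsub (f := fun χ : G → ℂ => χ 1 ^ 2)
  rw [hsum, sum_irrChar_one_sq, add_eq_right] at h1
  have hdeg : ∀ ψ ∈ irrFinset G \ L, ∃ n : ℕ, 0 < n ∧ ψ 1 = n := fun ψ hψ =>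
    irrChar_one (mem_irrFinset.1 (Finset.mem_sdiff.1 hψ).1)
  have h2 : ∑ ψ ∈ irrFinset G \ L, (ψ 1 ^ 2).re = 0 := by
    rw [← Complex.re_sum, h1, Complex.zero_re]
  rw [Finset.sum_eq_zero_iff_of_nonneg] at h2
  · obtain ⟨n, hn0, hn1⟩ := hdeg χ (Finset.mem_sdiff.2 ⟨hχ, hn⟩)
    have := h2 χ (Finset.mem_sdiff.2 ⟨hχ, hn⟩)
    rw [hn1, ← Nat.cast_pow, Complex.natCast_re] at this
    have : n ^ 2 = 0 := by exact_mod_cast this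
    exact hn0.ne' (by simpa using this)
  · intro ψ hψ
    obtain ⟨n, -, hn1⟩ := hdeg ψ hψ
    rw [hn1, ← Nat.cast_pow, Complex.natCast_re]
    positivity

omit [Finite G] in
theorem comp_mulEquiv_mem_irrChar {H : Type*} [Group H] (e : G ≃* H) {χ : H → ℂ}
    (hχ : χ ∈ IrrChar H) : χ ∘ e ∈ IrrChar G := by
  obtain ⟨n, ρ, hρ, rfl⟩ := hχ
  refine ⟨n, ρ.comp e.toMonoidHom, ?_, rfl⟩
  rw [isIrreducible_iff_submodule] at hρ ⊢
  refine ⟨hρ.1, fun W hW => hρ.2 W fun g v hv => ?_⟩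
  have := hW (e.symm g) v hv
  simpa using this

theorem totalCharacter_one_congr {H : Type*} [Group H] [Finite H] (e : G ≃* H) :
    totalCharacter G 1 = totalCharacter H 1 := by
  rw [totalCharacter_one, totalCharacter_one]
  refine Finset.sum_nbij' (fun χ => χ ∘ e.symm) (fun χ => χ ∘ e) ?_ ?_ ?_ ?_ ?_
  · intro χ hχ
    exact mem_irrFinset.2 (comp_mulEquiv_mem_irrChar e.symm (mem_irrFinset.1 hχ))
  · intro χ hχ
    exact mem_irrFinset.2 (comp_mulEquiv_mem_irrChar e (mem_irrFinset.1 hχ))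
  · intro χ _; ext; simp
  · intro χ _; ext; simp
  · intro χ _; simp

end Sums

section Idempotent

variable {G : Type*} [Group G] [Finite G]

omit [Finite G] in
theorem leftRegular_apply (g : G) (x : MonoidAlgebra ℂ G) :
    leftRegular ℂ G g x = MonoidAlgebra.single g 1 * x := by
  induction x using MonoidAlgebra.induction_linear with
  | zero => simp
  | add x y hx hy => rw [map_add, hx, hy, mul_add]
  | single h a => simp [leftRegular, ofMulAction_single]

theorem trace_mulRight (f : MonoidAlgebra ℂ G) :
    LinearMap.trace ℂ _ (LinearMap.mulRight ℂ f) = Nat.card G * f.coeff 1 := by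
  classical
  have := Fintype.ofFinite G
  let b : Basis G ℂ (MonoidAlgebra ℂ G) := ⟨MonoidAlgebra.coeffLinearEquiv ℂ⟩
  rw [LinearMap.trace_eq_matrix_trace ℂ b, Matrix.trace]
  have h : ∀ g : G, b.repr (LinearMap.mulRight ℂ f (b g)) g = f.coeff 1 := by
    intro g
    change (MonoidAlgebra.single g (1 : ℂ) * f).coeff g = _
    rw [MonoidAlgebra.coeff_single_mul_apply]
    simp
  simp only [Matrix.diag_apply, LinearMap.toMatrix_apply, h]
  simp

/-- If `f` is an idempotent of the group algebra `A` with `f A f = ℂ f`, then the left ideal `A f`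
has endomorphism algebra `ℂ`, hence is irreducible; its dimension is the trace of right
multiplication by `f`. -/
theorem exists_irrChar_of_idempotent (f : MonoidAlgebra ℂ G) (hf : f * f = f) (hf0 : f ≠ 0)
    (h : ∀ g : G, ∃ c : ℂ, f * MonoidAlgebra.single g 1 * f = c • f) :
    ∃ χ ∈ IrrChar G, χ 1 = Nat.card G * f.coeff 1 := by
  have hA : ∀ x : MonoidAlgebra ℂ G, ∃ c : ℂ, f * x * f = c • f := by
    intro x
    induction x using MonoidAlgebra.induction_linear with
    | zero => exact ⟨0, by simp⟩
    | add x y hx hy =>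
      obtain ⟨c, hc⟩ := hx
      obtain ⟨d, hd⟩ := hy
      exact ⟨c + d, by rw [mul_add, add_mul, hc, hd, add_smul]⟩
    | single g a =>
      obtain ⟨c, hc⟩ := h g
      refine ⟨a * c, ?_⟩
      have : MonoidAlgebra.single g a = a • MonoidAlgebra.single g (1 : ℂ) := by simp
      rw [mul_smul, ← hc, this, mul_smul_comm, smul_mul_assoc]
  let R := LinearMap.mulRight ℂ f
  have hR : IsIdempotentElem R := by
    refine LinearMap.ext fun x => ?_
    change x * f * f = x * f
    rw [mul_assoc, hf]
  let W : Subrepresentation (leftRegular ℂ G) := ⟨LinearMap.range R, by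
    rintro g _ ⟨x, rfl⟩
    exact ⟨MonoidAlgebra.single g 1 * x, by simp [R, leftRegular_apply, mul_assoc]⟩⟩
  have hWf : ∀ x ∈ W.toSubmodule, x * f = x := by
    rintro _ ⟨x, rfl⟩
    change x * f * f = x * f
    rw [mul_assoc, hf]
  have hfW : ∀ x, x * f ∈ W.toSubmodule := fun x => ⟨x, rfl⟩
  have hfin : (finrank ℂ W.toSubmodule : ℂ) = Nat.card G * f.coeff 1 := by
    rw [← trace_mulRight f]
    exact ((LinearMap.IsIdempotentElem.isProj_range R hR).trace).symm
  refine ⟨W.toRepresentation.character, ?_, by rw [char_one, hfin]⟩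
  apply character_mem_irrChar_of_charInner_self
  rw [charInner_character]
  have : finrank ℂ (IntertwiningMap W.toRepresentation W.toRepresentation) = 1 := by
    let f' : W.toSubmodule := ⟨f, by simpa [hf] using hfW f⟩
    have hbij : Function.Bijective (LinearMap.toSpanSingleton ℂ
        (IntertwiningMap W.toRepresentation W.toRepresentation) (IntertwiningMap.id _)) := by
      refine ⟨fun a b hab => ?_, fun φ => ?_⟩
      · have h0 := congrArg (fun φ : IntertwiningMap _ _ => (φ f').1) hab
        change a • f = b • f at h0
        exact smul_left_injective ℂ hf0 h0
      · have hφ : ∀ (x : MonoidAlgebra ℂ G) (w : W.toSubmodule) (hx : x * w.1 ∈ W.toSubmodule),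
            (φ ⟨x * w.1, hx⟩ : W.toSubmodule).1 = x * (φ w).1 := by
          intro x w hx
          induction x using MonoidAlgebra.induction_linear with
          | zero =>
            have : (⟨0 * w.1, hx⟩ : W.toSubmodule) = 0 := Subtype.ext (zero_mul _)
            rw [this, map_zero, zero_mul]; rfl
          | add x y ihx ihy =>
            have hmem : ∀ z, z * w.1 ∈ W.toSubmodule := fun z => by
              rw [← hWf w.1 w.2, ← mul_assoc]; exact hfW _
            have : (⟨(x + y) * w.1, hx⟩ : W.toSubmodule) = ⟨x * w.1, hmem x⟩ + ⟨y * w.1, hmem y⟩ :=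
              Subtype.ext (add_mul _ _ _)
            rw [this, map_add, add_mul, ← ihx (hmem x), ← ihy (hmem y)]; rfl
          | single g a =>
            have h1 := φ.isIntertwining _ _ g w
            have : (⟨MonoidAlgebra.single g a * w.1, hx⟩ : W.toSubmodule)
                = a • W.toRepresentation g w := by
              apply Subtype.ext
              change _ = a • (leftRegular ℂ G g w.1)
              rw [leftRegular_apply, ← smul_mul_assoc, MonoidAlgebra.smul_single, smul_eq_mul,
                mul_one]
            rw [this, map_smul, h1]
            change a • (leftRegular ℂ G g (φ w).1) = _
            rw [leftRegular_apply, ← smul_mul_assoc, MonoidAlgebra.smul_single, smul_eq_mul,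
              mul_one]
        have h1 : (φ f').1 = f * (φ f').1 := by
          have h0 := hφ f f' (by rw [hf]; exact f'.2)
          rw [← h0]
          congr 2
          exact Subtype.ext hf.symm
        obtain ⟨c, hc⟩ := hA (φ f').1
        have h2 : (φ f').1 = c • f := by
          rw [← hc, ← h1, hWf _ (φ f').2]
        refine ⟨c, ?_⟩
        apply IntertwiningMap.ext
        ext w : 1
        apply Subtype.ext
        have h3 := hφ w.1 f' (hfW _)
        have h4 : (⟨w.1 * f'.1, hfW _⟩ : W.toSubmodule) = w := Subtype.ext (hWf _ w.2)
        rw [h4, h2] at h3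
        change c • w.1 = (φ w).1
        rw [h3, mul_smul_comm, hWf _ w.2]
    rw [← (LinearEquiv.ofBijective _ hbij).finrank_eq, finrank_self]
  rw [this, Nat.cast_one]

end Idempotent

section Gelfand

variable {G : Type*} [Group G] [Finite G]

/-- The restriction of a representation to a subgroup. -/
abbrev resRep {V : Type*} [AddCommGroup V] [Module ℂ V] (H : Subgroup G)
    (σ : Representation ℂ G V) : Representation ℂ H V := σ.comp H.subtype

/-- One half of Frobenius reciprocity: an `H`-map into the restriction of `σ` extends to a `G`-map
from the induced representation. -/
theorem finrank_intertwiningMap_res_le {V W : Type*} [AddCommGroup V] [Module ℂ V] [AddCommGroup W]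
    [Module ℂ W] [FiniteDimensional ℂ V] [FiniteDimensional ℂ W] (H : Subgroup G)
    (ρ : Representation ℂ H V) (σ : Representation ℂ G W) :
    finrank ℂ (IntertwiningMap ρ (resRep H σ)) ≤
      finrank ℂ (IntertwiningMap (ind H.subtype ρ) σ) := by
  let Φ : IntertwiningMap ρ (resRep H σ) →ₗ[ℂ] IntertwiningMap (ind H.subtype ρ) σ :=
    { toFun := fun f => ⟨Representation.Coinvariants.lift _
        (TensorProduct.lift <| (Finsupp.lift _ _ _ fun h => σ h⁻¹ ∘ₗ f.toLinearMap) ∘ₗ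
          (MonoidAlgebra.coeffLinearEquiv ℂ).toLinearMap)
        fun g ↦ by
          ext h x
          have := f.isIntertwining _ _ g x
          simp only [LinearMap.coe_comp, Function.comp_apply, MonoidAlgebra.lsingle_apply]
          simp [ofMulAction_single, mul_inv_rev, this], fun g ↦ by ext; simp⟩
      map_add' := fun f f' => by
        apply IntertwiningMap.ext
        ext h x
        simp
      map_smul' := fun c f => by
        apply IntertwiningMap.ext
        ext h x
        simp }
  refine LinearMap.finrank_le_finrank_of_injective (f := Φ) fun f f' hff => ?_
  apply IntertwiningMap.ext
  ext x : 1
  have := congrArg (fun F : IntertwiningMap (ind H.subtype ρ) σ => F (IndV.mk _ _ 1 x)) hff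
  simpa [Φ] using this

/-- Restricting to a strong Gelfand subgroup is multiplicity free, so degrees are bounded by the
total degree of the subgroup. -/
theorem degree_le_of_isStrongGelfandSubgroup (H : Subgroup G) (hH : IsStrongGelfandSubgroup H)
    {χ : G → ℂ} (hχ : χ ∈ IrrChar G) : (χ 1).re ≤ (totalCharacter H 1).re := by
  have hχ' := hχ
  obtain ⟨n, σ, hσ, rfl⟩ := hχ
  have h1 := congrFun (character_eq_sum_charInner (resRep H σ)) 1
  have h2 : (resRep H σ).character 1 = σ.character 1 := by rw [char_one, char_one]
  rw [← h2, h1, totalCharacter_one, Finset.sum_apply, Complex.re_sum, Complex.re_sum]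
  refine Finset.sum_le_sum fun ψ hψ => ?_
  have hψ' := mem_irrFinset.1 hψ
  obtain ⟨d, hd, hd'⟩ := irrChar_one hψ'
  obtain ⟨m, ρ, hρ, rfl⟩ := hψ'
  have h3 := hH m ρ hρ _ hχ'
  rw [charInner_comm, charInner_character, Complex.conj_natCast, Complex.natCast_re] at h3
  have h4 : finrank ℂ (IntertwiningMap ρ (resRep H σ)) ≤ 1 :=
    (finrank_intertwiningMap_res_le H ρ σ).trans (by exact_mod_cast h3)
  rw [Pi.smul_apply, charInner_character, hd', smul_eq_mul, ← Nat.cast_mul, Complex.natCast_re,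
    Complex.natCast_re]
  have := Nat.mul_le_mul_right d h4
  rw [one_mul] at this
  exact_mod_cast this

end Gelfand
end FiniteGroupCharacters

/-! ### Characters of the wreath product with a group of order two -/

namespace WreathTwo

open FiniteGroupCharacters Representation Module Matrix

/-- The cyclic group of order two acting on the base group of the wreath product. -/
abbrev C2 : Type := Multiplicative (ZMod 2)

/-- The nontrivial element of `C2`. -/
abbrev swap : C2 := Multiplicative.ofAdd 1

theorem C2.eq_one_or_swap (s : C2) : s = 1 ∨ s = swap := by
  revert s; decide

theorem swap_ne_one : swap ≠ 1 := by decide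

theorem swap_mul_swap : swap * swap = 1 := by decide

theorem swap_inv : swap⁻¹ = swap := by decide

variable {D : Type*} [Group D]

/-- The element of the wreath product with components `x`, `y` and top part `s`. -/
def mk (x y : D) (s : C2) : D ≀ᵣ C2 := ⟨fun q => if q = 1 then x else y, s⟩

omit [Group D] in
theorem eq_mk (w : D ≀ᵣ C2) : w = mk (w.left 1) (w.left swap) w.right := by
  ext q
  · rcases C2.eq_one_or_swap q with rfl | rfl
    · simp [mk]
    · simp [mk]
  · rfl

/-- The wreath product as a set of triples. -/
def equivTriple : D ≀ᵣ C2 ≃ (D × D) × C2 where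
  toFun w := ((w.left 1, w.left swap), w.right)
  invFun p := mk p.1.1 p.1.2 p.2
  left_inv w := (eq_mk w).symm
  right_inv p := by simp [mk]

omit [Group D] in
theorem sum_eq [Fintype D] [Fintype (D ≀ᵣ C2)] (f : D ≀ᵣ C2 → ℂ) :
    ∑ w, f w = ∑ x, ∑ y, f (mk x y 1) + ∑ x, ∑ y, f (mk x y swap) := by
  have h1 : ∑ w, f w = ∑ p : (D × D) × C2, f (mk p.1.1 p.1.2 p.2) :=
    Fintype.sum_equiv equivTriple _ _ fun w => by
      conv_lhs => rw [eq_mk w]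
      rfl
  have h2 : ∀ h : C2 → ℂ, ∑ s, h s = h 1 + h swap := fun h => by
    have : (Finset.univ : Finset C2) = {1, swap} := by decide
    rw [this, Finset.sum_pair swap_ne_one.symm]
  rw [h1, Fintype.sum_prod_type, Fintype.sum_prod_type]
  simp only [h2, Finset.sum_add_distrib]

omit [Group D] in
theorem card_wreath [Finite D] : Nat.card (D ≀ᵣ C2) = 2 * Nat.card D ^ 2 := by
  rw [RegularWreathProduct.card]
  simp [mul_comm]

/-- The extension of `ψ ⊗ ψ` to the wreath product on whose top group the nontrivial element has
the sign `ε`. -/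
noncomputable def extChar (ε : ℂ) (ψ : D → ℂ) (w : D ≀ᵣ C2) : ℂ :=
  if w.right = 1 then ψ (w.left 1) * ψ (w.left swap) else ε * ψ (w.left 1 * w.left swap)

/-- The character induced from `ψ ⊗ φ`. -/
noncomputable def indChar (ψ φ : D → ℂ) (w : D ≀ᵣ C2) : ℂ :=
  if w.right = 1 then ψ (w.left 1) * φ (w.left swap) + φ (w.left 1) * ψ (w.left swap) else 0

theorem charInner_wreath [Finite D] [Fintype D] (f g : D ≀ᵣ C2 → ℂ) :
    charInner f g = 2⁻¹ * ((Nat.card D : ℂ)⁻¹ ^ 2 *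
        ∑ x, ∑ y, f (mk x y 1) * (starRingEnd ℂ) (g (mk x y 1)) +
      (Nat.card D : ℂ)⁻¹ ^ 2 *
        ∑ x, ∑ y, f (mk x y swap) * (starRingEnd ℂ) (g (mk x y swap))) := by
  have := Fintype.ofFinite (D ≀ᵣ C2)
  rw [charInner_eq_sum, sum_eq, card_wreath]
  push_cast
  rw [mul_inv]
  ring

theorem charInner_mul_charInner [Finite D] [Fintype D] (ψ φ ψ' φ' : D → ℂ) :
    (Nat.card D : ℂ)⁻¹ ^ 2 * ∑ x, ∑ y, ψ x * φ y * ((starRingEnd ℂ) (ψ' x) *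
      (starRingEnd ℂ) (φ' y)) = charInner ψ ψ' * charInner φ φ' := by
  rw [charInner_eq_sum, charInner_eq_sum, mul_mul_mul_comm, Finset.sum_mul_sum, ← sq]
  congr 1
  exact Finset.sum_congr rfl fun x _ => Finset.sum_congr rfl fun y _ => by ring

theorem charInner_extChar [Finite D] (ε δ : ℤˣ) (ψ φ : D → ℂ) :
    charInner (extChar (ε : ℤ) ψ) (extChar (δ : ℤ) φ) =
      2⁻¹ * (charInner ψ φ * charInner ψ φ + (ε : ℤ) * (δ : ℤ) * charInner ψ φ) := by
  have := Fintype.ofFinite D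
  have hD : (Nat.card D : ℂ) ≠ 0 := Nat.cast_ne_zero.2 Nat.card_pos.ne'
  rw [charInner_wreath, ← charInner_mul_charInner]
  congr 2
  · simp [extChar, mk]
  · have h1 : ∀ x : D, ∑ y, ψ (x * y) * (starRingEnd ℂ) (φ (x * y)) =
        ∑ z, ψ z * (starRingEnd ℂ) (φ z) := fun x =>
      Fintype.sum_equiv (Equiv.mulLeft x) _ _ fun y => rfl
    have h2 : ∀ x y : D, extChar (ε : ℤ) ψ (mk x y swap) *
        (starRingEnd ℂ) (extChar (δ : ℤ) φ (mk x y swap)) =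
        ((ε : ℤ) : ℂ) * ((δ : ℤ) : ℂ) * (ψ (x * y) * (starRingEnd ℂ) (φ (x * y))) := by
      intro x y
      simp only [extChar, mk, swap_ne_one, if_false, if_true, map_mul, map_intCast]
      ring
    simp only [h2, ← Finset.mul_sum, h1]
    rw [Finset.sum_const, Finset.card_univ, ← Nat.card_eq_fintype_card, nsmul_eq_mul,
      charInner_eq_sum]
    field_simp

theorem charInner_extChar_indChar [Finite D] (ε : ℂ) (ψ φ φ' : D → ℂ) :
    charInner (extChar ε ψ) (indChar φ φ') = charInner ψ φ * charInner ψ φ' := by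
  have := Fintype.ofFinite D
  rw [charInner_wreath]
  simp only [extChar, indChar, mk, swap_ne_one, if_false, if_true, map_mul, map_add, mul_add,
    Finset.sum_add_distrib, map_zero, mul_zero, Finset.sum_const_zero, charInner_mul_charInner,
    add_zero]
  ring

theorem charInner_indChar [Finite D] (ψ ψ' φ φ' : D → ℂ) :
    charInner (indChar ψ ψ') (indChar φ φ') =
      charInner ψ φ * charInner ψ' φ' + charInner ψ φ' * charInner ψ' φ := by
  have := Fintype.ofFinite D
  rw [charInner_wreath]
  simp only [indChar, mk, swap_ne_one, if_false, if_true, map_mul, map_add, mul_add, add_mul,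
    Finset.sum_add_distrib, map_zero, mul_zero, Finset.sum_const_zero, charInner_mul_charInner,
    add_zero]
  ring

theorem extChar_one (ε : ℂ) (ψ : D → ℂ) : extChar ε ψ 1 = ψ 1 ^ 2 := by
  simp [extChar, sq]

theorem indChar_one (ψ φ : D → ℂ) : indChar ψ φ 1 = 2 * (ψ 1 * φ 1) := by
  simp [indChar]; ring

omit [Group D] in
theorem indChar_comm (ψ φ : D → ℂ) : indChar ψ φ = indChar φ ψ := by
  ext w
  simp [indChar, add_comm]

section Traces

variable {m n : ℕ}

theorem trace_mul_mul_transpose (A : Matrix (Fin m) (Fin m) ℂ) (B : Matrix (Fin n) (Fin n) ℂ)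
    (f : Matrix (Fin m) (Fin n) ℂ →ₗ[ℂ] Matrix (Fin m) (Fin n) ℂ)
    (hf : ∀ X, f X = A * X * Bᵀ) : LinearMap.trace ℂ _ f = A.trace * B.trace := by
  rw [LinearMap.trace_eq_matrix_trace ℂ (Matrix.stdBasis ℂ (Fin m) (Fin n)), Matrix.trace]
  simp only [Matrix.diag_apply, LinearMap.toMatrix_apply, hf, Fintype.sum_prod_type,
    Matrix.stdBasis_eq_single]
  have h : ∀ (i : Fin m) (j : Fin n), ((Matrix.stdBasis ℂ (Fin m) (Fin n)).repr
      (A * Matrix.single i j (1 : ℂ) * Bᵀ)) (i, j) = A i i * B j j := by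
    intro i j
    change (A * Matrix.single i j (1 : ℂ) * Bᵀ) i j = _
    rw [Matrix.mul_assoc, Matrix.mul_apply, Finset.sum_eq_single i]
    · simp
    · intro k _ hk; simp [Matrix.single_mul_apply_of_ne _ _ _ _ _ hk]
    · simp
  simp only [h, Matrix.trace, Matrix.diag_apply, Finset.sum_mul_sum]

theorem trace_mul_transpose_mul (A B : Matrix (Fin n) (Fin n) ℂ) (ε : ℂ)
    (f : Matrix (Fin n) (Fin n) ℂ →ₗ[ℂ] Matrix (Fin n) (Fin n) ℂ)
    (hf : ∀ X, f X = ε • (A * Xᵀ * Bᵀ)) : LinearMap.trace ℂ _ f = ε * (A * B).trace := by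
  rw [LinearMap.trace_eq_matrix_trace ℂ (Matrix.stdBasis ℂ (Fin n) (Fin n)), Matrix.trace]
  simp only [Matrix.diag_apply, LinearMap.toMatrix_apply, hf, Fintype.sum_prod_type,
    Matrix.stdBasis_eq_single]
  have h : ∀ (i : Fin n) (j : Fin n), ((Matrix.stdBasis ℂ (Fin n) (Fin n)).repr
      (ε • (A * (Matrix.single i j (1 : ℂ))ᵀ * Bᵀ))) (i, j) = ε * (A i j * B j i) := by
    intro i j
    change (ε • (A * (Matrix.single i j (1 : ℂ))ᵀ * Bᵀ)) i j = _
    rw [Matrix.transpose_single, Matrix.smul_apply, Matrix.mul_assoc, Matrix.mul_apply,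
      Finset.sum_eq_single j]
    · simp
    · intro k _ hk; simp [Matrix.single_mul_apply_of_ne _ _ _ _ _ hk]
    · simp
  simp only [h, Matrix.trace, Matrix.diag_apply, Matrix.mul_apply, Finset.mul_sum]

end Traces

section Reps

variable {m n : ℕ} (ρ : Representation ℂ D (Fin m → ℂ)) (σ : Representation ℂ D (Fin n → ℂ))

/-- The matrix of a group element in a matrix representation. -/
noncomputable abbrev mat (d : D) : Matrix (Fin m) (Fin m) ℂ := LinearMap.toMatrix' (ρ d)

theorem mat_mul (d d' : D) : mat ρ (d * d') = mat ρ d * mat ρ d' := by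
  simp [mat, LinearMap.toMatrix'_mul]

theorem trace_mat (d : D) : (mat ρ d).trace = ρ.character d :=
  (LinearMap.trace_eq_matrix_trace ℂ (Pi.basisFun ℂ (Fin m)) (ρ d)).symm

/-- The representation `V ⊗ V` of the wreath product, realised on square matrices; the nontrivial
element of the top group acts by the transpose, up to the sign `ε`. -/
noncomputable def extRep (ε : ℤˣ) : Representation ℂ (D ≀ᵣ C2) (Matrix (Fin m) (Fin m) ℂ) where
  toFun w :=
    { toFun := fun X => if w.right = 1 then mat ρ (w.left 1) * X * (mat ρ (w.left swap))ᵀ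
        else ((ε : ℤ) : ℂ) • (mat ρ (w.left 1) * Xᵀ * (mat ρ (w.left swap))ᵀ)
      map_add' := fun X Y => by
        split_ifs <;> simp [Matrix.mul_add, Matrix.add_mul]
      map_smul' := fun c X => by
        split_ifs
        · simp
        · simp [smul_comm ((ε : ℤ) : ℂ) c] }
  map_one' := by ext1; simp [mat]
  map_mul' w w' := by
    have hε : ((ε : ℤ) : ℂ) * ((ε : ℤ) : ℂ) = 1 := by
      rw [← Int.cast_mul, ← Units.val_mul, Int.units_mul_self]; simp
    refine LinearMap.ext fun X => ?_
    obtain ⟨a, s⟩ := w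
    obtain ⟨b, s'⟩ := w'
    rcases C2.eq_one_or_swap s with rfl | rfl <;> rcases C2.eq_one_or_swap s' with rfl | rfl <;>
    simp [swap_mul_swap, swap_inv, mat_mul, Matrix.mul_assoc,
      Matrix.transpose_mul, smul_smul, hε]

theorem character_extRep (ε : ℤˣ) :
    (extRep ρ ε).character = extChar ((ε : ℤ) : ℂ) ρ.character := by
  ext w
  by_cases hw : w.right = 1
  · rw [extChar, if_pos hw, ← trace_mat, ← trace_mat]
    exact trace_mul_mul_transpose _ _ _ fun X => by simp [extRep, hw]
  · rw [extChar, if_neg hw, ← trace_mat, mat_mul]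
    exact trace_mul_transpose_mul _ _ _ _ fun X => by simp [extRep, hw]

/-- The representation of the wreath product induced from `V ⊗ W`, realised on
`V ⊗ W ⊕ W ⊗ V`. -/
noncomputable def indRep : Representation ℂ (D ≀ᵣ C2)
    (Matrix (Fin m) (Fin n) ℂ × Matrix (Fin n) (Fin m) ℂ) where
  toFun w :=
    { toFun := fun X => if w.right = 1 then
          (mat ρ (w.left 1) * X.1 * (mat σ (w.left swap))ᵀ,
            mat σ (w.left 1) * X.2 * (mat ρ (w.left swap))ᵀ)
        else (mat ρ (w.left 1) * X.2ᵀ * (mat σ (w.left swap))ᵀ,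
            mat σ (w.left 1) * X.1ᵀ * (mat ρ (w.left swap))ᵀ)
      map_add' := fun X Y => by
        split_ifs <;> simp [Matrix.mul_add, Matrix.add_mul]
      map_smul' := fun c X => by
        split_ifs <;> simp }
  map_one' := by
    refine LinearMap.ext fun X => ?_
    simp [mat]
  map_mul' w w' := by
    refine LinearMap.ext fun X => ?_
    obtain ⟨a, s⟩ := w
    obtain ⟨b, s'⟩ := w'
    rcases C2.eq_one_or_swap s with rfl | rfl <;> rcases C2.eq_one_or_swap s' with rfl | rfl <;>
    simp [swap_mul_swap, swap_inv, mat_mul, Matrix.mul_assoc,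
      Matrix.transpose_mul]

theorem character_indRep : (indRep ρ σ).character = indChar ρ.character σ.character := by
  ext w
  by_cases hw : w.right = 1
  · rw [indChar, if_pos hw]
    simp only [← trace_mat]
    let f : Matrix (Fin m) (Fin n) ℂ →ₗ[ℂ] Matrix (Fin m) (Fin n) ℂ :=
      LinearMap.fst ℂ _ _ ∘ₗ indRep ρ σ w ∘ₗ LinearMap.inl ℂ _ _
    let g : Matrix (Fin n) (Fin m) ℂ →ₗ[ℂ] Matrix (Fin n) (Fin m) ℂ :=
      LinearMap.snd ℂ _ _ ∘ₗ indRep ρ σ w ∘ₗ LinearMap.inr ℂ _ _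
    have h : indRep ρ σ w = f.prodMap g := by
      refine LinearMap.ext fun X => ?_
      simp [f, g, indRep, hw]
    rw [character, h, LinearMap.trace_prodMap']
    congr 1
    · exact trace_mul_mul_transpose _ _ _ fun X => by simp [f, indRep, hw]
    · exact trace_mul_mul_transpose _ _ _ fun X => by simp [g, indRep, hw]
  · rw [indChar, if_neg hw]
    -- The operator exchanges the two summands, so it is a sum of two operators of square zero.
    let P : (Matrix (Fin m) (Fin n) ℂ × Matrix (Fin n) (Fin m) ℂ) →ₗ[ℂ]
      (Matrix (Fin m) (Fin n) ℂ × Matrix (Fin n) (Fin m) ℂ) :=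
      LinearMap.inl ℂ _ _ ∘ₗ LinearMap.fst ℂ _ _ ∘ₗ indRep ρ σ w
    let Q : (Matrix (Fin m) (Fin n) ℂ × Matrix (Fin n) (Fin m) ℂ) →ₗ[ℂ]
      (Matrix (Fin m) (Fin n) ℂ × Matrix (Fin n) (Fin m) ℂ) :=
      LinearMap.inr ℂ _ _ ∘ₗ LinearMap.snd ℂ _ _ ∘ₗ indRep ρ σ w
    have h : indRep ρ σ w = P + Q := by
      refine LinearMap.ext fun X => ?_
      simp [P, Q]
    have hP : IsNilpotent P := ⟨2, by
      rw [sq]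
      refine LinearMap.ext fun X => ?_
      simp [P, indRep, hw]⟩
    have hQ : IsNilpotent Q := ⟨2, by
      rw [sq]
      refine LinearMap.ext fun X => ?_
      simp [Q, indRep, hw]⟩
    rw [character, h, map_add, (LinearMap.isNilpotent_trace_of_isNilpotent hP).eq_zero,
      (LinearMap.isNilpotent_trace_of_isNilpotent hQ).eq_zero, add_zero]

end Reps

variable [Finite D]

theorem extChar_mem_irrChar (ε : ℤˣ) {ψ : D → ℂ} (hψ : ψ ∈ IrrChar D) :
    extChar ((ε : ℤ) : ℂ) ψ ∈ IrrChar (D ≀ᵣ C2) := by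
  have hψ' := hψ
  obtain ⟨n, ρ, hρ, rfl⟩ := hψ
  rw [← character_extRep]
  apply character_mem_irrChar_of_charInner_self
  rw [character_extRep, charInner_extChar, charInner_irrChar hψ' hψ', if_pos rfl,
    ← Int.cast_mul, ← Units.val_mul, Int.units_mul_self]
  norm_num

theorem indChar_mem_irrChar {ψ φ : D → ℂ} (hψ : ψ ∈ IrrChar D) (hφ : φ ∈ IrrChar D)
    (hne : ψ ≠ φ) : indChar ψ φ ∈ IrrChar (D ≀ᵣ C2) := by
  have hψ' := hψ
  have hφ' := hφ
  obtain ⟨n, ρ, hρ, rfl⟩ := hψ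
  obtain ⟨m, σ, hσ, rfl⟩ := hφ
  rw [← character_indRep]
  apply character_mem_irrChar_of_charInner_self
  rw [character_indRep, charInner_indChar, charInner_irrChar hψ' hψ', charInner_irrChar hφ' hφ',
    charInner_irrChar hψ' hφ', if_pos rfl, if_pos rfl, if_neg hne]
  norm_num

theorem extChar_injOn {ε δ : ℤˣ} {ψ φ : D → ℂ} (hψ : ψ ∈ IrrChar D) (hφ : φ ∈ IrrChar D)
    (h : extChar ((ε : ℤ) : ℂ) ψ = extChar ((δ : ℤ) : ℂ) φ) : ε = δ ∧ ψ = φ := by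
  have h1 := charInner_irrChar (extChar_mem_irrChar ε hψ) (extChar_mem_irrChar δ hφ)
  rw [if_pos h, charInner_extChar, charInner_irrChar hψ hφ] at h1
  split_ifs at h1 with h2
  · refine ⟨?_, h2⟩
    by_contra hne
    have h3 : (ε : ℤ) * δ = -1 := by
      rw [← Units.val_mul]
      rcases Int.units_eq_one_or ε with rfl | rfl <;> rcases Int.units_eq_one_or δ with rfl | rfl <;>
        simp_all
    rw [← Int.cast_mul, h3] at h1
    norm_num at h1
  · norm_num at h1

theorem extChar_ne_indChar (ε : ℤˣ) {ψ φ φ' : D → ℂ} (hψ : ψ ∈ IrrChar D) (hφ : φ ∈ IrrChar D)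
    (hφ' : φ' ∈ IrrChar D) (hne : φ ≠ φ') : extChar ((ε : ℤ) : ℂ) ψ ≠ indChar φ φ' := by
  intro h
  have h1 := charInner_irrChar (extChar_mem_irrChar ε hψ) (indChar_mem_irrChar hφ hφ' hne)
  rw [if_pos h, charInner_extChar_indChar, charInner_irrChar hψ hφ, charInner_irrChar hψ hφ'] at h1
  split_ifs at h1 with h2 h3
  · exact hne (h2.symm.trans h3)
  all_goals norm_num at h1

theorem indChar_eq_iff {ψ φ ψ' φ' : D → ℂ} (hψ : ψ ∈ IrrChar D) (hφ : φ ∈ IrrChar D)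
    (hψ' : ψ' ∈ IrrChar D) (hφ' : φ' ∈ IrrChar D) (hne : ψ ≠ φ) (hne' : ψ' ≠ φ') :
    indChar ψ' φ' = indChar ψ φ ↔ (ψ' = ψ ∧ φ' = φ) ∨ (ψ' = φ ∧ φ' = ψ) := by
  constructor
  · intro h
    have h1 := charInner_irrChar (indChar_mem_irrChar hψ' hφ' hne') (indChar_mem_irrChar hψ hφ hne)
    rw [if_pos h, charInner_indChar, charInner_irrChar hψ' hψ, charInner_irrChar hφ' hφ,
      charInner_irrChar hψ' hφ, charInner_irrChar hφ' hψ] at h1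
    by_contra hcon
    rw [not_or] at hcon
    split_ifs at h1 <;> simp_all
  · rintro (⟨rfl, rfl⟩ | ⟨rfl, rfl⟩)
    · rfl
    · exact indChar_comm _ _

/-- The total degree of `D ≀ 2`: the irreducible characters are the two extensions of each
`ψ ⊗ ψ`, of degree `ψ(1)²`, and one induced character of degree `2ψ(1)φ(1)` for each pair
`{ψ, φ}`; the sum of their squared degrees is the group order. -/
theorem totalCharacter_wreath_one :
    totalCharacter (D ≀ᵣ C2) 1 = totalCharacter D 1 ^ 2 + Nat.card D := by
  classical
  let I := irrFinset D
  have hI : ∀ ψ ∈ I, ψ ∈ IrrChar D := fun ψ hψ => mem_irrFinset.1 hψ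
  let E : ℤˣ → Finset (D ≀ᵣ C2 → ℂ) := fun ε => I.image (extChar ((ε : ℤ) : ℂ))
  let K : Finset (D ≀ᵣ C2 → ℂ) := I.offDiag.image fun p => indChar p.1 p.2
  have hEsum : ∀ (ε : ℤˣ) (f : ℂ → ℂ), ∑ χ ∈ E ε, f (χ 1) = ∑ ψ ∈ I, f (ψ 1 ^ 2) := by
    intro ε f
    rw [Finset.sum_image]
    · simp only [extChar_one]
    · intro ψ hψ φ hφ h
      exact (extChar_injOn (hI _ hψ) (hI _ hφ) h).2
  have hKsum : ∀ f : ℂ → ℂ, 2 * ∑ χ ∈ K, f (χ 1) =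
      ∑ p ∈ I.offDiag, f (2 * (p.1 1 * p.2 1)) := by
    intro f
    have h1 := Finset.sum_comp (s := I.offDiag) (fun χ : D ≀ᵣ C2 → ℂ => f (χ 1))
      (fun p => indChar p.1 p.2)
    simp only [indChar_one] at h1
    rw [h1, Finset.mul_sum]
    refine Finset.sum_congr rfl fun χ hχ => ?_
    obtain ⟨⟨ψ, φ⟩, hp, rfl⟩ := Finset.mem_image.1 hχ
    obtain ⟨hψ, hφ, hne⟩ := Finset.mem_offDiag.1 hp
    have h2 : (I.offDiag.filter fun a => indChar a.1 a.2 = indChar ψ φ) =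
        {(ψ, φ), (φ, ψ)} := by
      ext ⟨a, b⟩
      simp only [Finset.mem_filter, Finset.mem_offDiag, Finset.mem_insert, Finset.mem_singleton,
        Prod.mk.injEq]
      constructor
      · rintro ⟨⟨ha, hb, hab⟩, h⟩
        exact (indChar_eq_iff (hI _ hψ) (hI _ hφ) (hI _ ha) (hI _ hb) hne hab).1 h
      · rintro (⟨rfl, rfl⟩ | ⟨rfl, rfl⟩)
        · exact ⟨⟨hψ, hφ, hne⟩, rfl⟩
        · exact ⟨⟨hφ, hψ, hne.symm⟩, indChar_comm _ _⟩
    rw [h2, Finset.card_pair, nsmul_eq_mul, Nat.cast_two]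
    exact fun h => hne (congrArg Prod.fst h)
  have hEE : Disjoint (E 1) (E (-1)) := by
    rw [Finset.disjoint_left]
    rintro χ h1 h2
    obtain ⟨ψ, hψ, rfl⟩ := Finset.mem_image.1 h1
    obtain ⟨φ, hφ, h⟩ := Finset.mem_image.1 h2
    have := (extChar_injOn (hI _ hφ) (hI _ hψ) h).1
    revert this; decide
  have hEK : Disjoint (E 1 ∪ E (-1)) K := by
    rw [Finset.disjoint_left]
    intro χ h1 h2
    obtain ⟨⟨φ, φ'⟩, hp, rfl⟩ := Finset.mem_image.1 h2
    obtain ⟨hφ, hφ', hne⟩ := Finset.mem_offDiag.1 hp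
    rcases Finset.mem_union.1 h1 with h1 | h1 <;> obtain ⟨ψ, hψ, h⟩ := Finset.mem_image.1 h1 <;>
    exact extChar_ne_indChar _ (hI _ hψ) (hI _ hφ) (hI _ hφ') hne h
  have hsum : ∀ f : ℂ → ℂ, 2 * ∑ χ ∈ E 1 ∪ E (-1) ∪ K, f (χ 1) =
      4 * ∑ ψ ∈ I, f (ψ 1 ^ 2) + ∑ p ∈ I.offDiag, f (2 * (p.1 1 * p.2 1)) := by
    intro f
    rw [Finset.sum_union hEK, Finset.sum_union hEE, hEsum, hEsum, ← hKsum]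
    ring
  have hoff : ∀ h : (D → ℂ) → ℂ, ∑ p ∈ I.offDiag, h p.1 * h p.2 =
      (∑ ψ ∈ I, h ψ) ^ 2 - ∑ ψ ∈ I, h ψ ^ 2 := by
    intro h
    rw [sq, Finset.sum_mul_sum, ← Finset.sum_product', ← Finset.diag_union_offDiag,
      Finset.sum_union (Finset.disjoint_diag_offDiag I), Finset.sum_diag]
    simp only [sq]
    ring
  have hsq : ∑ ψ ∈ I, ψ 1 ^ 2 = (Nat.card D : ℂ) := sum_irrChar_one_sq
  have hL : E 1 ∪ E (-1) ∪ K = irrFinset (D ≀ᵣ C2) := by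
    apply eq_irrFinset_of_sum_sq
    · intro χ hχ
      rcases Finset.mem_union.1 hχ with hχ | hχ
      · rcases Finset.mem_union.1 hχ with hχ | hχ <;>
        · obtain ⟨ψ, hψ, rfl⟩ := Finset.mem_image.1 hχ
          exact extChar_mem_irrChar _ (hI _ hψ)
      · obtain ⟨⟨φ, φ'⟩, hp, rfl⟩ := Finset.mem_image.1 hχ
        obtain ⟨hφ, hφ', hne⟩ := Finset.mem_offDiag.1 hp
        exact indChar_mem_irrChar (hI _ hφ) (hI _ hφ') hne
    · have h1 := hsum fun z => z ^ 2
      have h2 : ∑ p ∈ I.offDiag, (2 * (p.1 1 * p.2 1)) ^ 2 =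
          4 * ((Nat.card D : ℂ) ^ 2 - ∑ ψ ∈ I, (ψ 1 ^ 2) ^ 2) := by
        rw [← hsq, ← hoff fun ψ => ψ 1 ^ 2, Finset.mul_sum]
        exact Finset.sum_congr rfl fun p _ => by ring
      rw [h2] at h1
      rw [card_wreath]
      push_cast
      linear_combination h1 / 2
  have h1 := hsum fun z => z
  have h2 : ∑ p ∈ I.offDiag, (2 * (p.1 1 * p.2 1)) =
      2 * (totalCharacter D 1 ^ 2 - Nat.card D) := by
    rw [totalCharacter_one, ← hsq, ← hoff fun ψ => ψ 1, Finset.mul_sum]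
  rw [h2, hsq, hL, ← totalCharacter_one] at h1
  linear_combination h1 / 2

end WreathTwo

/-! ### The total degree of the special linear group of degree two in characteristic two -/

namespace FiniteGroupCharacters

open Representation Module

/-- If the compressions `P ρ(g) P` of an irreducible representation by an idempotent `P` commute,
then each of them is a scalar on the range of `P`, and as they act irreducibly there, `P` has rank
at most one. -/
theorem finrank_range_le_one {G V : Type*} [Group G] [AddCommGroup V] [Module ℂ V]
    [FiniteDimensional ℂ V] (ρ : Representation ℂ G V) (hρ : ρ.IsIrreducible)
    (P : V →ₗ[ℂ] V) (hP : ∀ v, P (P v) = P v)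
    (hcomm : ∀ g h v, P (ρ g (P (ρ h (P v)))) = P (ρ h (P (ρ g (P v))))) :
    finrank ℂ (LinearMap.range P) ≤ 1 := by
  rw [isIrreducible_iff_submodule] at hρ
  have hfix : ∀ v ∈ LinearMap.range P, P v = v := by
    rintro _ ⟨v, rfl⟩; exact hP v
  have hspan : ∀ v ∈ LinearMap.range P, v ≠ 0 → ∀ w ∈ LinearMap.range P,
      w ∈ Submodule.span ℂ (Set.range fun g => P (ρ g v)) := by
    intro v hv hv0 w hw
    have h1 : Submodule.span ℂ (Set.range fun g => ρ g v) = ⊤ := by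
      refine (hρ.2 _ fun g x hx => ?_).resolve_left fun h => hv0 ?_
      · induction hx using Submodule.span_induction with
        | mem x hx =>
          obtain ⟨h, rfl⟩ := hx
          exact Submodule.subset_span ⟨g * h, by simp⟩
        | zero => simp
        | add x y _ _ hx hy => rw [map_add]; exact add_mem hx hy
        | smul c x _ hx => rw [map_smul]; exact Submodule.smul_mem _ _ hx
      · have : ρ 1 v ∈ Submodule.span ℂ (Set.range fun g => ρ g v) :=
          Submodule.subset_span ⟨1, rfl⟩
        rw [h] at this
        simpa using this
    have h2 : w ∈ (Submodule.span ℂ (Set.range fun g => ρ g v)).map P := by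
      rw [h1]; exact ⟨w, trivial, hfix w hw⟩
    rw [Submodule.map_span, ← Set.range_comp] at h2
    exact h2
  rcases subsingleton_or_nontrivial (LinearMap.range P) with hs | hs
  · rw [finrank_zero_of_subsingleton]; exact zero_le_one
  have hscal : ∀ g, ∃ μ : ℂ, ∀ w ∈ LinearMap.range P, P (ρ g w) = μ • w := by
    intro g
    let T : Module.End ℂ (LinearMap.range P) :=
      (P ∘ₗ ρ g).restrict fun x _ => ⟨ρ g x, rfl⟩
    obtain ⟨μ, hμ⟩ := Module.End.exists_eigenvalue T
    obtain ⟨v, hv⟩ := hμ.exists_hasEigenvector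
    have hv1 : P (ρ g v.1) = μ • v.1 := congrArg Subtype.val hv.apply_eq_smul
    have hv0 : v.1 ≠ 0 := fun h => hv.2 (Subtype.ext h)
    refine ⟨μ, fun w hw => ?_⟩
    have hw' := hspan v.1 v.2 hv0 w hw
    clear hw
    induction hw' using Submodule.span_induction with
    | mem x hx =>
      obtain ⟨h, rfl⟩ := hx
      have := hcomm g h v.1
      rw [hfix v.1 v.2] at this
      rw [this, hv1, map_smul, map_smul]
    | zero => simp
    | add x y _ _ hx hy => rw [map_add, map_add, hx, hy, smul_add]
    | smul c x _ hx => rw [map_smul, map_smul, hx, smul_comm]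
  obtain ⟨v, hv⟩ := exists_ne (0 : LinearMap.range P)
  refine finrank_le_one v fun w => ?_
  have := hspan v.1 v.2 (fun h => hv (Subtype.ext h)) w.1 w.2
  have h2 : w.1 ∈ Submodule.span ℂ {v.1} := by
    refine Submodule.span_le.2 ?_ this
    rintro _ ⟨g, rfl⟩
    obtain ⟨μ, hμ⟩ := hscal g
    change P (ρ g v.1) ∈ _
    rw [hμ v.1 v.2]
    exact Submodule.smul_mem _ _ (Submodule.mem_span_singleton_self _)
  obtain ⟨c, hc⟩ := Submodule.mem_span_singleton.1 h2
  exact ⟨c, Subtype.ext hc⟩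

theorem one_mem_irrChar (G : Type*) [Group G] : (fun _ => 1 : G → ℂ) ∈ IrrChar G := by
  have h : (trivial ℂ G ℂ).IsIrreducible := by
    rw [isIrreducible_iff_submodule]
    exact ⟨inferInstance, fun W _ => eq_bot_or_eq_top W⟩
  convert character_mem_irrChar _ h using 1
  ext g
  have : trivial ℂ G ℂ g = LinearMap.id := by ext; simp
  simp [character, this]

theorem character_eq_one_of_forall_eq_one {G V : Type*} [Group G] [AddCommGroup V] [Module ℂ V]
    [FiniteDimensional ℂ V] (ρ : Representation ℂ G V) (hρ : ρ.IsIrreducible)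
    (h : ∀ g, ρ g = 1) : ρ.character = fun _ => 1 := by
  rw [isIrreducible_iff_submodule] at hρ
  obtain ⟨hV, hρ⟩ := hρ
  obtain ⟨v, hv⟩ := exists_ne (0 : V)
  have h1 : finrank ℂ V = 1 := by
    refine finrank_eq_one v hv fun w => ?_
    have := (hρ (Submodule.span ℂ {v}) fun g x hx => by simpa [h] using hx).resolve_left
      (by simpa using hv)
    exact Submodule.mem_span_singleton.1 (this ▸ Submodule.mem_top)
  ext g
  have h2 := Representation.char_one ρ
  rw [h1, Nat.cast_one, character, map_one] at h2
  rw [character, h, h2]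

end FiniteGroupCharacters

namespace SpecialLinearTwo

open FiniteGroupCharacters Representation Module Matrix MonoidAlgebra

variable {F : Type*} [Field F]

/-- The upper unitriangular matrix with entry `x`. -/
def upper (x : F) : SpecialLinearGroup (Fin 2) F := ⟨!![1, x; 0, 1], by simp⟩

/-- The lower unitriangular matrix with entry `x`. -/
def lower (x : F) : SpecialLinearGroup (Fin 2) F := ⟨!![1, 0; x, 1], by simp⟩

/-- The diagonal matrix with entries `a` and `a⁻¹`. -/
def torus (a : Fˣ) : SpecialLinearGroup (Fin 2) F :=
  ⟨!![(a : F), 0; 0, ((a⁻¹ : Fˣ) : F)], by simp⟩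

@[simp] theorem coe_upper (x : F) : (upper x : Matrix (Fin 2) (Fin 2) F) = !![1, x; 0, 1] := rfl

@[simp] theorem coe_lower (x : F) : (lower x : Matrix (Fin 2) (Fin 2) F) = !![1, 0; x, 1] := rfl

@[simp] theorem coe_torus (a : Fˣ) :
    (torus a : Matrix (Fin 2) (Fin 2) F) = !![(a : F), 0; 0, ((a⁻¹ : Fˣ) : F)] := rfl

theorem ext_entries {g h : SpecialLinearGroup (Fin 2) F} (h00 : g 0 0 = h 0 0)
    (h01 : g 0 1 = h 0 1) (h10 : g 1 0 = h 1 0) (h11 : g 1 1 = h 1 1) : g = h := by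
  apply Subtype.ext
  ext i j
  fin_cases i <;> fin_cases j <;> assumption

theorem det_entries (g : SpecialLinearGroup (Fin 2) F) :
    g 0 0 * g 1 1 - g 0 1 * g 1 0 = 1 := by
  have := g.2
  rwa [Matrix.det_fin_two] at this

theorem eq_upper_lower_upper (g : SpecialLinearGroup (Fin 2) F) (hc : g 1 0 ≠ 0) :
    g = upper ((g 0 0 - 1) / g 1 0) * lower (g 1 0) *
      upper ((g 1 1 - 1) / g 1 0) := by
  have hd := det_entries g
  apply ext_entries <;> simp [Matrix.mul_apply, Fin.sum_univ_two] <;> field_simp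
  · ring
  · linear_combination (-1 : F) * hd
  · ring

/-- A normal subgroup containing the upper unitriangular matrices is the whole group. -/
theorem eq_top_of_upper_mem (N : Subgroup (SpecialLinearGroup (Fin 2) F)) [N.Normal]
    (h : ∀ x, upper x ∈ N) : N = ⊤ := by
  obtain ⟨w, hw⟩ : ∃ w : SpecialLinearGroup (Fin 2) F,
      (w : Matrix (Fin 2) (Fin 2) F) = !![0, 1; -1, 0] := ⟨⟨!![0, 1; -1, 0], by simp⟩, rfl⟩
  have hlow : ∀ x, lower x ∈ N := by
    intro x
    have h1 := Subgroup.Normal.conj_mem ‹_› _ (h (-x)) w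
    have h2 : w * upper (-x) * w⁻¹ = lower x := by
      rw [mul_inv_eq_iff_eq_mul]
      apply ext_entries <;>
        simp [hw, Matrix.mul_apply, Fin.sum_univ_two]
    rwa [h2] at h1
  have hne : ∀ g : SpecialLinearGroup (Fin 2) F, g 1 0 ≠ 0 → g ∈ N := fun g hg => by
    rw [eq_upper_lower_upper g hg]
    exact mul_mem (mul_mem (h _) (hlow _)) (h _)
  rw [eq_top_iff]
  rintro g -
  by_cases hc : g 1 0 = 0
  · have h1 : lower 1 * g ∈ N := by
      apply hne
      have ha : g 0 0 ≠ 0 := by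
        intro ha
        have := det_entries g
        simp [ha, hc] at this
      simpa [Matrix.mul_apply, Fin.sum_univ_two, hc] using ha
    exact (Subgroup.mul_mem_cancel_left N (hlow 1)).1 h1
  · exact hne g hc

theorem card_eq [Finite F] :
    Nat.card (SpecialLinearGroup (Fin 2) F) = Nat.card F * (Nat.card F ^ 2 - 1) := by
  have := Fintype.ofFinite F
  have h1 : Nat.card (GL (Fin 2) F) = Nat.card (SpecialLinearGroup (Fin 2) F) * Nat.card Fˣ := by
    rw [← Subgroup.card_mul_index (Matrix.GeneralLinearGroup.det (n := Fin 2) (R := F)).ker,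
      Subgroup.index_ker, MonoidHom.range_eq_top.2 Matrix.GeneralLinearGroup.det_surjective,
      Subgroup.card_top]
    congr 1
    refine Nat.card_congr ⟨fun g => ⟨g.1.1, ?_⟩, fun g => ⟨g.toGL, ?_⟩, fun g => ?_, fun g => ?_⟩
    · have := congrArg Units.val g.2
      simpa using this
    · rw [MonoidHom.mem_ker]
      ext
      simp
    · apply Subtype.ext; ext; rfl
    · rfl
  have hq : 2 ≤ Nat.card F := Finite.one_lt_card
  rw [Matrix.card_GL_field, Nat.card_units, ← Nat.card_eq_fintype_card, Fin.prod_univ_two] at h1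
  generalize Nat.card F = q at *
  generalize Nat.card (SpecialLinearGroup (Fin 2) F) = n at *
  obtain ⟨r, rfl⟩ : ∃ r, q = r + 2 := ⟨q - 2, by omega⟩
  have h2 : (r + 2) ^ 2 - (r + 2) ^ ((1 : Fin 2) : ℕ) = (r + 2) * (r + 1) := by
    simp only [Fin.val_one, pow_one]
    rw [Nat.sub_eq_iff_eq_add (by nlinarith)]; ring
  rw [h2, show r + 2 - 1 = r + 1 by omega] at h1
  simp only [Fin.val_zero, pow_zero] at h1
  have h3 : n * (r + 1) = ((r + 2) * ((r + 2) ^ 2 - 1)) * (r + 1) := by rw [← h1]; ring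
  exact Nat.eq_of_mul_eq_mul_right (by omega) h3

section GelfandGraev

variable [Finite F] [CharP F 2]

/-- The idempotent of the group algebra belonging to the character `x ↦ lam (c * x)` of the upper
unitriangular group. In characteristic two the values of `lam` are `±1`, and no inverse is
needed. -/
noncomputable def unipIdem (lam : AddChar F ℂ) (c : F) :
    MonoidAlgebra ℂ (SpecialLinearGroup (Fin 2) F) :=
  (Nat.card F : ℂ)⁻¹ • ∑ᶠ x : F, lam (c * x) • of ℂ _ (upper x)

omit [Finite F] [CharP F 2] in
theorem upper_mul (x y : F) : upper x * upper y = upper (x + y) := by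
  apply ext_entries <;> simp [Matrix.mul_apply, Fin.sum_univ_two, add_comm]

omit [Finite F] [CharP F 2] in
theorem upper_zero : upper (0 : F) = 1 := by
  apply ext_entries <;> simp

omit [Finite F] in
theorem addChar_mul_self (lam : AddChar F ℂ) (x : F) : lam x * lam x = 1 := by
  rw [← AddChar.map_add_eq_mul, CharTwo.add_self_eq_zero, AddChar.map_zero_eq_one]

theorem unipIdem_mul_upper (lam : AddChar F ℂ) (c y : F) :
    unipIdem lam c * of ℂ _ (upper y) = lam (c * y) • unipIdem lam c := by
  have := Fintype.ofFinite F
  simp only [unipIdem, finsum_eq_sum_of_fintype, smul_mul_assoc, Finset.sum_mul, ← map_mul,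
    upper_mul]
  rw [smul_comm (lam (c * y)), Finset.smul_sum (r := lam (c * y))]
  congr 1
  refine Fintype.sum_equiv (_root_.Equiv.addRight y) _ _ fun x => ?_
  rw [Equiv.coe_addRight, smul_smul, mul_add, AddChar.map_add_eq_mul, mul_left_comm,
    addChar_mul_self, mul_one]

theorem upper_mul_unipIdem (lam : AddChar F ℂ) (c y : F) :
    of ℂ _ (upper y) * unipIdem lam c = lam (c * y) • unipIdem lam c := by
  rw [← unipIdem_mul_upper]
  have := Fintype.ofFinite F
  simp only [unipIdem, finsum_eq_sum_of_fintype, smul_mul_assoc, Finset.sum_mul, ← map_mul,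
    upper_mul, mul_smul_comm, Finset.mul_sum, add_comm]

theorem unipIdem_mul_self (lam : AddChar F ℂ) (c : F) :
    unipIdem lam c * unipIdem lam c = unipIdem lam c := by
  have := Fintype.ofFinite F
  have hq : (Nat.card F : ℂ) ≠ 0 := Nat.cast_ne_zero.2 Nat.card_pos.ne'
  generalize hf : unipIdem lam c = f
  conv_lhs => enter [1]; rw [← hf, unipIdem]
  have h1 := upper_mul_unipIdem lam c
  rw [hf] at h1
  rw [smul_mul_assoc, finsum_eq_sum_of_fintype, Finset.sum_mul]
  simp only [smul_mul_assoc, h1, smul_smul, addChar_mul_self, one_smul]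
  rw [Finset.sum_const, Finset.card_univ, ← Nat.card_eq_fintype_card, ← Nat.cast_smul_eq_nsmul ℂ,
    smul_smul, inv_mul_cancel₀ hq, one_smul]

omit [CharP F 2] in
theorem sum_unipIdem {lam : AddChar F ℂ} (hlam : lam.IsPrimitive) [Fintype F] :
    ∑ c, unipIdem lam c = 1 := by
  classical
  have hq : (Nat.card F : ℂ) ≠ 0 := Nat.cast_ne_zero.2 Nat.card_pos.ne'
  simp only [unipIdem, finsum_eq_sum_of_fintype, ← Finset.smul_sum]
  rw [Finset.sum_comm]
  simp only [← Finset.sum_smul, AddChar.sum_mulShift _ hlam]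
  rw [Finset.sum_eq_single 0]
  · rw [if_pos rfl, smul_smul, upper_zero, map_one, ← Nat.card_eq_fintype_card,
      inv_mul_cancel₀ hq, one_smul]
  · intro x _ hx; simp [hx]
  · simp

omit [Finite F] [CharP F 2] in
theorem torus_mul_upper (a : Fˣ) (x : F) :
    torus a * upper x = upper (a * a * x) * torus a := by
  apply ext_entries <;> simp [Matrix.mul_apply, Fin.sum_univ_two]
  field_simp

omit [CharP F 2] in
theorem torus_mul_unipIdem (lam : AddChar F ℂ) (a : Fˣ) (c : F) :
    of ℂ _ (torus a) * unipIdem lam (a * a * c) = unipIdem lam c * of ℂ _ (torus a) := by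
  have := Fintype.ofFinite F
  simp only [unipIdem, finsum_eq_sum_of_fintype, smul_mul_assoc, mul_smul_comm, Finset.mul_sum,
    Finset.sum_mul, ← map_mul, torus_mul_upper]
  congr 1
  refine Fintype.sum_equiv (Equiv.mulLeft₀ ((a : F) * a) (by simp)) _ _ fun x => ?_
  change _ = lam (c * (a * a * x)) • _
  rw [show (a : F) * a * c * x = c * (a * a * x) by ring]
  rfl

/-- An irreducible representation in which `unipIdem lam 1` acts as zero is trivial: conjugation by
the torus, where all elements are squares, moves `unipIdem lam 1` to all `unipIdem lam c` with
`c ≠ 0`, so that the upper unitriangular group acts trivially. -/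
theorem eq_one_of_unipIdem_eq_zero {lam : AddChar F ℂ} (hlam : lam.IsPrimitive) {V : Type*}
    [AddCommGroup V] [Module ℂ V] (ρ : Representation ℂ (SpecialLinearGroup (Fin 2) F) V)
    (h : ρ.asAlgebraHom (unipIdem lam 1) = 0) (g : SpecialLinearGroup (Fin 2) F) : ρ g = 1 := by
  classical
  have := Fintype.ofFinite F
  have h1 : ∀ c : F, c ≠ 0 → ρ.asAlgebraHom (unipIdem lam c) = 0 := by
    intro c hc
    obtain ⟨b, rfl⟩ := FiniteField.isSquare_of_char_two (ringChar.eq F 2) c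
    have hb : b ≠ 0 := fun hb => hc (by simp [hb])
    let a : Fˣ := Units.mk0 b hb
    have h2 := torus_mul_unipIdem lam a 1
    have h3 : unipIdem lam (b * b) = of ℂ _ (torus a⁻¹) * (unipIdem lam 1 * of ℂ _ (torus a)) := by
      rw [← h2, ← mul_assoc, ← map_mul]
      have : torus a⁻¹ * torus a = 1 := by
        apply ext_entries <;> simp [Matrix.mul_apply, Fin.sum_univ_two]
      rw [this, map_one, one_mul]
      simp [a]
    rw [h3, map_mul, map_mul, h, zero_mul, mul_zero]
  have h0 : ρ.asAlgebraHom (unipIdem lam 0) = 1 := by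
    rw [← map_one ρ.asAlgebraHom, ← sum_unipIdem hlam, map_sum,
      Finset.sum_eq_single (0 : F) (fun c _ hc => h1 c hc) (by simp)]
  have hN : (MonoidHom.ker ρ) = ⊤ := by
    apply eq_top_of_upper_mem
    intro x
    rw [MonoidHom.mem_ker, ← asAlgebraHom_of, ← one_mul (ρ.asAlgebraHom _), ← h0, ← map_mul,
      unipIdem_mul_upper, zero_mul, AddChar.map_zero_eq_one, one_smul]
  have : g ∈ MonoidHom.ker ρ := by rw [hN]; trivial
  exact this

/-- The anti-automorphism `x ↦ w xᵀ w` reflecting a matrix in its antidiagonal. -/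
def flip (g : SpecialLinearGroup (Fin 2) F) : SpecialLinearGroup (Fin 2) F :=
  ⟨!![g 1 1, g 0 1; g 1 0, g 0 0], by
    rw [Matrix.det_fin_two_of]
    linear_combination det_entries g⟩

omit [Finite F] [CharP F 2] in
@[simp] theorem coe_flip (g : SpecialLinearGroup (Fin 2) F) :
    (flip g : Matrix (Fin 2) (Fin 2) F) = !![g 1 1, g 0 1; g 1 0, g 0 0] := rfl

omit [Finite F] [CharP F 2] in
theorem flip_mul (g h : SpecialLinearGroup (Fin 2) F) : flip (g * h) = flip h * flip g := by
  apply ext_entries <;> simp [Matrix.mul_apply, Fin.sum_univ_two] <;> ring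

omit [Finite F] [CharP F 2] in
theorem flip_upper (x : F) : flip (upper x) = upper x := by
  apply ext_entries <;> simp

theorem unipIdem_torus_eq_zero {lam : AddChar F ℂ} (hlam : lam.IsPrimitive)
    (g : SpecialLinearGroup (Fin 2) F) (hc : g 1 0 = 0) (hne : g 0 0 ≠ g 1 1) :
    unipIdem lam 1 * of ℂ _ g * unipIdem lam 1 = 0 := by
  have hd := det_entries g
  rw [hc, mul_zero, sub_zero] at hd
  have ha : g 0 0 ≠ 0 := left_ne_zero_of_mul_eq_one hd
  set a := g 0 0 with ha'
  have hcomm : ∀ x, g * upper x = upper (a * a * x) * g := by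
    intro x
    apply ext_entries <;> simp [Matrix.mul_apply, Fin.sum_univ_two, hc, ← ha']
    linear_combination (-(a * x)) * hd
  have h1 : ∀ x, lam x • (unipIdem lam 1 * of ℂ _ g * unipIdem lam 1) =
      lam (a * a * x) • (unipIdem lam 1 * of ℂ _ g * unipIdem lam 1) := by
    intro x
    have h2 := upper_mul_unipIdem lam 1 x
    have h3 := unipIdem_mul_upper lam 1 (a * a * x)
    rw [one_mul] at h2 h3
    rw [← mul_smul_comm, ← h2, ← smul_mul_assoc, ← smul_mul_assoc, ← h3, mul_assoc, mul_assoc,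
      mul_assoc, ← mul_assoc (of ℂ _ g), ← map_mul, hcomm, map_mul, mul_assoc]
  by_contra hne0
  refine hlam (a := a * a + 1) ?_ ?_
  · intro h0
    have h2 : (a + 1) * (a + 1) = 0 := by
      linear_combination h0 + a * CharTwo.two_eq_zero (R := F)
    have h3 : a = 1 := by
      have := CharTwo.add_eq_zero.1 (mul_self_eq_zero.1 h2)
      exact this
    rw [h3, one_mul] at hd
    exact hne (by rw [h3, hd])
  · ext x
    rw [AddChar.mulShift_apply, add_mul, one_mul, AddChar.map_add_eq_mul,
      ← smul_left_injective ℂ hne0 (h1 x)]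
    simpa using addChar_mul_self lam x

theorem unipIdem_flip {lam : AddChar F ℂ} (hlam : lam.IsPrimitive)
    (g : SpecialLinearGroup (Fin 2) F) :
    unipIdem lam 1 * of ℂ _ (flip g) * unipIdem lam 1 =
      unipIdem lam 1 * of ℂ _ g * unipIdem lam 1 := by
  by_cases hc : g 1 0 = 0
  · by_cases hne : g 0 0 = g 1 1
    · congr 3
      apply ext_entries <;> simp [hne]
    · rw [unipIdem_torus_eq_zero hlam g hc hne, unipIdem_torus_eq_zero hlam (flip g)
        (by simpa using hc) (by simpa using Ne.symm hne)]
  · set s := (g 0 0 + g 1 1) / g 1 0 with hs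
    have h1 : g = upper s * flip g * upper s := by
      have hd := det_entries g
      have h2 := CharTwo.two_eq_zero (R := F)
      apply ext_entries <;> simp [Matrix.mul_apply, Fin.sum_univ_two, hs] <;>
        field_simp
      · linear_combination -(g 1 1) * h2
      · linear_combination (-(g 0 0 * g 1 1) - g 0 0 ^ 2 - g 1 1 ^ 2 - g 0 0 * g 1 1) * h2
      · linear_combination -(g 0 0) * h2
    conv_rhs => rw [h1]
    rw [map_mul, map_mul, ← mul_assoc, ← mul_assoc, unipIdem_mul_upper,
      mul_assoc _ (of ℂ _ (upper s)), upper_mul_unipIdem, smul_mul_assoc, smul_mul_assoc,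
      mul_smul_comm, smul_smul, addChar_mul_self, one_smul]

/-- The Hecke algebra of a nondegenerate character of the unitriangular group is commutative, as
`flip` induces an anti-automorphism fixing it pointwise. -/
theorem unipIdem_comm {lam : AddChar F ℂ} (hlam : lam.IsPrimitive)
    (g h : SpecialLinearGroup (Fin 2) F) :
    unipIdem lam 1 * of ℂ _ g * unipIdem lam 1 * of ℂ _ h * unipIdem lam 1 =
      unipIdem lam 1 * of ℂ _ h * unipIdem lam 1 * of ℂ _ g * unipIdem lam 1 := by
  have := Fintype.ofFinite F
  -- The middle idempotent is expanded, and each term is flipped.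
  have hexp : ∀ a b : MonoidAlgebra ℂ (SpecialLinearGroup (Fin 2) F), a * unipIdem lam 1 * b =
      (Nat.card F : ℂ)⁻¹ • ∑ x, lam x • (a * of ℂ _ (upper x) * b) := by
    intro a b
    simp only [unipIdem, finsum_eq_sum_of_fintype, one_mul, smul_mul_assoc, mul_smul_comm,
      Finset.mul_sum, Finset.sum_mul]
  have key : ∀ k l : SpecialLinearGroup (Fin 2) F,
      unipIdem lam 1 * of ℂ _ k * unipIdem lam 1 * of ℂ _ l * unipIdem lam 1 =
      (Nat.card F : ℂ)⁻¹ • ∑ x, lam x • (unipIdem lam 1 * of ℂ _ (k * upper x * l) *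
        unipIdem lam 1) := by
    intro k l
    rw [mul_assoc _ (of ℂ _ l), hexp (unipIdem lam 1 * of ℂ _ k)]
    refine congrArg _ (Finset.sum_congr rfl fun x _ => ?_)
    simp only [map_mul, mul_assoc]
  have hfl : ∀ k l : SpecialLinearGroup (Fin 2) F,
      unipIdem lam 1 * of ℂ _ (flip l) * unipIdem lam 1 * of ℂ _ (flip k) * unipIdem lam 1 =
      unipIdem lam 1 * of ℂ _ k * unipIdem lam 1 * of ℂ _ l * unipIdem lam 1 := by
    intro k l
    rw [key (flip l) (flip k), key k l]
    refine congrArg _ (Finset.sum_congr rfl fun x _ => ?_)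
    rw [← unipIdem_flip hlam (k * upper x * l), flip_mul, flip_mul, flip_upper, mul_assoc (flip l)]
  rw [← hfl g h, unipIdem_flip hlam h, mul_assoc _ _ (unipIdem lam 1),
    mul_assoc _ _ (of ℂ _ (flip g) * _), ← mul_assoc (unipIdem lam 1) (of ℂ _ (flip g)),
    unipIdem_flip hlam g]
  simp only [mul_assoc]

/-- The total degree: with the trivial character left aside, all irreducible characters occur in
the Gelfand–Graev character exactly once, and the degree of that character is the index `q² - 1`
of the unitriangular group. -/
theorem totalCharacter_one_eq :
    totalCharacter (SpecialLinearGroup (Fin 2) F) 1 = (Nat.card F : ℂ) ^ 2 := by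
  classical
  have := Fintype.ofFinite F
  have hq : (Nat.card F : ℂ) ≠ 0 := Nat.cast_ne_zero.2 Nat.card_pos.ne'
  obtain ⟨lam, hlam1⟩ := AddChar.exists_apply_ne_zero.2 (one_ne_zero (α := F))
  have hne : lam ≠ 1 := fun h => hlam1 (by rw [h]; rfl)
  have hlam : lam.IsPrimitive := AddChar.IsPrimitive.of_ne_one hne
  have hsum0 : ∑ x, lam x = 0 := AddChar.sum_eq_zero_of_ne_one hne
  let mult : (SpecialLinearGroup (Fin 2) F → ℂ) → ℂ :=
    fun χ => (Nat.card F : ℂ)⁻¹ * ∑ x, lam x * χ (upper x)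
  have h1 : mult (fun _ => 1) = 0 := by simp [mult, hsum0]
  have h2 : ∀ χ ∈ IrrChar (SpecialLinearGroup (Fin 2) F), χ ≠ (fun _ => 1) → mult χ = 1 := by
    rintro _ ⟨n, ρ, hρ, rfl⟩ hχ
    have htr : mult ρ.character = LinearMap.trace ℂ _ (ρ.asAlgebraHom (unipIdem lam 1)) := by
      simp [mult, unipIdem, finsum_eq_sum_of_fintype, map_sum, character]
    have hidem : IsIdempotentElem (ρ.asAlgebraHom (unipIdem lam 1)) := by
      change _ * _ = _
      rw [← map_mul, unipIdem_mul_self]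
    have hle := finrank_range_le_one ρ hρ (ρ.asAlgebraHom (unipIdem lam 1))
      (fun v => by rw [← Module.End.mul_apply, hidem.eq]) (fun g h v => by
        have := congrArg (fun x => ρ.asAlgebraHom x v) (unipIdem_comm hlam g h)
        simpa only [map_mul, asAlgebraHom_of, Module.End.mul_apply] using this)
    have hfin : finrank ℂ (LinearMap.range (ρ.asAlgebraHom (unipIdem lam 1))) ≠ 0 := by
      intro h0
      rw [Submodule.finrank_eq_zero, LinearMap.range_eq_bot] at h0
      exact hχ (character_eq_one_of_forall_eq_one ρ hρ (eq_one_of_unipIdem_eq_zero hlam ρ h0))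
    rw [htr, (LinearMap.IsIdempotentElem.isProj_range _ hidem).trace,
      show finrank ℂ (LinearMap.range (ρ.asAlgebraHom (unipIdem lam 1))) = 1 by omega, Nat.cast_one]
  have h3 : ∑ χ ∈ irrFinset (SpecialLinearGroup (Fin 2) F), χ 1 * mult χ =
      Nat.card (SpecialLinearGroup (Fin 2) F) / Nat.card F := by
    simp only [mult, Finset.mul_sum]
    rw [Finset.sum_comm]
    have : ∀ x : F, ∑ χ ∈ irrFinset (SpecialLinearGroup (Fin 2) F),
        χ 1 * ((Nat.card F : ℂ)⁻¹ * (lam x * χ (upper x))) =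
        (Nat.card F : ℂ)⁻¹ * lam x *
          if x = 0 then (Nat.card (SpecialLinearGroup (Fin 2) F) : ℂ) else 0 := by
      intro x
      have hx : upper x = 1 ↔ x = 0 := by
        constructor
        · intro h
          simpa using congrArg (fun g : SpecialLinearGroup (Fin 2) F => g 0 1) h
        · rintro rfl; exact upper_zero
      rw [← if_congr hx rfl rfl, ← sum_irrChar_one_mul, Finset.mul_sum]
      exact Finset.sum_congr rfl fun χ _ => by ring
    simp only [this, mul_ite, mul_zero, Finset.sum_ite_eq', Finset.mem_univ, if_true,
      AddChar.map_zero_eq_one]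
    field_simp
  have hmem : (fun _ => 1) ∈ irrFinset (SpecialLinearGroup (Fin 2) F) :=
    mem_irrFinset.2 (one_mem_irrChar _)
  rw [← Finset.add_sum_erase _ _ hmem, h1, mul_zero, zero_add] at h3
  rw [totalCharacter_one, ← Finset.add_sum_erase _ _ hmem]
  have h4 : ∑ χ ∈ (irrFinset (SpecialLinearGroup (Fin 2) F)).erase (fun _ => 1), χ 1 * mult χ =
      ∑ χ ∈ (irrFinset (SpecialLinearGroup (Fin 2) F)).erase (fun _ => 1), χ 1 :=
    Finset.sum_congr rfl fun χ hχ => by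
      obtain ⟨hχ1, hχ2⟩ := Finset.mem_erase.1 hχ
      rw [h2 χ (mem_irrFinset.1 hχ2) hχ1, mul_one]
  rw [← h4, h3, card_eq, Nat.cast_mul, Nat.cast_sub (Nat.one_le_pow _ _ Nat.card_pos)]
  push_cast
  field_simp
  ring

end GelfandGraev

end SpecialLinearTwo

/-! ### Symplectic transvections in dimension four and characteristic two -/

namespace SymplecticFour

open Matrix

variable {F : Type*} [Field F]

omit [Field F] in
theorem vec_ext {v w : Fin 2 ⊕ Fin 2 → F} (h1 : v (Sum.inl 0) = w (Sum.inl 0))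
    (h2 : v (Sum.inl 1) = w (Sum.inl 1)) (h3 : v (Sum.inr 0) = w (Sum.inr 0))
    (h4 : v (Sum.inr 1) = w (Sum.inr 1)) : v = w := by
  funext i
  rcases i with i | i <;> fin_cases i <;> assumption

/-- The alternating form in characteristic two, where the signs in the matrix `J` disappear. -/
def om (v w : Fin 2 ⊕ Fin 2 → F) : F :=
  v (Sum.inl 0) * w (Sum.inr 0) + v (Sum.inr 0) * w (Sum.inl 0) +
    (v (Sum.inl 1) * w (Sum.inr 1) + v (Sum.inr 1) * w (Sum.inl 1))

theorem om_comm (v w : Fin 2 ⊕ Fin 2 → F) : om v w = om w v := by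
  simp only [om]; ring

theorem om_add_left (u v w : Fin 2 ⊕ Fin 2 → F) : om (u + v) w = om u w + om v w := by
  simp only [om, Pi.add_apply]; ring

theorem om_add_right (u v w : Fin 2 ⊕ Fin 2 → F) : om u (v + w) = om u v + om u w := by
  simp only [om, Pi.add_apply]; ring

theorem om_smul_left (c : F) (v w : Fin 2 ⊕ Fin 2 → F) : om (c • v) w = c * om v w := by
  simp only [om, Pi.smul_apply, smul_eq_mul]; ring

theorem om_smul_right (c : F) (v w : Fin 2 ⊕ Fin 2 → F) : om v (c • w) = c * om v w := by
  simp only [om, Pi.smul_apply, smul_eq_mul]; ring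

theorem exists_om_ne_zero {v : Fin 2 ⊕ Fin 2 → F} (hv : v ≠ 0) : ∃ w, om v w ≠ 0 := by
  by_contra! h
  refine hv (vec_ext ?_ ?_ ?_ ?_)
  · simpa [om] using h (Pi.single (Sum.inr 0) 1)
  · simpa [om] using h (Pi.single (Sum.inr 1) 1)
  · simpa [om] using h (Pi.single (Sum.inl 0) 1)
  · simpa [om] using h (Pi.single (Sum.inl 1) 1)

/-- The first basis vector `e₁`. -/
abbrev e₁ : Fin 2 ⊕ Fin 2 → F := Pi.single (Sum.inl 0) 1

/-- The second basis vector `e₂`. -/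
abbrev e₂ : Fin 2 ⊕ Fin 2 → F := Pi.single (Sum.inl 1) 1

/-- The third basis vector `f₁`. -/
abbrev f₁ : Fin 2 ⊕ Fin 2 → F := Pi.single (Sum.inr 0) 1

/-- The fourth basis vector `f₂`. -/
abbrev f₂ : Fin 2 ⊕ Fin 2 → F := Pi.single (Sum.inr 1) 1

theorem eq_sum_basis (v : Fin 2 ⊕ Fin 2 → F) :
    v = v (Sum.inl 0) • e₁ + v (Sum.inl 1) • e₂ + v (Sum.inr 0) • f₁ + v (Sum.inr 1) • f₂ := by
  apply vec_ext <;> simp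

theorem ext_basis {g h : Sp 2 F} (h1 : g.1 *ᵥ e₁ = h.1 *ᵥ e₁) (h2 : g.1 *ᵥ e₂ = h.1 *ᵥ e₂)
    (h3 : g.1 *ᵥ f₁ = h.1 *ᵥ f₁) (h4 : g.1 *ᵥ f₂ = h.1 *ᵥ f₂) : g = h := by
  apply Subtype.ext
  apply Matrix.ext_of_mulVec_single
  rintro (i | i) <;> fin_cases i <;> assumption

theorem mul_mulVec (g h : Sp 2 F) (v : Fin 2 ⊕ Fin 2 → F) :
    (g * h).1 *ᵥ v = g.1 *ᵥ (h.1 *ᵥ v) := by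
  rw [Submonoid.coe_mul, mulVec_mulVec]

theorem one_mulVec' (v : Fin 2 ⊕ Fin 2 → F) : (1 : Sp 2 F).1 *ᵥ v = v := by
  rw [Submonoid.coe_one, one_mulVec]

theorem inv_mulVec_mulVec (g : Sp 2 F) (v : Fin 2 ⊕ Fin 2 → F) : g⁻¹.1 *ᵥ (g.1 *ᵥ v) = v := by
  rw [← mul_mulVec, inv_mul_cancel, one_mulVec']

theorem mulVec_inv_mulVec (g : Sp 2 F) (v : Fin 2 ⊕ Fin 2 → F) : g.1 *ᵥ (g⁻¹.1 *ᵥ v) = v := by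
  rw [← mul_mulVec, mul_inv_cancel, one_mulVec']

theorem mulVec_ne_zero (g : Sp 2 F) {v : Fin 2 ⊕ Fin 2 → F} (hv : v ≠ 0) : g.1 *ᵥ v ≠ 0 := by
  intro h
  rw [← inv_mulVec_mulVec g v, h, mulVec_zero] at hv
  exact hv rfl

section CharTwo

variable [CharP F 2]

theorem om_self (v : Fin 2 ⊕ Fin 2 → F) : om v v = 0 := by
  simp only [om]
  linear_combination (v (Sum.inl 0) * v (Sum.inr 0) + v (Sum.inl 1) * v (Sum.inr 1)) *
    CharTwo.two_eq_zero (R := F)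

theorem add_self_vec (v : Fin 2 ⊕ Fin 2 → F) : v + v = 0 := by
  funext i; exact CharTwo.add_self_eq_zero _

theorem dotProduct_J (v w : Fin 2 ⊕ Fin 2 → F) : v ⬝ᵥ (J (Fin 2) F *ᵥ w) = om v w := by
  have hneg : ∀ x : F, -x = x := fun x => CharTwo.neg_eq x
  simp [om, Matrix.J, dotProduct, mulVec, Fin.sum_univ_two, Matrix.one_apply, hneg]
  ring

theorem om_mulVec (g : Sp 2 F) (v w : Fin 2 ⊕ Fin 2 → F) :
    om (g.1 *ᵥ v) (g.1 *ᵥ w) = om v w := by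
  have h := SymplecticGroup.mem_iff'.1 g.2
  rw [← dotProduct_J, ← dotProduct_J v w]
  conv_rhs => rw [← h, ← mulVec_mulVec, ← mulVec_mulVec, dotProduct_mulVec, vecMul_transpose]

theorem om_inv_mulVec (g : Sp 2 F) (v w : Fin 2 ⊕ Fin 2 → F) :
    om (g⁻¹.1 *ᵥ v) w = om v (g.1 *ᵥ w) := by
  rw [← om_mulVec g, mulVec_inv_mulVec]

/-- The element of the symplectic group given by a linear isometry of `om`. -/
def ofLinear (f : (Fin 2 ⊕ Fin 2 → F) →ₗ[F] (Fin 2 ⊕ Fin 2 → F))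
    (hf : ∀ v w, om (f v) (f w) = om v w) : Sp 2 F :=
  ⟨LinearMap.toMatrix' f, by
    rw [SymplecticGroup.mem_iff']
    apply Matrix.ext_of_mulVec_single
    intro j
    funext i
    have h1 : ∀ v w, v ⬝ᵥ (((LinearMap.toMatrix' f)ᵀ * J (Fin 2) F * LinearMap.toMatrix' f) *ᵥ w) =
        v ⬝ᵥ (J (Fin 2) F *ᵥ w) := by
      intro v w
      rw [dotProduct_J, ← hf, ← dotProduct_J, ← mulVec_mulVec, ← mulVec_mulVec, dotProduct_mulVec v,
        vecMul_transpose, LinearMap.toMatrix'_mulVec, LinearMap.toMatrix'_mulVec]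
    simpa using h1 (Pi.single i 1) (Pi.single j 1)⟩

theorem ofLinear_mulVec (f : (Fin 2 ⊕ Fin 2 → F) →ₗ[F] (Fin 2 ⊕ Fin 2 → F))
    (hf : ∀ v w, om (f v) (f w) = om v w) (v : Fin 2 ⊕ Fin 2 → F) :
    (ofLinear f hf).1 *ᵥ v = f v :=
  LinearMap.toMatrix'_mulVec f v

/-- The symplectic transvection `v ↦ v + om v u • u`. -/
def tv (u : Fin 2 ⊕ Fin 2 → F) : Sp 2 F :=
  ofLinear
    { toFun := fun v => v + om v u • u
      map_add' := fun v w => by rw [om_add_left, add_smul]; abel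
      map_smul' := fun c v => by rw [om_smul_left, smul_add, smul_smul]; rfl }
    fun v w => by
      simp only [LinearMap.coe_mk, AddHom.coe_mk, om_add_left, om_add_right, om_smul_left,
        om_smul_right, om_self, om_comm u w]
      linear_combination (om v u * om w u) * CharTwo.two_eq_zero (R := F)

theorem tv_mulVec (u v : Fin 2 ⊕ Fin 2 → F) : (tv u).1 *ᵥ v = v + om v u • u :=
  ofLinear_mulVec _ _ _

theorem conj_tv (g : Sp 2 F) (u : Fin 2 ⊕ Fin 2 → F) : g * tv u * g⁻¹ = tv (g.1 *ᵥ u) := by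
  rw [mul_inv_eq_iff_eq_mul]
  have : ∀ v, (g * tv u).1 *ᵥ v = (tv (g.1 *ᵥ u) * g).1 *ᵥ v := by
    intro v
    rw [mul_mulVec, mul_mulVec, tv_mulVec, tv_mulVec, om_mulVec, mulVec_add, mulVec_smul]
  exact ext_basis (this _) (this _) (this _) (this _)

theorem tv_mulVec_of_om_eq_zero {u a : Fin 2 ⊕ Fin 2 → F} (h : om a u = 0) :
    (tv u).1 *ᵥ a = a := by
  rw [tv_mulVec, h, zero_smul, add_zero]

variable [Finite F]

omit [CharP F 2] in
theorem exists_sq [CharP F 2] (x : F) : ∃ c : F, c * c = x := by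
  obtain ⟨c, hc⟩ := FiniteField.isSquare_of_char_two (ringChar.eq F 2) x
  exact ⟨c, hc.symm⟩

/-- The transvection with centre on the line through `x + y` that carries `x` to `y`; it fixes all
vectors that pair equally with `x` and `y`. -/
theorem exists_tv_mulVec_eq {x y : Fin 2 ⊕ Fin 2 → F} (h : om x y ≠ 0) :
    ∃ c : F, c * c * om x y = 1 ∧ (tv (c • (x + y))).1 *ᵥ x = y ∧
      ∀ a, om a x = om a y → (tv (c • (x + y))).1 *ᵥ a = a := by
  obtain ⟨c, hc⟩ := exists_sq (om x y)⁻¹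
  have hc' : c * c * om x y = 1 := by rw [hc, inv_mul_cancel₀ h]
  refine ⟨c, hc', ?_, fun a ha => ?_⟩
  · rw [tv_mulVec, om_smul_right, om_add_right, om_self, zero_add, smul_smul,
      show c * om x y * c = 1 by rw [← hc']; ring, one_smul, ← add_assoc, add_self_vec, zero_add]
  · apply tv_mulVec_of_om_eq_zero
    rw [om_smul_right, om_add_right, ha, CharTwo.add_self_eq_zero, mul_zero]

omit [CharP F 2] [Finite F] in
theorem exists_om_ne_zero_and {x y : Fin 2 ⊕ Fin 2 → F} (hx : x ≠ 0) (hy : y ≠ 0) :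
    ∃ z, om x z ≠ 0 ∧ om z y ≠ 0 := by
  obtain ⟨a, ha⟩ := exists_om_ne_zero hx
  obtain ⟨b, hb⟩ := exists_om_ne_zero hy
  rw [om_comm] at hb
  by_cases h1 : om a y = 0
  · by_cases h2 : om x b = 0
    · exact ⟨a + b, by rwa [om_add_right, h2, add_zero], by rwa [om_add_left, h1, zero_add]⟩
    · exact ⟨b, h2, hb⟩
  · exact ⟨a, ha, h1⟩

theorem exists_mulVec_eq {x y : Fin 2 ⊕ Fin 2 → F} (hx : x ≠ 0) (hy : y ≠ 0) :
    ∃ g : Sp 2 F, g.1 *ᵥ x = y := by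
  obtain ⟨z, h1, h2⟩ := exists_om_ne_zero_and hx hy
  obtain ⟨c, -, hc, -⟩ := exists_tv_mulVec_eq h1
  obtain ⟨d, -, hd, -⟩ := exists_tv_mulVec_eq h2
  exact ⟨_ * _, by rw [mul_mulVec, hc, hd]⟩

/-- The symplectic group is generated by its transvections. -/
theorem eq_top_of_tv_mem (T : Subgroup (Sp 2 F)) (hT : ∀ u, tv u ∈ T) : T = ⊤ := by
  rw [eq_top_iff]
  rintro g -
  -- The images of `e₁`, `f₁`, `e₂`, `f₂` are moved back one after another.
  have move : ∀ x y : Fin 2 ⊕ Fin 2 → F, om x y ≠ 0 → ∃ t ∈ T, t.1 *ᵥ x = y ∧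
      ∀ a, om a x = om a y → t.1 *ᵥ a = a := by
    intro x y h
    obtain ⟨c, -, h1, h2⟩ := exists_tv_mulVec_eq h
    exact ⟨_, hT _, h1, h2⟩
  have move2 : ∀ x y z : Fin 2 ⊕ Fin 2 → F, om x z ≠ 0 → om z y ≠ 0 → ∃ t ∈ T, t.1 *ᵥ x = y ∧
      ∀ a, om a x = om a z → om a z = om a y → t.1 *ᵥ a = a := by
    intro x y z h1 h2
    obtain ⟨t, ht, ht1, ht2⟩ := move x z h1
    obtain ⟨s, hs, hs1, hs2⟩ := move z y h2
    refine ⟨s * t, mul_mem hs ht, by rw [mul_mulVec, ht1, hs1], fun a ha hb => ?_⟩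
    rw [mul_mulVec, ht2 a ha, hs2 a hb]
  have red : ∀ t ∈ T, ∀ g : Sp 2 F, t * g ∈ T → g ∈ T := fun t ht g h =>
    (Subgroup.mul_mem_cancel_left T ht).1 h
  have step4 : ∀ g : Sp 2 F, g.1 *ᵥ e₁ = e₁ → g.1 *ᵥ f₁ = f₁ → g.1 *ᵥ e₂ = e₂ → g ∈ T := by
    intro g h1 h2 h3
    set y := g.1 *ᵥ f₂ with hy
    have y1 : om e₁ y = 0 := by rw [← h1, om_mulVec]; simp [om]
    have y2 : om f₁ y = 0 := by rw [← h2, om_mulVec]; simp [om]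
    have y3 : om e₂ y = 1 := by rw [← h3, om_mulVec]; simp [om]
    have key : ∀ t ∈ T, t.1 *ᵥ y = f₂ → t.1 *ᵥ e₁ = e₁ → t.1 *ᵥ f₁ = f₁ → t.1 *ᵥ e₂ = e₂ →
        g ∈ T := by
      intro t ht a1 a2 a3 a4
      refine red t ht g ?_
      have : t * g = 1 := by
        apply ext_basis <;> rw [mul_mulVec, one_mulVec']
        · rw [h1, a2]
        · rw [h3, a4]
        · rw [h2, a3]
        · rw [← hy, a1]
      rw [this]; exact one_mem T
    by_cases h : om y f₂ = 0
    · obtain ⟨t, ht, ht1, ht2⟩ := move2 y f₂ (y + e₂) (by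
        rw [om_add_right, om_self, om_comm y, y3]; simp) (by
        rw [om_add_left, h]; simp [om])
      refine key t ht ht1 (ht2 _ ?_ ?_) (ht2 _ ?_ ?_) (ht2 _ ?_ ?_) <;>
        simp only [om_add_right, y1, y2, y3] <;> simp [om]
    · obtain ⟨t, ht, ht1, ht2⟩ := move y f₂ h
      refine key t ht ht1 (ht2 _ ?_) (ht2 _ ?_) (ht2 _ ?_) <;> simp only [y1, y2, y3] <;> simp [om]
  have step3 : ∀ g : Sp 2 F, g.1 *ᵥ e₁ = e₁ → g.1 *ᵥ f₁ = f₁ → g ∈ T := by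
    intro g h1 h2
    set y := g.1 *ᵥ e₂ with hy
    have hy0 : y ≠ 0 := mulVec_ne_zero g (by simp)
    have y1 : om e₁ y = 0 := by rw [← h1, om_mulVec]; simp [om]
    have y2 : om f₁ y = 0 := by rw [← h2, om_mulVec]; simp [om]
    have key : ∀ t ∈ T, t.1 *ᵥ y = e₂ → t.1 *ᵥ e₁ = e₁ → t.1 *ᵥ f₁ = f₁ → g ∈ T := by
      intro t ht a1 a2 a3
      refine red t ht g (step4 _ ?_ ?_ ?_) <;> rw [mul_mulVec]
      · rw [h1, a2]
      · rw [h2, a3]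
      · rw [← hy, a1]
    by_cases h : om y e₂ = 0
    · have h3 : om y f₂ ≠ 0 := by
        intro h3
        refine hy0 (vec_ext ?_ ?_ ?_ ?_)
        · simpa [om] using y2
        · simpa [om] using h3
        · simpa [om] using y1
        · simpa [om] using h
      obtain ⟨t, ht, ht1, ht2⟩ := move2 y e₂ f₂ h3 (by simp [om])
      refine key t ht ht1 (ht2 _ ?_ ?_) (ht2 _ ?_ ?_) <;> (try simp only [y1, y2]) <;> simp [om]
    · obtain ⟨t, ht, ht1, ht2⟩ := move y e₂ h
      refine key t ht ht1 (ht2 _ ?_) (ht2 _ ?_) <;> simp only [y1, y2] <;> simp [om]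
  have step2 : ∀ g : Sp 2 F, g.1 *ᵥ e₁ = e₁ → g ∈ T := by
    intro g h1
    set y := g.1 *ᵥ f₁ with hy
    have y1 : om e₁ y = 1 := by rw [← h1, om_mulVec]; simp [om]
    have key : ∀ t ∈ T, t.1 *ᵥ y = f₁ → t.1 *ᵥ e₁ = e₁ → g ∈ T := by
      intro t ht a1 a2
      refine red t ht g (step3 _ ?_ ?_) <;> rw [mul_mulVec]
      · rw [h1, a2]
      · rw [← hy, a1]
    by_cases h : om y f₁ = 0
    · obtain ⟨t, ht, ht1, ht2⟩ := move2 y f₁ (y + e₁) (by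
        rw [om_add_right, om_self, om_comm y, y1]; simp) (by
        rw [om_add_left, h]; simp [om])
      refine key t ht ht1 (ht2 _ ?_ ?_) <;> simp only [om_add_right, y1] <;> simp [om]
    · obtain ⟨t, ht, ht1, ht2⟩ := move y f₁ h
      refine key t ht ht1 (ht2 _ ?_) <;> simp only [y1] <;> simp [om]
  set y := g.1 *ᵥ e₁ with hy
  have hy0 : y ≠ 0 := mulVec_ne_zero g (by simp)
  have key : ∀ t ∈ T, t.1 *ᵥ y = e₁ → g ∈ T := fun t ht a1 =>
    red t ht g (step2 _ (by rw [mul_mulVec, ← hy, a1]))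
  by_cases h : om y e₁ = 0
  · obtain ⟨z, hz1, hz2⟩ := exists_om_ne_zero_and hy0 (y := e₁) (by simp)
    obtain ⟨t, ht, ht1, -⟩ := move2 y e₁ z hz1 hz2
    exact key t ht ht1
  · obtain ⟨t, ht, ht1, -⟩ := move y e₁ h
    exact key t ht ht1

end CharTwo

end SymplecticFour

/-! ### The two subgroups as wreath products -/

namespace WreathTwo

variable {D G : Type*} [Group D] [Group G]

/-- The homomorphism on `D ≀ᵣ C2` that is `f` on the base group and maps the involution of the top
group to `s`. -/
def lift (f : D × D →* G) (s : G) (hs : s * s = 1)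
    (h : ∀ x y, s * f (x, y) = f (y, x) * s) : D ≀ᵣ C2 →* G where
  toFun w := f (w.left 1, w.left swap) * if w.right = 1 then 1 else s
  map_one' := by
    have : ((1 : D ≀ᵣ C2).left 1, (1 : D ≀ᵣ C2).left swap) = 1 := rfl
    rw [this, map_one, one_mul]
    exact if_pos rfl
  map_mul' v w := by
    have key : ∀ x y z t, f (x, y) * f (z, t) = f (x * z, y * t) := fun x y z t => by
      rw [← map_mul]; rfl
    rcases C2.eq_one_or_swap v.right with hv | hv <;>
      rcases C2.eq_one_or_swap w.right with hw | hw <;>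
      simp only [RegularWreathProduct.mul_left, RegularWreathProduct.mul_right, hv, hw,
        swap_mul_swap, swap_ne_one, swap_inv, if_true, if_false, mul_one, one_mul, inv_one,
        Pi.mul_apply]
    · rw [key]
    · rw [← mul_assoc, key]
    · rw [mul_assoc, h, ← mul_assoc, key]
    · rw [mul_assoc, ← mul_assoc s, h, mul_assoc _ s s, hs, mul_one, key]

theorem lift_mk_one (f : D × D →* G) (s : G) (hs : s * s = 1)
    (h : ∀ x y, s * f (x, y) = f (y, x) * s) (x y : D) : lift f s hs h (mk x y 1) = f (x, y) := by
  simp [lift, mk]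

theorem lift_mk_swap (f : D × D →* G) (s : G) (hs : s * s = 1)
    (h : ∀ x y, s * f (x, y) = f (y, x) * s) (x y : D) :
    lift f s hs h (mk x y swap) = f (x, y) * s := by
  simp [lift, mk]

theorem lift_injective (f : D × D →* G) (s : G) (hs : s * s = 1)
    (h : ∀ x y, s * f (x, y) = f (y, x) * s) (hf : Function.Injective f)
    (hsf : ∀ x y, f (x, y) ≠ s) : Function.Injective (lift f s hs h) := by
  rw [injective_iff_map_eq_one]
  intro w hw
  rw [eq_mk w] at hw ⊢
  rcases C2.eq_one_or_swap w.right with hr | hr <;> rw [hr] at hw ⊢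
  · rw [lift_mk_one] at hw
    have h1 := hf (hw.trans (map_one f).symm)
    rw [Prod.mk_eq_one] at h1
    rw [h1.1, h1.2]
    exact (eq_mk 1).symm
  · rw [lift_mk_swap] at hw
    refine absurd ?_ (hsf (w.left 1) (w.left swap))
    rw [eq_inv_of_mul_eq_one_left hw, inv_eq_of_mul_eq_one_left hs]

end WreathTwo

namespace SymplecticFour

open Matrix WreathTwo

variable {F : Type*} [Field F]

theorem mem_symplecticGroup_one_iff (A : Matrix (Fin 1 ⊕ Fin 1) (Fin 1 ⊕ Fin 1) F) :
    A ∈ symplecticGroup (Fin 1) F ↔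
      A (Sum.inl 0) (Sum.inl 0) * A (Sum.inr 0) (Sum.inr 0) -
        A (Sum.inl 0) (Sum.inr 0) * A (Sum.inr 0) (Sum.inl 0) = 1 := by
  rw [SymplecticGroup.mem_iff]
  constructor
  · intro h
    have := congrFun (congrFun h (Sum.inr 0)) (Sum.inl 0)
    simp [Matrix.mul_apply, Matrix.J] at this
    linear_combination this
  · intro h
    ext i j
    rcases i with i | i <;> rcases j with j | j <;> fin_cases i <;> fin_cases j <;>
      simp [Matrix.mul_apply, Matrix.J]
    · ring
    · linear_combination -h
    · linear_combination h
    · ring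

/-- An element of `Sp_2` as an element of `SL_2`. -/
def sp1ToSL (g : Sp 1 F) : SpecialLinearGroup (Fin 2) F :=
  ⟨!![g.1 (Sum.inl 0) (Sum.inl 0), g.1 (Sum.inl 0) (Sum.inr 0);
    g.1 (Sum.inr 0) (Sum.inl 0), g.1 (Sum.inr 0) (Sum.inr 0)], by
      rw [det_fin_two_of]; exact (mem_symplecticGroup_one_iff _).1 g.2⟩

/-- `Sp_2` and `SL_2` coincide. -/
def sp1Equiv : Sp 1 F ≃* SpecialLinearGroup (Fin 2) F where
  toFun := sp1ToSL
  invFun h := ⟨fromBlocks (of fun _ _ => h 0 0) (of fun _ _ => h 0 1)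
    (of fun _ _ => h 1 0) (of fun _ _ => h 1 1), by
      rw [mem_symplecticGroup_one_iff]
      exact (det_fin_two _).symm.trans h.2⟩
  left_inv g := by
    apply Subtype.ext
    ext i j
    rcases i with i | i <;> rcases j with j | j <;> fin_cases i <;> fin_cases j <;> simp [sp1ToSL]
  right_inv h := by
    apply Subtype.ext
    ext i j
    fin_cases i <;> fin_cases j <;> simp [sp1ToSL]
  map_mul' g h := by
    apply Matrix.SpecialLinearGroup.ext
    intro i j
    rw [Matrix.SpecialLinearGroup.coe_mul]
    fin_cases i <;> fin_cases j <;> simp [sp1ToSL, Matrix.mul_apply]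

theorem planeDiag_mulVec (a : Fin 2 → Matrix (Fin 1 ⊕ Fin 1) (Fin 1 ⊕ Fin 1) F)
    (v : Fin 2 ⊕ Fin 2 → F) :
    (∀ i, (planeDiag a *ᵥ v) (Sum.inl i) = a i (Sum.inl 0) (Sum.inl 0) * v (Sum.inl i) +
      a i (Sum.inl 0) (Sum.inr 0) * v (Sum.inr i)) ∧
    (∀ i, (planeDiag a *ᵥ v) (Sum.inr i) = a i (Sum.inr 0) (Sum.inl 0) * v (Sum.inl i) +
      a i (Sum.inr 0) (Sum.inr 0) * v (Sum.inr i)) := by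
  constructor <;> intro i <;>
    fin_cases i <;> simp [planeDiag, fromBlocks_mulVec]

theorem planePerm_swap_mulVec (v : Fin 2 ⊕ Fin 2 → F) :
    (∀ i, (planePerm (Equiv.swap 0 1) *ᵥ v) (Sum.inl i) = v (Sum.inl (Equiv.swap 0 1 i))) ∧
    (∀ i, (planePerm (Equiv.swap 0 1) *ᵥ v) (Sum.inr i) = v (Sum.inr (Equiv.swap 0 1 i))) := by
  constructor <;> intro i <;>
    simp [planePerm, fromBlocks_mulVec, Equiv.Perm.permMatrix, PEquiv.toMatrix_toPEquiv_mulVec]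

variable [CharP F 2]

theorem mem_symplecticGroup_of_om {A : Matrix (Fin 2 ⊕ Fin 2) (Fin 2 ⊕ Fin 2) F}
    (hA : ∀ v w, om (A *ᵥ v) (A *ᵥ w) = om v w) : A ∈ symplecticGroup (Fin 2) F := by
  have := (ofLinear (Matrix.toLin' A) (by simpa using hA)).2
  simpa [ofLinear] using this

/-- The embedding of `Sp_2 × Sp_2` in `Sp_4`, each factor acting on one of the planes. -/
def planeHom : Sp 1 F × Sp 1 F →* Sp 2 F where
  toFun p := ⟨planeDiag ![p.1.1, p.2.1], mem_symplecticGroup_of_om fun v w => by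
    have h1 := (mem_symplecticGroup_one_iff _).1 p.1.2
    have h2 := (mem_symplecticGroup_one_iff _).1 p.2.2
    have key : ∀ {a b c d x y z w : F}, a * d - b * c = 1 →
        (a * x + b * y) * (c * z + d * w) + (c * x + d * y) * (a * z + b * w) =
          x * w + y * z := fun {a b c d x y z w} h => by
      linear_combination (x * w + y * z) * h +
        (a * c * x * z + b * d * y * w + b * c * (x * w + y * z)) * CharTwo.two_eq_zero (R := F)
    have e1 := planeDiag_mulVec ![p.1.1, p.2.1] v
    have e2 := planeDiag_mulVec ![p.1.1, p.2.1] w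
    simp only [om, e1, e2, cons_val_zero, cons_val_one, key h1, key h2]⟩
  map_one' := Subtype.ext <| by
    rw [Submonoid.coe_one, ← planeDiag_one]
    refine congrArg planeDiag ?_; funext i; fin_cases i <;> rfl
  map_mul' p p' := Subtype.ext <| by
    rw [Submonoid.coe_mul, planeDiag_mul]
    refine congrArg planeDiag ?_; funext i; fin_cases i <;> rfl

variable (F) in
/-- The involution of `Sp_4` that exchanges the two planes. -/
def planeSwap : Sp 2 F :=
  ⟨planePerm (Equiv.swap 0 1), mem_symplecticGroup_of_om fun v w => by
    simp only [om, planePerm_swap_mulVec, Equiv.swap_apply_left, Equiv.swap_apply_right]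
    ring⟩

variable (F) in
theorem planeSwap_mul_self : planeSwap F * planeSwap F = 1 := by
  apply Subtype.ext
  rw [Submonoid.coe_mul, Submonoid.coe_one]
  exact (planePerm_mul _ _).trans (by rw [Equiv.swap_mul_self, planePerm_one])

theorem planeSwap_mul_planeHom (x y : Sp 1 F) :
    planeSwap F * planeHom (x, y) = planeHom (y, x) * planeSwap F := by
  apply Subtype.ext
  refine (planePerm_mul_planeDiag _ _).trans ?_
  refine congrArg (fun a => planeDiag a * planePerm (Equiv.swap 0 1)) ?_
  funext i; fin_cases i <;> simp

theorem planeHom_injective : Function.Injective (planeHom (F := F)) := by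
  intro p p' h
  have h1 := congrArg Subtype.val h
  have h2 : ∀ i j, planeDiag ![p.1.1, p.2.1] i j = planeDiag ![p'.1.1, p'.2.1] i j := fun i j =>
    congrFun (congrFun h1 i) j
  apply Prod.ext <;> apply Subtype.ext <;> ext i j
  · have h3 := h2 (Sum.map (fun _ => 0) (fun _ => 0) i) (Sum.map (fun _ => 0) (fun _ => 0) j)
    rcases i with i | i <;> rcases j with j | j <;> fin_cases i <;> fin_cases j <;>
      simpa [planeDiag] using h3
  · have h3 := h2 (Sum.map (fun _ => 1) (fun _ => 1) i) (Sum.map (fun _ => 1) (fun _ => 1) j)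
    rcases i with i | i <;> rcases j with j | j <;> fin_cases i <;> fin_cases j <;>
      simpa [planeDiag] using h3

theorem planeHom_ne_planeSwap (x y : Sp 1 F) : planeHom (x, y) ≠ planeSwap F := by
  intro h
  have h1 : planeDiag ![x.1, y.1] (Sum.inl 0) (Sum.inl 1) =
    planePerm (Equiv.swap 0 1) (Sum.inl 0) (Sum.inl 1) :=
    congrFun (congrFun (congrArg Subtype.val h) _) _
  simp [planeDiag, planePerm, Equiv.Perm.permMatrix] at h1

theorem range_lift_planeHom :
    (lift planeHom (planeSwap F) (planeSwap_mul_self F) planeSwap_mul_planeHom).range =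
      sp2Wreath F := by
  apply le_antisymm
  · rintro _ ⟨w, rfl⟩
    rw [eq_mk w]
    rcases C2.eq_one_or_swap w.right with hr | hr <;> rw [hr]
    · refine ⟨![w.left 1, w.left swap], 1, ?_⟩
      rw [lift_mk_one, planePerm_one, mul_one]
      refine congrArg planeDiag ?_
      funext i; fin_cases i <;> rfl
    · refine ⟨![w.left 1, w.left swap], Equiv.swap 0 1, ?_⟩
      rw [lift_mk_swap, Submonoid.coe_mul]
      refine congrArg (fun a => planeDiag a * planePerm (Equiv.swap 0 1)) ?_
      funext i; fin_cases i <;> rfl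
  · rintro g ⟨a, σ, hg⟩
    have hσ : σ = 1 ∨ σ = Equiv.swap 0 1 := by clear hg; revert σ; decide
    have ha : (fun i => (a i).1) = ![(a 0).1, (a 1).1] := by funext i; fin_cases i <;> rfl
    rcases hσ with rfl | rfl
    · refine ⟨mk (a 0) (a 1) 1, Subtype.ext ?_⟩
      rw [lift_mk_one, hg, planePerm_one, mul_one, ha]; rfl
    · refine ⟨mk (a 0) (a 1) swap, Subtype.ext ?_⟩
      rw [lift_mk_swap, hg, ha]; rfl

variable (F) in
theorem nonempty_sp2Wreath_equiv : Nonempty (sp2Wreath F ≃* (Sp 1 F ≀ᵣ C2)) :=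
  ⟨((MonoidHom.ofInjective (lift_injective _ _ _ _ planeHom_injective
    planeHom_ne_planeSwap)).trans (MulEquiv.subgroupCongr range_lift_planeHom)).symm⟩

end SymplecticFour

/-! ### The orthogonal group in the model of two-by-two matrices -/

namespace SymplecticFour

open Matrix WreathTwo

variable {F : Type*} [Field F]

/-- The identification of the four-dimensional space with two-by-two matrices under which, in
characteristic two, `plusForm` becomes the determinant. -/
def toMat (v : Fin 2 ⊕ Fin 2 → F) : Matrix (Fin 2) (Fin 2) F :=
  !![v (Sum.inl 0), v (Sum.inl 1); v (Sum.inr 1), v (Sum.inr 0)]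

/-- The inverse of `toMat`. -/
def ofMat (X : Matrix (Fin 2) (Fin 2) F) : Fin 2 ⊕ Fin 2 → F :=
  Sum.elim ![X 0 0, X 0 1] ![X 1 1, X 1 0]

omit [Field F] in
@[simp] theorem toMat_ofMat (X : Matrix (Fin 2) (Fin 2) F) : toMat (ofMat X) = X := by
  ext i j
  fin_cases i <;> fin_cases j <;> rfl

omit [Field F] in
@[simp] theorem ofMat_toMat (v : Fin 2 ⊕ Fin 2 → F) : ofMat (toMat v) = v :=
  vec_ext rfl rfl rfl rfl

theorem ofMat_add (X Y : Matrix (Fin 2) (Fin 2) F) : ofMat (X + Y) = ofMat X + ofMat Y :=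
  vec_ext rfl rfl rfl rfl

theorem ofMat_smul (c : F) (X : Matrix (Fin 2) (Fin 2) F) : ofMat (c • X) = c • ofMat X :=
  vec_ext rfl rfl rfl rfl

theorem toMat_add (v w : Fin 2 ⊕ Fin 2 → F) : toMat (v + w) = toMat v + toMat w := by
  ext i j
  fin_cases i <;> fin_cases j <;> rfl

theorem toMat_smul (c : F) (v : Fin 2 ⊕ Fin 2 → F) : toMat (c • v) = c • toMat v := by
  ext i j
  fin_cases i <;> fin_cases j <;> rfl

theorem plusForm_eq (v : Fin 2 ⊕ Fin 2 → F) :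
    plusForm F v = v (Sum.inl 0) * v (Sum.inr 0) + v (Sum.inl 1) * v (Sum.inr 1) := by
  simp [plusForm]

theorem plusForm_add (v w : Fin 2 ⊕ Fin 2 → F) :
    plusForm F (v + w) = plusForm F v + plusForm F w + om v w := by
  simp only [plusForm_eq, om, Pi.add_apply]; ring

theorem plusForm_smul (c : F) (v : Fin 2 ⊕ Fin 2 → F) :
    plusForm F (c • v) = c * c * plusForm F v := by
  simp only [plusForm_eq, Pi.smul_apply, smul_eq_mul]; ring

variable [CharP F 2]

theorem det_toMat (v : Fin 2 ⊕ Fin 2 → F) : (toMat v).det = plusForm F v := by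
  rw [toMat, det_fin_two_of, plusForm_eq]
  linear_combination -(v (Sum.inl 1) * v (Sum.inr 1)) * CharTwo.two_eq_zero (R := F)

omit [CharP F 2] in
/-- Every symplectic isometry of `plusForm` has determinant one. -/
theorem mem_soPlus_iff (g : Sp 2 F) :
    g ∈ soPlus F ↔ ∀ v, plusForm F (g.1 *ᵥ v) = plusForm F v :=
  ⟨fun h => h.2, fun h => ⟨SymplecticGroup.det_eq_one g.2, h⟩⟩

omit [CharP F 2] in
theorem om_of_plusForm {f : (Fin 2 ⊕ Fin 2 → F) →ₗ[F] (Fin 2 ⊕ Fin 2 → F)}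
    (hf : ∀ v, plusForm F (f v) = plusForm F v) (v w : Fin 2 ⊕ Fin 2 → F) :
    om (f v) (f w) = om v w := by
  have h := hf (v + w)
  rw [map_add, plusForm_add, plusForm_add, hf, hf] at h
  exact add_left_cancel h

/-- The action `X ↦ A * X * Bᵀ` of `SL_2 × SL_2` on two-by-two matrices. -/
def tensorHom : SpecialLinearGroup (Fin 2) F × SpecialLinearGroup (Fin 2) F →* Sp 2 F where
  toFun p := ofLinear
    { toFun := fun v => ofMat (p.1.1 * toMat v * p.2.1ᵀ)
      map_add' := fun v w => by rw [toMat_add, mul_add, add_mul, ofMat_add]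
      map_smul' := fun c v => by
        rw [toMat_smul, mul_smul_comm, smul_mul_assoc, ofMat_smul]; rfl }
    (om_of_plusForm fun v => by
      rw [← det_toMat, LinearMap.coe_mk, AddHom.coe_mk, toMat_ofMat, det_mul, det_mul,
        det_transpose, p.1.2, p.2.2, one_mul, mul_one, det_toMat])
  map_one' := by
    apply ext_basis <;> rw [ofLinear_mulVec, one_mulVec'] <;> simp
  map_mul' p p' := by
    apply ext_basis <;> rw [mul_mulVec, ofLinear_mulVec, ofLinear_mulVec, ofLinear_mulVec] <;>
      simp [transpose_mul, mul_assoc]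

theorem tensorHom_mulVec (A B : SpecialLinearGroup (Fin 2) F) (v : Fin 2 ⊕ Fin 2 → F) :
    (tensorHom (A, B)).1 *ᵥ v = ofMat (A.1 * toMat v * B.1ᵀ) :=
  LinearMap.toMatrix'_mulVec _ v

theorem toMat_tensorHom_mulVec (A B : SpecialLinearGroup (Fin 2) F) (v : Fin 2 ⊕ Fin 2 → F) :
    toMat ((tensorHom (A, B)).1 *ᵥ v) = A.1 * toMat v * B.1ᵀ := by
  rw [tensorHom_mulVec, toMat_ofMat]

variable (F) in
/-- The transposition of two-by-two matrices. -/
def transp : Sp 2 F := ofLinear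
  { toFun := fun v => ofMat (toMat v)ᵀ
    map_add' := fun v w => by rw [toMat_add, transpose_add, ofMat_add]
    map_smul' := fun c v => by rw [toMat_smul, transpose_smul, ofMat_smul]; rfl }
  (om_of_plusForm fun v => by
    rw [← det_toMat, LinearMap.coe_mk, AddHom.coe_mk, toMat_ofMat, det_transpose, det_toMat])

theorem transp_mulVec (v : Fin 2 ⊕ Fin 2 → F) : (transp F).1 *ᵥ v = ofMat (toMat v)ᵀ :=
  ofLinear_mulVec _ _ _

variable (F) in
theorem transp_mul_self : transp F * transp F = 1 := by
  apply ext_basis <;> rw [mul_mulVec, one_mulVec', transp_mulVec, transp_mulVec] <;> simp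

theorem transp_mul_tensorHom (A B : SpecialLinearGroup (Fin 2) F) :
    transp F * tensorHom (A, B) = tensorHom (B, A) * transp F := by
  apply ext_basis <;> rw [mul_mulVec, mul_mulVec, transp_mulVec, transp_mulVec,
    tensorHom_mulVec, tensorHom_mulVec] <;> simp [transpose_mul, mul_assoc]

theorem tensorHom_mem_soPlus (A B : SpecialLinearGroup (Fin 2) F) :
    tensorHom (A, B) ∈ soPlus F := by
  rw [mem_soPlus_iff]
  intro v
  rw [← det_toMat, toMat_tensorHom_mulVec, det_mul, det_mul, det_transpose, A.2, B.2, one_mul,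
    mul_one, det_toMat]

variable (F) in
theorem transp_mem_soPlus : transp F ∈ soPlus F := by
  rw [mem_soPlus_iff]
  intro v
  rw [← det_toMat, transp_mulVec, toMat_ofMat, det_transpose, det_toMat]

theorem tensorHom_injective : Function.Injective (tensorHom (F := F)) := by
  rw [injective_iff_map_eq_one]
  rintro ⟨A, B⟩ h
  have h1 : ∀ X : Matrix (Fin 2) (Fin 2) F, A.1 * X * B.1ᵀ = X := fun X => by
    have := toMat_tensorHom_mulVec A B (ofMat X)
    rwa [h, one_mulVec', toMat_ofMat, eq_comm] at this
  have hA := A.2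
  have hB := B.2
  rw [det_fin_two] at hA hB
  have ha00 := congrFun (congrFun (h1 !![1, 0; 0, 0]) 0) 0
  have ha10 := congrFun (congrFun (h1 !![1, 0; 0, 0]) 1) 0
  have ha01 := congrFun (congrFun (h1 !![1, 0; 0, 0]) 0) 1
  have hb11 := congrFun (congrFun (h1 !![0, 0; 0, 1]) 1) 1
  have hb10 := congrFun (congrFun (h1 !![0, 0; 0, 1]) 1) 0
  have hb01 := congrFun (congrFun (h1 !![0, 0; 0, 1]) 0) 1
  have hc := congrFun (congrFun (h1 !![0, 1; 0, 0]) 0) 1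
  simp [Matrix.mul_apply] at ha00 ha10 ha01 hb11 hb10 hb01 hc
  have n1 : A 0 0 ≠ 0 := left_ne_zero_of_mul_eq_one ha00
  have n2 : B 0 0 ≠ 0 := right_ne_zero_of_mul_eq_one ha00
  have n3 : A 1 1 ≠ 0 := left_ne_zero_of_mul_eq_one hb11
  have n4 : B 1 1 ≠ 0 := right_ne_zero_of_mul_eq_one hb11
  have a10 : A 1 0 = 0 := by simpa [n2] using ha10
  have a01 : A 0 1 = 0 := by simpa [n4] using hb01
  have b10 : B 1 0 = 0 := by simpa [n1] using ha01
  have b01 : B 0 1 = 0 := by simpa [n3] using hb10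
  rw [a01, zero_mul, sub_zero] at hA
  have h3 : B 0 0 = B 1 1 := mul_left_cancel₀ n1 (ha00.trans hc.symm)
  have h4 : B 0 0 = A 1 1 := mul_left_cancel₀ n1 (ha00.trans hA.symm)
  have h5 : B 0 0 = 1 := by
    have : (B 0 0 + 1) * (B 0 0 + 1) = 0 := by
      rw [← h3, ← h4] at hb11
      linear_combination hb11 + (1 + B 0 0) * CharTwo.two_eq_zero (R := F)
    exact CharTwo.add_eq_zero.1 (mul_self_eq_zero.1 this)
  rw [h5, mul_one] at ha00
  rw [Prod.mk_eq_one]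
  constructor <;> apply Subtype.ext <;> rw [Matrix.SpecialLinearGroup.coe_one] <;> ext i j <;>
    fin_cases i <;> fin_cases j <;> simp [a10, a01, b10, b01, ha00, h5, ← h3, ← h4]

theorem tensorHom_ne_transp (A B : SpecialLinearGroup (Fin 2) F) : tensorHom (A, B) ≠ transp F := by
  intro h
  have h1 : ∀ X : Matrix (Fin 2) (Fin 2) F, A.1 * X * B.1ᵀ = Xᵀ := fun X => by
    have := toMat_tensorHom_mulVec A B (ofMat X)
    rwa [h, transp_mulVec, toMat_ofMat, toMat_ofMat, eq_comm] at this
  have ha := congrFun (congrFun (h1 !![1, 0; 0, 0]) 0) 0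
  have hb := congrFun (congrFun (h1 !![0, 0; 0, 1]) 1) 1
  have hc := congrFun (congrFun (h1 !![0, 1; 0, 0]) 0) 1
  simp [Matrix.mul_apply] at ha hb hc
  rcases hc with hc | hc <;> simp [hc] at ha hb

/-- A rank one idempotent is conjugate to the first diagonal matrix unit. -/
theorem exists_mul_toMat_eq {x : Fin 2 ⊕ Fin 2 → F} (h1 : plusForm F x = 0)
    (h2 : x (Sum.inl 0) + x (Sum.inr 0) = 1) :
    ∃ C : SpecialLinearGroup (Fin 2) F, C.1 * toMat x = !![1, 0; 0, 0] * C.1 := by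
  have two := CharTwo.two_eq_zero (R := F)
  rw [plusForm_eq] at h1
  generalize hx0 : x (Sum.inl 0) = a at *
  generalize hx1 : x (Sum.inl 1) = b at *
  generalize hx2 : x (Sum.inr 0) = d at *
  generalize hx3 : x (Sum.inr 1) = c at *
  by_cases ha : a = 0
  · subst ha
    refine ⟨⟨!![c, 1; 1, b], ?_⟩, ?_⟩
    · rw [det_fin_two_of]; linear_combination h1 - two
    · ext i j
      fin_cases i <;> fin_cases j <;>
        simp [toMat, hx0, hx1, hx2, hx3, Matrix.mul_apply, Fin.sum_univ_two]
      · linear_combination h1 + h2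
      · simpa using h1
      · linear_combination b * h2 + b * two
  · have h3 : b / a * c = d := by
      rw [div_mul_eq_mul_div, div_eq_iff ha]; linear_combination h1 - a * d * two
    have h4 : b / a * a = b := div_mul_cancel₀ b ha
    refine ⟨⟨!![1, b / a; c, a], ?_⟩, ?_⟩
    · rw [det_fin_two_of]
      linear_combination h2 - h3 - d * two
    · ext i j
      fin_cases i <;> fin_cases j <;>
        simp [toMat, hx0, hx1, hx2, hx3, Matrix.mul_apply, Fin.sum_univ_two]
      · linear_combination h2 + h3
      · linear_combination b / a * h2 - h4
      · linear_combination a * c * two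
      · linear_combination h1

variable [Finite F]

/-- The isometries of the determinant on two-by-two matrices are the maps `X ↦ A * X * Bᵀ` and
`X ↦ A * Xᵀ * Bᵀ`. Left multiplication makes an isometry fix the identity matrix, conjugation makes
it fix the two diagonal matrix units as well, and then it scales or exchanges the other two. -/
theorem range_lift_tensorHom :
    (lift tensorHom (transp F) (transp_mul_self F) transp_mul_tensorHom).range = soPlus F := by
  set R := (lift tensorHom (transp F) (transp_mul_self F) transp_mul_tensorHom).range with hR
  have hf : ∀ A B, tensorHom (A, B) ∈ R := fun A B => ⟨mk A B 1, lift_mk_one _ _ _ _ _ _⟩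
  have hs : transp F ∈ R := ⟨mk 1 1 swap, by
    rw [lift_mk_swap, show tensorHom (1, 1) = (1 : Sp 2 F) from map_one tensorHom, one_mul]⟩
  apply le_antisymm
  · rintro _ ⟨w, rfl⟩
    rw [eq_mk w]
    rcases C2.eq_one_or_swap w.right with hr | hr <;> rw [hr]
    · rw [lift_mk_one]; exact tensorHom_mem_soPlus _ _
    · rw [lift_mk_swap]; exact mul_mem (tensorHom_mem_soPlus _ _) (transp_mem_soPlus F)
  · have red : ∀ t ∈ R, ∀ g : Sp 2 F, t * g ∈ R → g ∈ R := fun t ht g h =>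
      (Subgroup.mul_mem_cancel_left R ht).1 h
    -- Under `toMat` the vectors `e₁`, `f₁` are the diagonal matrix units, and `e₁ + f₁` is the
    -- identity matrix.
    have step3 : ∀ g ∈ soPlus F, g.1 *ᵥ e₁ = e₁ → g.1 *ᵥ f₁ = f₁ →
        (g.1 *ᵥ e₂) (Sum.inr 1) = 0 → g ∈ R := by
      intro g hg h1 h2 h3
      rw [mem_soPlus_iff] at hg
      set y := g.1 *ᵥ e₂ with hy
      set z := g.1 *ᵥ f₂ with hz'
      have y1 : om e₁ y = 0 := by rw [← h1, om_mulVec]; simp [om]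
      have y2 : om f₁ y = 0 := by rw [← h2, om_mulVec]; simp [om]
      have z1 : om e₁ z = 0 := by rw [← h1, om_mulVec]; simp [om]
      have z2 : om f₁ z = 0 := by rw [← h2, om_mulVec]; simp [om]
      have yz : om y z = 1 := by rw [om_mulVec]; simp [om]
      have z3 : plusForm F z = 0 := by rw [hg]; simp [plusForm_eq]
      simp [om] at y1 y2 z1 z2
      simp [om, y1, y2, h3] at yz
      have n1 := left_ne_zero_of_mul_eq_one yz
      have n2 := right_ne_zero_of_mul_eq_one yz
      simp [plusForm_eq, z1, z2, n2] at z3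
      obtain ⟨c, hc⟩ := exists_sq (y (Sum.inl 1))
      have hc0 : c ≠ 0 := by rintro rfl; exact n1 (by rw [← hc, mul_zero])
      have hz : z (Sum.inr 1) = c⁻¹ * c⁻¹ := by
        rw [← mul_inv, hc]; exact eq_inv_of_mul_eq_one_right yz
      have : g = tensorHom (SpecialLinearTwo.torus (Units.mk0 c hc0),
          SpecialLinearTwo.torus (Units.mk0 c⁻¹ (inv_ne_zero hc0))) := by
        apply ext_basis <;> rw [tensorHom_mulVec]
        · rw [h1]; apply vec_ext <;> simp [toMat, ofMat, hc0, Matrix.mul_apply]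
        · rw [← hy]; apply vec_ext <;> simp [toMat, ofMat, y1, y2, h3, ← hc, Matrix.mul_apply]
        · rw [h2]; apply vec_ext <;> simp [toMat, ofMat, hc0, Matrix.mul_apply]
        · rw [← hz']; apply vec_ext <;> simp [toMat, ofMat, z1, z2, z3, hz, Matrix.mul_apply]
      rw [this]
      exact hf _ _
    have step2 : ∀ g ∈ soPlus F, g.1 *ᵥ e₁ = e₁ → g.1 *ᵥ f₁ = f₁ → g ∈ R := by
      intro g hg h1 h2
      by_cases h3 : (g.1 *ᵥ e₂) (Sum.inr 1) = 0
      · exact step3 g hg h1 h2 h3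
      · have y3 : plusForm F (g.1 *ᵥ e₂) = 0 := by
          rw [(mem_soPlus_iff g).1 hg]; simp [plusForm_eq]
        have y1 : om e₁ (g.1 *ᵥ e₂) = 0 := by rw [← h1, om_mulVec]; simp [om]
        simp [om, -mulVec_single] at y1
        rw [plusForm_eq, y1, mul_zero, zero_add] at y3
        refine red _ hs g (step3 _ (mul_mem (transp_mem_soPlus F) hg) ?_ ?_ ?_) <;>
          rw [mul_mulVec, transp_mulVec]
        · rw [h1]; apply vec_ext <;> simp [toMat, ofMat]
        · rw [h2]; apply vec_ext <;> simp [toMat, ofMat]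
        · simpa [toMat, ofMat, h3, -mulVec_single] using y3
    have step1 : ∀ g ∈ soPlus F, g.1 *ᵥ (e₁ + f₁) = e₁ + f₁ → g ∈ R := by
      intro g hg h1
      set x := g.1 *ᵥ e₁ with hx
      have x1 : plusForm F x = 0 := by rw [(mem_soPlus_iff g).1 hg]; simp [plusForm_eq]
      have x2 : x (Sum.inl 0) + x (Sum.inr 0) = 1 := by
        have : om x (e₁ + f₁) = 1 := by rw [← h1, om_mulVec]; simp [om]
        simpa [om] using this
      obtain ⟨C, hC⟩ := exists_mul_toMat_eq x1 x2
      have hC' : C.1 * C⁻¹.1 = 1 := congrArg Subtype.val (mul_inv_cancel C)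
      have t1 : (tensorHom (C, C⁻¹.transpose)).1 *ᵥ x = e₁ := by
        rw [tensorHom_mulVec, Matrix.SpecialLinearGroup.coe_transpose, transpose_transpose, hC, mul_assoc,
          hC', mul_one]
        apply vec_ext <;> simp [ofMat]
      have t2 : (tensorHom (C, C⁻¹.transpose)).1 *ᵥ (e₁ + f₁) = e₁ + f₁ := by
        have : toMat (e₁ + f₁ : Fin 2 ⊕ Fin 2 → F) = 1 := by
          ext i j; fin_cases i <;> fin_cases j <;> simp [toMat]
        rw [tensorHom_mulVec, Matrix.SpecialLinearGroup.coe_transpose, transpose_transpose, this, mul_one,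
          hC']
        apply vec_ext <;> simp [ofMat]
      have t3 : (tensorHom (C, C⁻¹.transpose) * g).1 *ᵥ e₁ = e₁ := by rw [mul_mulVec, ← hx, t1]
      refine red _ (hf C C⁻¹.transpose) g (step2 _ (mul_mem (tensorHom_mem_soPlus _ _) hg) t3 ?_)
      have t4 : (tensorHom (C, C⁻¹.transpose) * g).1 *ᵥ (e₁ + f₁) = e₁ + f₁ := by
        rw [mul_mulVec, h1, t2]
      rw [mulVec_add, t3] at t4
      exact add_left_cancel t4
    intro g hg
    have hdet : (toMat (g.1 *ᵥ (e₁ + f₁))).det = 1 := by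
      rw [det_toMat, (mem_soPlus_iff g).1 hg]; simp [plusForm_eq]
    let Y : SpecialLinearGroup (Fin 2) F := ⟨_, hdet⟩
    refine red (tensorHom (Y⁻¹, 1)) (hf _ _) g
      (step1 _ (mul_mem (tensorHom_mem_soPlus _ _) hg) ?_)
    have : Y⁻¹.1 * Y.1 = 1 := congrArg Subtype.val (inv_mul_cancel Y)
    rw [mul_mulVec, tensorHom_mulVec]
    change ofMat (Y⁻¹.1 * Y.1 * _) = _
    rw [this]
    apply vec_ext <;> simp [ofMat]

variable (F) in
theorem nonempty_sp2Wreath_equiv_soPlus : Nonempty (sp2Wreath F ≃* soPlus F) := by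
  obtain ⟨e⟩ := nonempty_sp2Wreath_equiv F
  exact ⟨(e.trans (RegularWreathProduct.congr sp1Equiv (MulEquiv.refl _))).trans
    ((MonoidHom.ofInjective (lift_injective _ _ _ _ tensorHom_injective tensorHom_ne_transp)).trans
      (MulEquiv.subgroupCongr range_lift_tensorHom))⟩

end SymplecticFour

/-! ### Maximality of the two subgroups -/

namespace SymplecticFour

open Matrix WreathTwo

variable {F : Type*} [Field F] [CharP F 2]

theorem tv_mem_of_mulVec_eq {H : Subgroup (Sp 2 F)} {h : Sp 2 F} (hh : h ∈ H)
    {u w : Fin 2 ⊕ Fin 2 → F} (hu : tv u ∈ H) (huw : h.1 *ᵥ u = w) : tv w ∈ H := by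
  rw [← huw, ← conj_tv]
  exact mul_mem (mul_mem hh hu) (inv_mem hh)

/-- Membership in the first plane `⟨e₁, f₁⟩`. -/
def InPlane₁ (v : Fin 2 ⊕ Fin 2 → F) : Prop := v (Sum.inl 1) = 0 ∧ v (Sum.inr 1) = 0

/-- Membership in the second plane `⟨e₂, f₂⟩`. -/
def InPlane₂ (v : Fin 2 ⊕ Fin 2 → F) : Prop := v (Sum.inl 0) = 0 ∧ v (Sum.inr 0) = 0

variable (F) in
theorem planeSwap_mem : planeSwap F ∈ sp2Wreath F :=
  ⟨1, Equiv.swap 0 1, by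
    rw [show planeDiag (fun i => ((1 : Fin 2 → Sp 1 F) i).1) = 1 from planeDiag_one, one_mul]; rfl⟩

theorem inPlane₁_planeSwap {v : Fin 2 ⊕ Fin 2 → F} (h : InPlane₂ v) :
    InPlane₁ ((planeSwap F).1 *ᵥ v) := by
  have := planePerm_swap_mulVec v
  exact ⟨(this.1 1).trans (by simpa using h.1), (this.2 1).trans (by simpa using h.2)⟩

theorem inPlane₂_planeSwap {v : Fin 2 ⊕ Fin 2 → F} (h : InPlane₁ v) :
    InPlane₂ ((planeSwap F).1 *ᵥ v) := by
  have := planePerm_swap_mulVec v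
  exact ⟨(this.1 0).trans (by simpa using h.1), (this.2 0).trans (by simpa using h.2)⟩

omit [CharP F 2] in
theorem om_eq_zero_of_inPlane {v w : Fin 2 ⊕ Fin 2 → F} (hv : InPlane₁ v) (hw : InPlane₂ w) :
    om v w = 0 := by
  simp [om, hv.1, hv.2, hw.1, hw.2]

/-- An isometry that preserves the first plane also preserves its orthogonal complement, the
second plane. -/
theorem mem_sp2Wreath_of_inPlane₁ {g : Sp 2 F} (h1 : InPlane₁ (g.1 *ᵥ e₁))
    (h2 : InPlane₁ (g.1 *ᵥ f₁)) : g ∈ sp2Wreath F := by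
  have two := CharTwo.two_eq_zero (R := F)
  have hd : om (g.1 *ᵥ e₁) (g.1 *ᵥ f₁) = 1 := by rw [om_mulVec]; simp [om]
  have key : ∀ w, om (g.1 *ᵥ e₁) w = 0 → om (g.1 *ᵥ f₁) w = 0 → InPlane₂ w := by
    intro w a1 a2
    simp only [om, h1.1, h1.2, h2.1, h2.2, zero_mul, mul_zero, add_zero] at hd a1 a2
    constructor
    · linear_combination -w (Sum.inl 0) * hd + (g.1 *ᵥ e₁) (Sum.inl 0) * a2 +
        (g.1 *ᵥ f₁) (Sum.inl 0) * a1 - (g.1 *ᵥ e₁) (Sum.inl 0) * (g.1 *ᵥ f₁) (Sum.inl 0) *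
          w (Sum.inr 0) * two
    · linear_combination -w (Sum.inr 0) * hd + (g.1 *ᵥ e₁) (Sum.inr 0) * a2 +
        (g.1 *ᵥ f₁) (Sum.inr 0) * a1 - (g.1 *ᵥ e₁) (Sum.inr 0) * (g.1 *ᵥ f₁) (Sum.inr 0) *
          w (Sum.inl 0) * two
  have h3 : InPlane₂ (g.1 *ᵥ e₂) := key _ (by rw [om_mulVec]; simp [om])
    (by rw [om_mulVec]; simp [om])
  have h4 : InPlane₂ (g.1 *ᵥ f₂) := key _ (by rw [om_mulVec]; simp [om])
    (by rw [om_mulVec]; simp [om])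
  have he : om (g.1 *ᵥ e₂) (g.1 *ᵥ f₂) = 1 := by rw [om_mulVec]; simp [om]
  simp only [om, h1.1, h1.2, h2.1, h2.2, h3.1, h3.2, h4.1, h4.2, mul_zero, add_zero,
    zero_add] at hd he
  let M : Fin 2 → Matrix (Fin 1 ⊕ Fin 1) (Fin 1 ⊕ Fin 1) F := fun i =>
    of fun r c => g.1 (Sum.map (fun _ => i) (fun _ => i) r) (Sum.map (fun _ => i) (fun _ => i) c)
  have hM : ∀ i, M i ∈ symplecticGroup (Fin 1) F := by
    intro i
    rw [mem_symplecticGroup_one_iff]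
    fin_cases i
    · simp [M] at hd ⊢
      linear_combination hd - g.1 (Sum.inl 0) (Sum.inr 0) * g.1 (Sum.inr 0) (Sum.inl 0) * two
    · simp [M] at he ⊢
      linear_combination he - g.1 (Sum.inl 1) (Sum.inr 1) * g.1 (Sum.inr 1) (Sum.inl 1) * two
  refine ⟨fun i => ⟨M i, hM i⟩, 1, ?_⟩
  rw [planePerm_one, mul_one]
  simp only [InPlane₁, InPlane₂, mulVec_single_one, col_apply] at h1 h2 h3 h4
  ext i j
  rcases i with i | i <;> rcases j with j | j <;> fin_cases i <;> fin_cases j <;>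
    simp [planeDiag, M, h1, h2, h3, h4]

theorem mem_sp2Wreath_of_inPlane₂ {g : Sp 2 F} (h1 : InPlane₂ (g.1 *ᵥ e₁))
    (h2 : InPlane₂ (g.1 *ᵥ f₁)) : g ∈ sp2Wreath F := by
  refine (Subgroup.mul_mem_cancel_left _ (planeSwap_mem F)).1 (mem_sp2Wreath_of_inPlane₁ ?_ ?_) <;>
    rw [mul_mulVec]
  · exact inPlane₁_planeSwap h1
  · exact inPlane₁_planeSwap h2

theorem tv_mem_sp2Wreath_of_inPlane₁ {u : Fin 2 ⊕ Fin 2 → F} (hu : InPlane₁ u) :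
    tv u ∈ sp2Wreath F := by
  apply mem_sp2Wreath_of_inPlane₁ <;> rw [tv_mulVec] <;> constructor <;> simp [hu.1, hu.2]

theorem tv_mem_sp2Wreath_of_inPlane₂ {u : Fin 2 ⊕ Fin 2 → F} (hu : InPlane₂ u) :
    tv u ∈ sp2Wreath F := by
  apply mem_sp2Wreath_of_inPlane₁ <;> rw [tv_mulVec_of_om_eq_zero] <;> simp [InPlane₁, om, hu.1, hu.2]

omit [CharP F 2] in
theorem mul_eq_zero_of_mem_sp2Wreath {g : Sp 2 F} (hg : g ∈ sp2Wreath F) :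
    (g.1 *ᵥ f₁) (Sum.inl 0) * (g.1 *ᵥ f₁) (Sum.inl 1) = 0 := by
  obtain ⟨a, σ, hg⟩ := hg
  have hσ : σ = 1 ∨ σ = Equiv.swap 0 1 := by clear hg; revert σ; decide
  rcases hσ with rfl | rfl
  · rw [planePerm_one, mul_one] at hg
    simp [hg, planeDiag]
  · have h1 := planeDiag_mulVec (fun i => (a i).1) (planePerm (Equiv.swap 0 1) *ᵥ f₁)
    have h2 := planePerm_swap_mulVec (f₁ : Fin 2 ⊕ Fin 2 → F)
    rw [hg, ← mulVec_mulVec, h1.1, h1.1, h2.1, h2.2, h2.1, h2.2]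
    simp

variable [Finite F]

theorem exists_mem_sp2Wreath_of_inPlane₁ {x y : Fin 2 ⊕ Fin 2 → F} (hx : InPlane₁ x)
    (hy : InPlane₁ y) (hx0 : x ≠ 0) (hy0 : y ≠ 0) :
    ∃ t ∈ sp2Wreath F, t.1 *ᵥ x = y ∧ ∀ a, InPlane₂ a → t.1 *ᵥ a = a := by
  have move : ∀ x y : Fin 2 ⊕ Fin 2 → F, InPlane₁ x → InPlane₁ y → om x y ≠ 0 →
      ∃ t ∈ sp2Wreath F, t.1 *ᵥ x = y ∧ ∀ a, InPlane₂ a → t.1 *ᵥ a = a := by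
    intro x y hx hy h
    obtain ⟨c, -, h1, h2⟩ := exists_tv_mulVec_eq h
    refine ⟨_, tv_mem_sp2Wreath_of_inPlane₁ ?_, h1, fun a ha => h2 a ?_⟩
    · simp [InPlane₁, hx.1, hx.2, hy.1, hy.2]
    · rw [om_comm, om_eq_zero_of_inPlane hx ha, om_comm, om_eq_zero_of_inPlane hy ha]
  obtain ⟨z, h1, h2⟩ := exists_om_ne_zero_and hx0 hy0
  -- The projection of `z` to the first plane serves as an intermediate vector.
  let z' : Fin 2 ⊕ Fin 2 → F := z (Sum.inl 0) • e₁ + z (Sum.inr 0) • f₁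
  have hz' : InPlane₁ z' := by simp [InPlane₁, z']
  have h1' : om x z' ≠ 0 := by
    intro h; apply h1; rw [← h]; simp [om, z', hx.1, hx.2]
  have h2' : om z' y ≠ 0 := by
    intro h; apply h2; rw [← h]; simp [om, z', hy.1, hy.2]
  obtain ⟨t, ht, ht1, ht2⟩ := move x z' hx hz' h1'
  obtain ⟨s, hs, hs1, hs2⟩ := move z' y hz' hy h2'
  exact ⟨s * t, mul_mem hs ht, by rw [mul_mulVec, ht1, hs1], fun a ha => by
    rw [mul_mulVec, ht2 a ha, hs2 a ha]⟩

theorem exists_mem_sp2Wreath_of_inPlane₂ {x y : Fin 2 ⊕ Fin 2 → F} (hx : InPlane₂ x)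
    (hy : InPlane₂ y) (hx0 : x ≠ 0) (hy0 : y ≠ 0) :
    ∃ t ∈ sp2Wreath F, t.1 *ᵥ x = y ∧ ∀ a, InPlane₁ a → t.1 *ᵥ a = a := by
  obtain ⟨t, ht, h1, h2⟩ := exists_mem_sp2Wreath_of_inPlane₁ (inPlane₁_planeSwap hx)
    (inPlane₁_planeSwap hy) (mulVec_ne_zero _ hx0) (mulVec_ne_zero _ hy0)
  have hs : ∀ v, (planeSwap F).1 *ᵥ ((planeSwap F).1 *ᵥ v) = v := fun v => by
    rw [← mul_mulVec, planeSwap_mul_self, one_mulVec']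
  refine ⟨planeSwap F * t * planeSwap F, mul_mem (mul_mem (planeSwap_mem F) ht) (planeSwap_mem F),
    ?_, fun a ha => ?_⟩
  · rw [mul_mulVec, mul_mulVec, h1, hs]
  · rw [mul_mulVec, mul_mulVec, h2 _ (inPlane₂_planeSwap ha), hs]

variable (F) in
/-- A larger subgroup contains a transvection whose centre lies in neither plane; the wreath product
permutes these transvections transitively and contains all the others. -/
theorem isCoatom_sp2Wreath : IsCoatom (sp2Wreath F) := by
  refine ⟨fun h => ?_, fun H hH => ?_⟩
  · have := mul_eq_zero_of_mem_sp2Wreath (F := F) (g := tv (e₁ + e₂)) (by rw [h]; trivial)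
    rw [tv_mulVec] at this
    simp [om] at this
  · obtain ⟨hle, g, hg, hgW⟩ := SetLike.lt_iff_le_and_exists.1 hH
    -- A vector with two nonzero components whose transvection lies in `H`.
    have hmixed : ∃ u, tv u ∈ H ∧ ¬ InPlane₁ u ∧ ¬ InPlane₂ u := by
      by_contra! hcon
      have hv : ∀ v, InPlane₁ v → InPlane₁ (g.1 *ᵥ v) ∨ InPlane₂ (g.1 *ᵥ v) := fun v hv => by
        have := hcon (g.1 *ᵥ v) (tv_mem_of_mulVec_eq hg (hle (tv_mem_sp2Wreath_of_inPlane₁ hv)) rfl)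
        tauto
      have hno : ∀ x y : Fin 2 ⊕ Fin 2 → F, InPlane₁ x → InPlane₁ y → om x y = 1 →
          InPlane₁ (g.1 *ᵥ x) → InPlane₂ (g.1 *ᵥ y) → False := by
        intro x y _ _ hxy h1 h2
        rw [← om_mulVec g, om_eq_zero_of_inPlane h1 h2] at hxy
        exact zero_ne_one hxy
      have he : InPlane₁ (e₁ : Fin 2 ⊕ Fin 2 → F) := by simp [InPlane₁]
      have hf : InPlane₁ (f₁ : Fin 2 ⊕ Fin 2 → F) := by simp [InPlane₁]
      rcases hv e₁ he with h1 | h1 <;> rcases hv f₁ hf with h2 | h2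
      · exact hgW (mem_sp2Wreath_of_inPlane₁ h1 h2)
      · exact hno e₁ f₁ he hf (by simp [om]) h1 h2
      · exact hno f₁ e₁ hf he (by simp [om]) h2 h1
      · exact hgW (mem_sp2Wreath_of_inPlane₂ h1 h2)
    obtain ⟨u, huH, hu1, hu2⟩ := hmixed
    apply eq_top_of_tv_mem
    intro w
    by_cases hw1 : InPlane₁ w
    · exact hle (tv_mem_sp2Wreath_of_inPlane₁ hw1)
    by_cases hw2 : InPlane₂ w
    · exact hle (tv_mem_sp2Wreath_of_inPlane₂ hw2)
    let p : (Fin 2 ⊕ Fin 2 → F) → Fin 2 ⊕ Fin 2 → F :=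
      fun v => v (Sum.inl 0) • e₁ + v (Sum.inr 0) • f₁
    let r : (Fin 2 ⊕ Fin 2 → F) → Fin 2 ⊕ Fin 2 → F :=
      fun v => v (Sum.inl 1) • e₂ + v (Sum.inr 1) • f₂
    have hp : ∀ v, InPlane₁ (p v) := fun v => by simp [InPlane₁, p]
    have hr : ∀ v, InPlane₂ (r v) := fun v => by simp [InPlane₂, r]
    have hpr : ∀ v, p v + r v = v := fun v => by apply vec_ext <;> simp [p, r]
    have hp0 : ∀ v, ¬ InPlane₂ v → p v ≠ 0 := fun v hv h => hv (by
      rw [← hpr v, h, zero_add]; exact hr v)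
    have hr0 : ∀ v, ¬ InPlane₁ v → r v ≠ 0 := fun v hv h => hv (by
      rw [← hpr v, h, add_zero]; exact hp v)
    obtain ⟨t, ht, ht1, ht2⟩ := exists_mem_sp2Wreath_of_inPlane₁ (hp u) (hp w) (hp0 u hu2) (hp0 w hw2)
    obtain ⟨s, hs, hs1, hs2⟩ := exists_mem_sp2Wreath_of_inPlane₂ (hr u) (hr w) (hr0 u hu1) (hr0 w hw1)
    refine tv_mem_of_mulVec_eq (mul_mem (hle hs) (hle ht)) huH ?_
    rw [mul_mulVec, ← hpr u, mulVec_add, ht1, ht2 _ (hr u), mulVec_add, hs1, hs2 _ (hp w), hpr]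

omit [Finite F] in
/-- A transvection is orthogonal when its centre is scaled so that `plusForm` takes the value
one. -/
theorem tv_mem_soPlus {u : Fin 2 ⊕ Fin 2 → F} (hu : plusForm F u = 1) : tv u ∈ soPlus F := by
  rw [mem_soPlus_iff]
  intro v
  rw [tv_mulVec, plusForm_add, plusForm_smul, hu, om_smul_right]
  linear_combination om v u * om v u * CharTwo.two_eq_zero (R := F)

/-- Two affine functions that are nonzero at zero are nonzero at a common nonzero point. -/
theorem exists_ne_zero_and_add_mul_ne_zero (hF : 4 ≤ Nat.card F) {a a' : F} (b b' : F)
    (ha : a ≠ 0) (ha' : a' ≠ 0) : ∃ t : F, t ≠ 0 ∧ a + t * b ≠ 0 ∧ a' + t * b' ≠ 0 := by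
  classical
  have := Fintype.ofFinite F
  have hcard : ({0, a / b, a' / b'} : Finset F).card < (Finset.univ : Finset F).card := by
    rw [Finset.card_univ, ← Nat.card_eq_fintype_card]
    exact lt_of_le_of_lt Finset.card_le_three (by omega)
  obtain ⟨t, -, ht⟩ := Finset.exists_mem_notMem_of_card_lt_card hcard
  simp only [Finset.mem_insert, Finset.mem_singleton, not_or] at ht
  have key : ∀ a b : F, a ≠ 0 → t ≠ a / b → a + t * b ≠ 0 := by
    intro a b ha h1 h2
    by_cases hb : b = 0
    · rw [hb, mul_zero, add_zero] at h2; exact ha h2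
    · rw [CharTwo.add_eq_zero] at h2
      exact h1 (by rw [h2, mul_div_cancel_right₀ _ hb])
  exact ⟨t, ht.1, key a b ha ht.2.1, key a' b' ha' ht.2.2⟩

/-- Witt's theorem for vectors: the orthogonal group is transitive on the nonzero vectors at which
the form takes a given value. -/
theorem exists_mem_soPlus_mulVec_eq (hF : 4 ≤ Nat.card F) {x y : Fin 2 ⊕ Fin 2 → F} (hx : x ≠ 0)
    (hy : y ≠ 0) (hxy : plusForm F x = plusForm F y) : ∃ t ∈ soPlus F, t.1 *ᵥ x = y := by
  have move : ∀ x y : Fin 2 ⊕ Fin 2 → F, plusForm F x = plusForm F y → om x y ≠ 0 →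
      ∃ t ∈ soPlus F, t.1 *ᵥ x = y := by
    intro x y hxy h
    obtain ⟨c, h0, h1, -⟩ := exists_tv_mulVec_eq h
    refine ⟨_, tv_mem_soPlus ?_, h1⟩
    rw [plusForm_smul, plusForm_add, hxy, CharTwo.add_self_eq_zero, zero_add, h0]
  by_cases h : om x y = 0
  · -- It suffices to find a nonsingular vector that is orthogonal neither to `x` nor to `y`.
    obtain ⟨v, hv, h1, h2⟩ : ∃ v, plusForm F v ≠ 0 ∧ om x v ≠ 0 ∧ om v y ≠ 0 := by
      obtain ⟨z, h1, h2⟩ := exists_om_ne_zero_and hx hy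
      by_cases hz : plusForm F z = 0
      · obtain ⟨w, hw, hzw⟩ : ∃ w, plusForm F w = 0 ∧ om z w ≠ 0 := by
          by_contra! hcon
          have hz0 : z ≠ 0 := by rintro rfl; simp [om] at h1
          refine hz0 (vec_ext ?_ ?_ ?_ ?_)
          · simpa [om] using hcon f₁ (by simp [plusForm_eq])
          · simpa [om] using hcon f₂ (by simp [plusForm_eq])
          · simpa [om] using hcon e₁ (by simp [plusForm_eq])
          · simpa [om] using hcon e₂ (by simp [plusForm_eq])
        obtain ⟨t, ht, ht1, ht2⟩ :=
          exists_ne_zero_and_add_mul_ne_zero hF (om x w) (om w y) h1 h2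
        refine ⟨z + t • w, ?_, ?_, ?_⟩
        · rw [plusForm_add, plusForm_smul, hz, hw, om_smul_right]
          simpa using ⟨ht, hzw⟩
        · rwa [om_add_right, om_smul_right]
        · rwa [om_add_left, om_smul_left]
      · exact ⟨z, hz, h1, h2⟩
    obtain ⟨c, hc⟩ := exists_sq (plusForm F v)⁻¹
    have hc0 : c ≠ 0 := by
      rintro rfl; exact inv_ne_zero hv (by rw [← hc, mul_zero])
    have hm : tv (c • v) ∈ soPlus F :=
      tv_mem_soPlus (by rw [plusForm_smul, hc, inv_mul_cancel₀ hv])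
    obtain ⟨t, ht, ht1⟩ := move ((tv (c • v)).1 *ᵥ x) y
      (by rw [(mem_soPlus_iff _).1 hm, hxy]) (by
        rw [tv_mulVec, om_add_left, h, zero_add, om_smul_left, om_smul_left, om_smul_right]
        exact mul_ne_zero (mul_ne_zero hc0 h1) (mul_ne_zero hc0 h2))
    exact ⟨t * tv (c • v), mul_mem ht hm, by rw [mul_mulVec, ht1]⟩
  · exact move x y hxy h

/-- The difference of two quadratic forms with the same polar form is the square of a linear
form. -/
theorem exists_plusForm_mulVec (g : Sp 2 F) :
    ∃ d, ∀ v, plusForm F (g.1 *ᵥ v) = plusForm F v + om v d * om v d := by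
  obtain ⟨a, ha⟩ := exists_sq (plusForm F (g.1 *ᵥ e₁))
  obtain ⟨b, hb⟩ := exists_sq (plusForm F (g.1 *ᵥ e₂))
  obtain ⟨c, hc⟩ := exists_sq (plusForm F (g.1 *ᵥ f₁))
  obtain ⟨d, hd⟩ := exists_sq (plusForm F (g.1 *ᵥ f₂))
  refine ⟨a • f₁ + b • f₂ + c • e₁ + d • e₂, fun v => ?_⟩
  have hv := eq_sum_basis v
  conv_lhs => rw [hv]
  simp only [mulVec_add, mulVec_smul, plusForm_add, plusForm_smul, om_add_left, om_smul_left,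
    om_smul_right, om_mulVec, ← ha, ← hb, ← hc, ← hd]
  simp [om, plusForm_eq]
  linear_combination (-(v (Sum.inl 0) * a * (v (Sum.inl 1) * b) +
    v (Sum.inl 0) * a * (v (Sum.inr 0) * c) + v (Sum.inl 0) * a * (v (Sum.inr 1) * d) +
    v (Sum.inl 1) * b * (v (Sum.inr 0) * c) + v (Sum.inl 1) * b * (v (Sum.inr 1) * d) +
    v (Sum.inr 0) * c * (v (Sum.inr 1) * d))) * CharTwo.two_eq_zero (R := F)

/-- A larger subgroup contains a conjugate of the orthogonal group, and therefore the transvections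
with centre `u` such that `plusForm u + om u d ^ 2 = 1` for some `d ≠ 0`. Every orbit of the
orthogonal group on nonzero vectors contains such a `u`. -/
theorem isCoatom_soPlus (hF : 4 ≤ Nat.card F) : IsCoatom (soPlus F) := by
  refine ⟨fun h => ?_, fun H hH => ?_⟩
  · have := (mem_soPlus_iff (F := F) (tv e₁)).1 (by rw [h]; trivial) f₁
    rw [tv_mulVec] at this
    simp [om, plusForm_eq] at this
  · obtain ⟨hle, g, hg, hgO⟩ := SetLike.lt_iff_le_and_exists.1 hH
    obtain ⟨d, hd⟩ := exists_plusForm_mulVec g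
    have hd0 : d ≠ 0 := by
      rintro rfl
      refine hgO ((mem_soPlus_iff g).2 fun v => ?_)
      rw [hd]; simp [om]
    apply eq_top_of_tv_mem
    intro w
    by_cases hw : w = 0
    · have : tv w = 1 := by
        apply ext_basis <;> rw [tv_mulVec, hw, smul_zero, add_zero, one_mulVec']
      rw [this]; exact one_mem H
    -- In each orbit of the orthogonal group there is a `u` with `plusForm (g u) = 1`.
    obtain ⟨m, hm⟩ := exists_sq (1 + plusForm F w)
    have hd' : (e₁ + plusForm F d • f₁ : Fin 2 ⊕ Fin 2 → F) ≠ 0 := fun h => by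
      simpa using congrFun h (Sum.inl 0)
    obtain ⟨h, hh, hh1⟩ := exists_mem_soPlus_mulVec_eq hF hd0 hd' (by simp [plusForm_eq])
    let u' : Fin 2 ⊕ Fin 2 → F := m • f₁ + e₂ + plusForm F w • f₂
    have hu'0 : u' ≠ 0 := fun h => by simpa [u'] using congrFun h (Sum.inl 1)
    have hu' : plusForm F u' = plusForm F w := by simp [u', plusForm_eq]
    have hu'd : om u' (e₁ + plusForm F d • f₁) = m := by simp [u', om]
    have hu : tv (h⁻¹.1 *ᵥ u') ∈ H := by
      refine tv_mem_of_mulVec_eq (inv_mem hg) (u := g.1 *ᵥ (h⁻¹.1 *ᵥ u')) (hle (tv_mem_soPlus ?_))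
        (inv_mulVec_mulVec _ _)
      rw [hd, (mem_soPlus_iff _).1 (inv_mem hh), om_inv_mulVec, hh1, hu'd, hm, hu']
      linear_combination plusForm F w * CharTwo.two_eq_zero (R := F)
    obtain ⟨t, ht, ht1⟩ := exists_mem_soPlus_mulVec_eq hF hu'0 hw hu'
    refine tv_mem_of_mulVec_eq (mul_mem (hle ht) (hle hh)) hu ?_
    rw [mul_mulVec, mulVec_inv_mulVec, ht1]

end SymplecticFour

/-! ### Idempotents of linear characters of subgroups -/

namespace FiniteGroupCharacters

open MonoidAlgebra

variable {G : Type*} [Group G] [Finite G]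

/-- The idempotent `|K|⁻¹ ∑ θ(k⁻¹) k` of the group algebra of `G` that belongs to a linear
character `θ` of a subgroup `K`. -/
noncomputable def linIdem (K : Subgroup G) (θ : K →* ℂ) : MonoidAlgebra ℂ G :=
  (Nat.card K : ℂ)⁻¹ • ∑ᶠ k : K, θ k⁻¹ • of ℂ G k

variable {K : Subgroup G} {θ : K →* ℂ}

omit [Finite G] in
theorem linChar_inv_mul (k : K) : θ k⁻¹ * θ k = 1 := by
  rw [← map_mul, inv_mul_cancel, map_one]

theorem of_mul_linIdem (k : K) : of ℂ G k * linIdem K θ = θ k • linIdem K θ := by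
  have := Fintype.ofFinite K
  simp only [linIdem, finsum_eq_sum_of_fintype, mul_smul_comm, Finset.mul_sum, ← map_mul]
  rw [smul_comm (θ k), Finset.smul_sum (r := θ k)]
  refine congrArg _ (Fintype.sum_equiv (Equiv.mulLeft k) _ _ fun x => ?_)
  have h : θ k * θ (k * x)⁻¹ = θ x⁻¹ := by
    rw [mul_inv_rev, map_mul, mul_left_comm, mul_comm (θ k), linChar_inv_mul, mul_one]
  rw [Equiv.coe_mulLeft, smul_smul, h]
  rfl

theorem linIdem_mul_of (k : K) : linIdem K θ * of ℂ G k = θ k • linIdem K θ := by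
  have := Fintype.ofFinite K
  simp only [linIdem, finsum_eq_sum_of_fintype, smul_mul_assoc, Finset.sum_mul, ← map_mul]
  rw [smul_comm (θ k), Finset.smul_sum (r := θ k)]
  refine congrArg _ (Fintype.sum_equiv (Equiv.mulRight k) _ _ fun x => ?_)
  have h : θ k * θ (x * k)⁻¹ = θ x⁻¹ := by
    rw [mul_inv_rev, map_mul, ← mul_assoc, mul_comm (θ k), linChar_inv_mul, one_mul]
  rw [Equiv.coe_mulRight, smul_smul, h]
  rfl

/-- The idempotent of a subgroup absorbs every element on which its left multiplications agree with
the linear character. -/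
theorem linIdem_mul_of_forall {x : MonoidAlgebra ℂ G} (hx : ∀ k : K, of ℂ G k * x = θ k • x) :
    linIdem K θ * x = x := by
  have := Fintype.ofFinite K
  have hK : (Nat.card K : ℂ) ≠ 0 := Nat.cast_ne_zero.2 Nat.card_pos.ne'
  rw [linIdem, finsum_eq_sum_of_fintype, smul_mul_assoc, Finset.sum_mul]
  simp only [smul_mul_assoc, hx, smul_smul, linChar_inv_mul, one_smul]
  rw [Finset.sum_const, Finset.card_univ, ← Nat.card_eq_fintype_card, ← Nat.cast_smul_eq_nsmul ℂ,
    smul_smul, inv_mul_cancel₀ hK, one_smul]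

theorem mul_linIdem_of_forall {x : MonoidAlgebra ℂ G} (hx : ∀ k : K, x * of ℂ G k = θ k • x) :
    x * linIdem K θ = x := by
  have := Fintype.ofFinite K
  have hK : (Nat.card K : ℂ) ≠ 0 := Nat.cast_ne_zero.2 Nat.card_pos.ne'
  rw [linIdem, finsum_eq_sum_of_fintype, mul_smul_comm, Finset.mul_sum]
  simp only [mul_smul_comm, hx, smul_smul, linChar_inv_mul, one_smul]
  rw [Finset.sum_const, Finset.card_univ, ← Nat.card_eq_fintype_card, ← Nat.cast_smul_eq_nsmul ℂ,
    smul_smul, inv_mul_cancel₀ hK, one_smul]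

theorem linIdem_mul_self : linIdem K θ * linIdem K θ = linIdem K θ :=
  linIdem_mul_of_forall of_mul_linIdem

theorem linIdem_coeff_one : (linIdem K θ).coeff 1 = (Nat.card K : ℂ)⁻¹ := by
  classical
  have := Fintype.ofFinite K
  have h : ∀ k : K, (θ k⁻¹ • of ℂ G k).coeff 1 = if k = 1 then 1 else 0 := by
    intro k
    rw [coeff_smul, of_apply, coeff_single, Finsupp.smul_apply, Finsupp.single_apply]
    by_cases hk : k = 1
    · simp [hk]
    · simp [hk]
  rw [linIdem, finsum_eq_sum_of_fintype, coeff_smul, coeff_sum, Finsupp.smul_apply,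
    Finsupp.finsetSum_apply, Finset.sum_congr rfl fun k _ => h k]
  simp

theorem linIdem_ne_zero : linIdem K θ ≠ 0 := by
  intro h
  have h1 := linIdem_coeff_one (K := K) (θ := θ)
  rw [h] at h1
  exact inv_ne_zero (Nat.cast_ne_zero.2 Nat.card_pos.ne') h1.symm

/-- Mackey's criterion, in the form of a vanishing statement: a double coset on which the two
restrictions of `θ` differ contributes nothing. -/
theorem linIdem_mul_of_mul_linIdem_eq_zero {g : G} {h h' : K} (hg : (h : G) * g = g * h')
    (hθ : θ h ≠ θ h') : linIdem K θ * of ℂ G g * linIdem K θ = 0 := by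
  have h1 : θ h • (linIdem K θ * of ℂ G g * linIdem K θ) =
      θ h' • (linIdem K θ * of ℂ G g * linIdem K θ) := by
    rw [← smul_mul_assoc, ← smul_mul_assoc, ← linIdem_mul_of, ← mul_smul_comm, ← of_mul_linIdem,
      mul_assoc (linIdem K θ) (of ℂ G h), ← map_mul, hg, map_mul]
    simp only [mul_assoc]
  rw [← sub_eq_zero, ← sub_smul] at h1
  exact (smul_eq_zero.1 h1).resolve_left (sub_ne_zero.2 hθ)

theorem card_div_card (K : Subgroup G) : (Nat.card G : ℂ) * (Nat.card K : ℂ)⁻¹ = K.index := by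
  have hK : (Nat.card K : ℂ) ≠ 0 := Nat.cast_ne_zero.2 Nat.card_pos.ne'
  rw [← K.index_mul_card, Nat.cast_mul, mul_assoc, mul_inv_cancel₀ hK, mul_one]

/-- If `θ` and each of its conjugates by elements outside `K` differ where both are defined, then
`θ` induces an irreducible character. -/
theorem exists_irrChar_index (K : Subgroup G) (θ : K →* ℂ)
    (hθ : ∀ g ∉ K, ∃ h h' : K, (h : G) * g = g * h' ∧ θ h ≠ θ h') :
    ∃ χ ∈ IrrChar G, χ 1 = K.index := by
  obtain ⟨χ, hχ, h1⟩ := exists_irrChar_of_idempotent (linIdem K θ) linIdem_mul_self linIdem_ne_zero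
    fun g => by
      by_cases hg : g ∈ K
      · refine ⟨θ ⟨g, hg⟩, ?_⟩
        have := linIdem_mul_of (θ := θ) ⟨g, hg⟩
        rw [of_apply] at this
        rw [this, smul_mul_assoc, linIdem_mul_self]
      · obtain ⟨h, h', h1, h2⟩ := hθ g hg
        exact ⟨0, by rw [zero_smul]; exact linIdem_mul_of_mul_linIdem_eq_zero h1 h2⟩
  exact ⟨χ, hχ, by rw [h1, linIdem_coeff_one, card_div_card]⟩

/-- Let `θ` be a linear character of a subgroup `P` that is the union of the subgroup `B` and one
further double coset of `B`. Then the restriction of `θ` to `B` induces the sum of `θ` and one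
further irreducible character of `P`; under Mackey's condition, that character induces an
irreducible character of `G`. -/
theorem exists_irrChar_index_sub (B P : Subgroup G) (hBP : B < P) (θ : P →* ℂ)
    (hθ : ∀ g ∉ P, ∃ h h' : B, (h : G) * g = g * h' ∧
      θ (Subgroup.inclusion hBP.le h) ≠ θ (Subgroup.inclusion hBP.le h'))
    (hdouble : ∀ p ∈ P, ∀ p' ∈ P, p ∉ B → p' ∉ B → ∃ b ∈ B, ∃ b' ∈ B, p' = b * p * b') :
    ∃ χ ∈ IrrChar G, χ 1 = B.index - P.index := by
  classical
  have := Fintype.ofFinite P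
  obtain ⟨eP, heP⟩ : ∃ x, x = linIdem P θ := ⟨_, rfl⟩
  obtain ⟨eB, heB⟩ : ∃ x, x = linIdem B (θ.comp (Subgroup.inclusion hBP.le)) := ⟨_, rfl⟩
  have hPP : eP * eP = eP := by rw [heP]; exact linIdem_mul_self
  have hBB : eB * eB = eB := by rw [heB]; exact linIdem_mul_self
  have hBP' : eB * eP = eP := by
    rw [heB, heP]
    exact linIdem_mul_of_forall fun k => of_mul_linIdem (θ := θ) (Subgroup.inclusion hBP.le k)
  have hPB : eP * eB = eP := by
    rw [heB, heP]
    exact mul_linIdem_of_forall fun k => linIdem_mul_of (θ := θ) (Subgroup.inclusion hBP.le k)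
  have hff : (eB - eP) * (eB - eP) = eB - eP := by
    rw [sub_mul, mul_sub, mul_sub, hPP, hBB, hBP', hPB, sub_self, sub_zero]
  have hfB : (eB - eP) * eB = eB - eP := by rw [sub_mul, hBB, hPB]
  have hBf : eB * (eB - eP) = eB - eP := by rw [mul_sub, hBB, hBP']
  have hfP : (eB - eP) * eP = 0 := by rw [sub_mul, hPP, hBP', sub_self]
  have hcoeff : (eB - eP).coeff 1 = (Nat.card B : ℂ)⁻¹ - (Nat.card P : ℂ)⁻¹ := by
    rw [← linIdem_coeff_one (K := P) (θ := θ), ← linIdem_coeff_one (K := B), heB, heP]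
    rfl
  have hlt : Nat.card B < Nat.card P := Set.ncard_lt_ncard hBP (Set.toFinite _)
  have hf0 : eB - eP ≠ 0 := by
    intro h
    rw [h] at hcoeff
    have h1 := sub_eq_zero.1 hcoeff.symm
    exact hlt.ne (by exact_mod_cast inv_injective h1)
  have a0 : ∀ x, (eB - eP) * x * (eB - eP) = (eB - eP) * (eB * x * eB) * (eB - eP) := by
    intro x
    rw [← mul_assoc, ← mul_assoc, hfB, mul_assoc _ eB, hBf]
  -- The elements of `P` outside `B` all act in the same way between two copies of `eB`.
  have hN : ∀ p ∈ P, p ∉ B → ∃ c : ℂ, (eB - eP) * of ℂ G p * (eB - eP) = c • (eB - eP) := by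
    intro p hp hpB
    have key : ∀ p' : P, (p' : G) ∉ B → θ p'⁻¹ • (eB * of ℂ G p' * eB) =
        θ (⟨p, hp⟩ : P)⁻¹ • (eB * of ℂ G p * eB) := by
      intro p' hp'
      obtain ⟨b, hb, b', hb', h⟩ := hdouble p hp p' p'.2 hpB hp'
      have h1 : p' = Subgroup.inclusion hBP.le ⟨b, hb⟩ * ⟨p, hp⟩ *
          Subgroup.inclusion hBP.le ⟨b', hb'⟩ := Subtype.ext h
      have h2 : eB * of ℂ G p' * eB = (θ (Subgroup.inclusion hBP.le ⟨b, hb⟩) *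
          θ (Subgroup.inclusion hBP.le ⟨b', hb'⟩)) • (eB * of ℂ G p * eB) := by
        have a1 := linIdem_mul_of (θ := θ.comp (Subgroup.inclusion hBP.le)) (⟨b, hb⟩ : B)
        have a2 := of_mul_linIdem (θ := θ.comp (Subgroup.inclusion hBP.le)) (⟨b', hb'⟩ : B)
        rw [← heB] at a1 a2
        rw [h, map_mul, map_mul, mul_assoc, mul_assoc (_ * _), a2, ← mul_assoc, ← mul_assoc, a1,
          mul_smul_comm, smul_mul_assoc, smul_mul_assoc, smul_smul, mul_comm]
        rfl
      rw [h2, smul_smul]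
      congr 1
      rw [h1, mul_inv_rev, mul_inv_rev, map_mul, map_mul]
      have c1 := linChar_inv_mul (θ := θ) (Subgroup.inclusion hBP.le ⟨b, hb⟩)
      have c2 := linChar_inv_mul (θ := θ) (Subgroup.inclusion hBP.le ⟨b', hb'⟩)
      linear_combination (θ (⟨p, hp⟩ : P)⁻¹) * c1 + (θ (⟨p, hp⟩ : P)⁻¹) *
        (θ (Subgroup.inclusion hBP.le ⟨b, hb⟩)⁻¹ * θ (Subgroup.inclusion hBP.le ⟨b, hb⟩)) * c2
    obtain ⟨X, hX⟩ : ∃ X, X = θ (⟨p, hp⟩ : P)⁻¹ • ((eB - eP) * of ℂ G p * (eB - eP)) := ⟨_, rfl⟩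
    have hite : ∀ p' : P, (eB - eP) * (θ p'⁻¹ • of ℂ G p') * (eB - eP) =
        if (p' : G) ∈ B then eB - eP else X := by
      intro p'
      split_ifs with hp'
      · have a1 := linIdem_mul_of (θ := θ.comp (Subgroup.inclusion hBP.le)) (⟨p', hp'⟩ : B)
        rw [← heB] at a1
        rw [a0, mul_smul_comm, a1, smul_smul]
        have : θ p'⁻¹ * (θ.comp (Subgroup.inclusion hBP.le)) ⟨p', hp'⟩ = 1 := linChar_inv_mul p'
        rw [this, one_smul, hBB, hfB, hff]
      · rw [a0, mul_smul_comm, smul_mul_assoc, key p' hp', hX, a0 (of ℂ G p), mul_smul_comm,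
          smul_mul_assoc]
    have hsum : ∑ p' : P, (if (p' : G) ∈ B then eB - eP else X) = 0 := by
      have hP : (Nat.card P : ℂ) ≠ 0 := Nat.cast_ne_zero.2 Nat.card_pos.ne'
      have h1 : ∑ p' : P, θ p'⁻¹ • of ℂ G p' = (Nat.card P : ℂ) • eP := by
        rw [heP, linIdem, finsum_eq_sum_of_fintype, smul_smul, mul_inv_cancel₀ hP, one_smul]
      rw [← Finset.sum_congr rfl fun p' _ => hite p', ← Finset.sum_mul, ← Finset.mul_sum, h1,
        mul_smul_comm, hfP, smul_zero, zero_mul]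
    rw [Finset.sum_ite, Finset.sum_const, Finset.sum_const, ← Nat.cast_smul_eq_nsmul ℂ,
      ← Nat.cast_smul_eq_nsmul ℂ] at hsum
    have hne : ((Finset.univ.filter fun p' : P => (p' : G) ∉ B).card : ℂ) ≠ 0 :=
      Nat.cast_ne_zero.2 (Finset.card_ne_zero_of_mem (a := ⟨p, hp⟩) (by simpa using hpB))
    have hX' : (eB - eP) * of ℂ G p * (eB - eP) = θ ⟨p, hp⟩ • X := by
      rw [hX, smul_smul, mul_comm, linChar_inv_mul, one_smul]
    rw [← inv_smul_smul₀ hne X, eq_neg_of_add_eq_zero_right hsum, ← neg_smul, smul_smul,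
      smul_smul] at hX'
    exact ⟨_, hX'⟩
  obtain ⟨χ, hχ, h1⟩ := exists_irrChar_of_idempotent (eB - eP) hff hf0 fun g => by
    rw [← of_apply]
    by_cases hgP : g ∈ P
    · by_cases hgB : g ∈ B
      · have a1 := linIdem_mul_of (θ := θ.comp (Subgroup.inclusion hBP.le)) (⟨g, hgB⟩ : B)
        have a2 := linIdem_mul_of (θ := θ) ⟨g, hgP⟩
        rw [← heB] at a1
        rw [← heP] at a2
        refine ⟨θ ⟨g, hgP⟩, ?_⟩
        have a3 : (eB - eP) * of ℂ G g = θ ⟨g, hgP⟩ • (eB - eP) := by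
          rw [sub_mul, smul_sub]
          exact congrArg₂ _ a1 a2
        rw [a3, smul_mul_assoc, hff]
      · exact hN g hgP hgB
    · obtain ⟨h, h', h1, h2⟩ := hθ g hgP
      refine ⟨0, ?_⟩
      have h0 : eB * of ℂ G g * eB = 0 := by
        rw [heB]; exact linIdem_mul_of_mul_linIdem_eq_zero h1 h2
      rw [a0, h0, mul_zero, zero_mul, zero_smul]
  refine ⟨χ, hχ, ?_⟩
  rw [h1, hcoeff, mul_sub, card_div_card, card_div_card]

end FiniteGroupCharacters

/-! ### The Borel subgroup and the stabilizer of a line -/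

namespace SymplecticFour

open Matrix FiniteGroupCharacters

variable {F : Type*} [Field F] [CharP F 2]

variable (F) in
/-- The maximal parabolic subgroup that stabilizes the line `⟨e₁⟩`. -/
def parabolic : Subgroup (Sp 2 F) where
  carrier := {g | ∃ a : F, g.1 *ᵥ e₁ = a • e₁}
  one_mem' := ⟨1, by rw [one_mulVec', one_smul]⟩
  mul_mem' := by
    rintro g h ⟨a, ha⟩ ⟨b, hb⟩
    exact ⟨b * a, by rw [mul_mulVec, hb, mulVec_smul, ha, smul_smul]⟩
  inv_mem' := by
    rintro g ⟨a, ha⟩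
    refine ⟨a⁻¹, ?_⟩
    have ha0 : a ≠ 0 := by
      rintro rfl
      exact mulVec_ne_zero g (v := e₁) (by simp) (by rw [ha, zero_smul])
    rw [eq_inv_smul_iff₀ ha0, ← mulVec_smul, ← ha, inv_mulVec_mulVec]

omit [CharP F 2] in
theorem mulVec_e₁ {g : Sp 2 F} (hg : g ∈ parabolic F) :
    g.1 *ᵥ e₁ = (g.1 *ᵥ e₁) (Sum.inl 0) • e₁ := by
  obtain ⟨a, ha⟩ := hg
  rw [ha]; simp

theorem om_e₁_mulVec {g : Sp 2 F} (hg : g ∈ parabolic F) {v : Fin 2 ⊕ Fin 2 → F}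
    (hv : om e₁ v = 0) : om e₁ (g.1 *ᵥ v) = 0 := by
  obtain ⟨a, ha⟩ := inv_mem hg
  rw [om_comm, om_comm, ← om_inv_mulVec, ha, om_smul_left, hv, mul_zero]

theorem mulVec_e₂_inr_zero {g : Sp 2 F} (hg : g ∈ parabolic F) :
    (g.1 *ᵥ e₂) (Sum.inr 0) = 0 := by
  simpa [om, -mulVec_single] using om_e₁_mulVec hg (v := e₂) (by simp [om])

theorem om_mulVec_e₂ {g h : Sp 2 F} (hg : g ∈ parabolic F) (hh : h ∈ parabolic F) :
    om (g.1 *ᵥ e₂) (h.1 *ᵥ e₂) = (g.1 *ᵥ e₂) (Sum.inl 1) * (h.1 *ᵥ e₂) (Sum.inr 1) +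
      (g.1 *ᵥ e₂) (Sum.inr 1) * (h.1 *ᵥ e₂) (Sum.inl 1) := by
  rw [om, mulVec_e₂_inr_zero hg, mulVec_e₂_inr_zero hh, mul_zero, zero_mul, add_zero, zero_add]

omit [CharP F 2] in
theorem om_e₂ (v : Fin 2 ⊕ Fin 2 → F) : om e₂ v = v (Sum.inr 1) := by
  simp [om]

theorem mulVec_e₂ {g : Sp 2 F} (hg : g ∈ parabolic F) (hg' : om e₂ (g.1 *ᵥ e₂) = 0) :
    g.1 *ᵥ e₂ = (g.1 *ᵥ e₂) (Sum.inl 0) • e₁ + (g.1 *ᵥ e₂) (Sum.inl 1) • e₂ := by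
  rw [om_e₂] at hg'
  have := mulVec_e₂_inr_zero hg
  generalize g.1 *ᵥ e₂ = y at *
  apply vec_ext <;> simp [hg', this]

variable (F) in
/-- The Borel subgroup that stabilizes the flag `⟨e₁⟩ < ⟨e₁, e₂⟩`. As `⟨e₁, e₂⟩` is its own
orthogonal complement, an element of `parabolic F` belongs to it if it sends `e₂` to a vector
orthogonal to `e₂`. -/
def borel : Subgroup (Sp 2 F) where
  carrier := {g | g ∈ parabolic F ∧ om e₂ (g.1 *ᵥ e₂) = 0}
  one_mem' := ⟨one_mem _, by rw [one_mulVec', om_self]⟩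
  mul_mem' := by
    rintro g h ⟨hg, hg'⟩ ⟨hh, hh'⟩
    refine ⟨mul_mem hg hh, ?_⟩
    rw [mul_mulVec, mulVec_e₂ hh hh', mulVec_add, mulVec_smul, mulVec_smul, mulVec_e₁ hg,
      om_add_right, om_smul_right, om_smul_right, om_smul_right, hg']
    simp [om]
  inv_mem' := by
    rintro g ⟨hg, hg'⟩
    exact ⟨inv_mem hg, by rw [om_comm, om_inv_mulVec, hg']⟩

theorem borel_le_parabolic : borel F ≤ parabolic F := fun _ h => h.1

/-- The linear character `g ↦ α (g₁₁)` of the stabilizer of the line `⟨e₁⟩`. -/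
noncomputable def parabolicChar (α : MulChar F ℂ) : parabolic F →* ℂ where
  toFun g := α ((g.1.1 *ᵥ e₁) (Sum.inl 0))
  map_one' := by
    rw [Subgroup.coe_one, one_mulVec']; simp
  map_mul' g h := by
    rw [Subgroup.coe_mul, mul_mulVec, mulVec_e₁ h.2, mulVec_smul, mulVec_e₁ g.2, ← map_mul]
    simp [mul_comm]

/-- The linear character `g ↦ α (g₁₁) β (g₂₂)` of the Borel subgroup. -/
noncomputable def borelChar (α β : MulChar F ℂ) : borel F →* ℂ where
  toFun g := α ((g.1.1 *ᵥ e₁) (Sum.inl 0)) * β ((g.1.1 *ᵥ e₂) (Sum.inl 1))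
  map_one' := by
    rw [Subgroup.coe_one, one_mulVec', one_mulVec']; simp
  map_mul' g h := by
    have h1 : ((g * h).1.1 *ᵥ e₁) (Sum.inl 0) =
        (g.1.1 *ᵥ e₁) (Sum.inl 0) * (h.1.1 *ᵥ e₁) (Sum.inl 0) := by
      rw [Subgroup.coe_mul, mul_mulVec, mulVec_e₁ h.2.1, mulVec_smul, mulVec_e₁ g.2.1]
      simp [mul_comm]
    have h2 : ((g * h).1.1 *ᵥ e₂) (Sum.inl 1) =
        (g.1.1 *ᵥ e₂) (Sum.inl 1) * (h.1.1 *ᵥ e₂) (Sum.inl 1) := by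
      rw [Subgroup.coe_mul, mul_mulVec, mulVec_e₂ h.2.1 h.2.2, mulVec_add, mulVec_smul,
        mulVec_smul, mulVec_e₁ g.2.1, mulVec_e₂ g.2.1 g.2.2]
      simp [mul_comm]
    rw [h1, h2, map_mul, map_mul]; ring

/-- The isometry that multiplies `v` by `a`, multiplies `w` by `a⁻¹` and fixes the orthogonal
complement of the hyperbolic pair `v`, `w`. -/
def hyp (v w : Fin 2 ⊕ Fin 2 → F) (h : om v w = 1) (a : F) (ha : a ≠ 0) : Sp 2 F :=
  ofLinear
    { toFun := fun x => x + (om x w * (a + 1)) • v + (om x v * (a⁻¹ + 1)) • w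
      map_add' := fun x y => by
        rw [om_add_left, om_add_left, add_mul, add_mul, add_smul, add_smul]; abel
      map_smul' := fun c x => by
        rw [om_smul_left, om_smul_left, smul_add, smul_add, smul_smul, smul_smul, mul_assoc,
          mul_assoc]; rfl }
    fun x y => by
      have h1 := mul_inv_cancel₀ ha
      simp only [LinearMap.coe_mk, AddHom.coe_mk, om_add_left, om_add_right, om_smul_left,
        om_smul_right, om_self, om_comm v y, om_comm w y, om_comm w v, h]
      linear_combination (om x w * om y v + om x v * om y w) * h1 +
        (om x w * om y v + om x v * om y w) * (a + a⁻¹ + 2) * CharTwo.two_eq_zero (R := F)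

theorem hyp_mulVec (v w : Fin 2 ⊕ Fin 2 → F) (h : om v w = 1) (a : F) (ha : a ≠ 0)
    (x : Fin 2 ⊕ Fin 2 → F) : (hyp v w h a ha).1 *ᵥ x =
      x + (om x w * (a + 1)) • v + (om x v * (a⁻¹ + 1)) • w :=
  ofLinear_mulVec _ _ _

theorem hyp_mulVec_left {v w : Fin 2 ⊕ Fin 2 → F} (h : om v w = 1) {a : F} (ha : a ≠ 0) :
    (hyp v w h a ha).1 *ᵥ v = a • v := by
  rw [hyp_mulVec, h, om_self, one_mul, zero_mul, zero_smul, add_zero, add_smul, one_smul,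
    add_comm (a • v), ← add_assoc, add_self_vec, zero_add]

theorem hyp_mulVec_right {v w : Fin 2 ⊕ Fin 2 → F} (h : om v w = 1) {a : F} (ha : a ≠ 0) :
    (hyp v w h a ha).1 *ᵥ w = a⁻¹ • w := by
  rw [hyp_mulVec, om_comm w v, h, om_self, one_mul, zero_mul, zero_smul, add_zero, add_smul,
    one_smul, add_comm (a⁻¹ • w), ← add_assoc, add_self_vec, zero_add]

theorem hyp_mulVec_of_om_eq_zero {v w x : Fin 2 ⊕ Fin 2 → F} (h : om v w = 1) {a : F}
    (ha : a ≠ 0) (hv : om x v = 0) (hw : om x w = 0) : (hyp v w h a ha).1 *ᵥ x = x := by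
  rw [hyp_mulVec, hv, hw]; simp

theorem hyp_mul (g : Sp 2 F) {v w v' w' : Fin 2 ⊕ Fin 2 → F} (h : om v w = 1)
    (h' : om v' w' = 1) {a : F} (ha : a ≠ 0) (hv : g.1 *ᵥ v = v') (hw : g.1 *ᵥ w = w') :
    hyp v' w' h' a ha * g = g * hyp v w h a ha := by
  subst hv hw
  have : ∀ x, (hyp (g.1 *ᵥ v) (g.1 *ᵥ w) h' a ha * g).1 *ᵥ x = (g * hyp v w h a ha).1 *ᵥ x := by
    intro x
    rw [mul_mulVec, mul_mulVec, hyp_mulVec, hyp_mulVec, om_mulVec, om_mulVec, mulVec_add,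
      mulVec_add, mulVec_smul, mulVec_smul]
  exact ext_basis (this _) (this _) (this _) (this _)

/-- For `g` outside the stabilizer of `⟨e₁⟩` there is a one-parameter torus in the intersection of
the Borel subgroup with its conjugate by `g`, on which the diagonal entries `(g₁₁, g₂₂)` for the two
groups are `(a, 1)` and one of `(a⁻¹, 1)`, `(1, a)`, `(1, a⁻¹)`. -/
theorem exists_borel_of_notMem_parabolic {g : Sp 2 F} (hg : g ∉ parabolic F) {a : F}
    (ha : a ≠ 0) : ∃ h h' : borel F, (h : Sp 2 F) * g = g * h' ∧
      (h.1.1 *ᵥ e₁) (Sum.inl 0) = a ∧ (h.1.1 *ᵥ e₂) (Sum.inl 1) = 1 ∧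
      ((h'.1.1 *ᵥ e₁) (Sum.inl 0) = a⁻¹ ∧ (h'.1.1 *ᵥ e₂) (Sum.inl 1) = 1 ∨
        (h'.1.1 *ᵥ e₁) (Sum.inl 0) = 1 ∧ (h'.1.1 *ᵥ e₂) (Sum.inl 1) = a ∨
        (h'.1.1 *ᵥ e₁) (Sum.inl 0) = 1 ∧ (h'.1.1 *ᵥ e₂) (Sum.inl 1) = a⁻¹) := by
  set y := g⁻¹.1 *ᵥ e₁ with hy
  have hgy : g.1 *ᵥ y = e₁ := mulVec_inv_mulVec _ _
  have hy0 : ∀ s : F, y ≠ s • e₁ := fun s hs => hg ((inv_mem_iff (x := g)).1 ⟨s, hs⟩)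
  -- It suffices to complete `y` to a hyperbolic pair whose torus lies in the Borel subgroup.
  have key : ∀ w (hw : om y w = 1) (x₁ x₂ : F), (hyp y w hw a ha).1 *ᵥ e₁ = x₁ • e₁ →
      om e₂ ((hyp y w hw a ha).1 *ᵥ e₂) = 0 →
      ((hyp y w hw a ha).1 *ᵥ e₂) (Sum.inl 1) = x₂ →
      ∃ h h' : borel F, (h : Sp 2 F) * g = g * h' ∧
      (h.1.1 *ᵥ e₁) (Sum.inl 0) = a ∧ (h.1.1 *ᵥ e₂) (Sum.inl 1) = 1 ∧
      (h'.1.1 *ᵥ e₁) (Sum.inl 0) = x₁ ∧ (h'.1.1 *ᵥ e₂) (Sum.inl 1) = x₂ := by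
    intro w hw x₁ x₂ h1 h2 h3
    have hw' : om e₁ (g.1 *ᵥ w) = 1 := by rw [← hgy, om_mulVec, hw]
    have k1 := hyp_mulVec_left hw' ha
    have k2 : (hyp e₁ (g.1 *ᵥ w) hw' a ha).1 *ᵥ e₂ =
        e₂ + (om e₂ (g.1 *ᵥ w) * (a + 1)) • e₁ := by
      rw [hyp_mulVec, show om (e₂ : Fin 2 ⊕ Fin 2 → F) e₁ = 0 by simp [om], zero_mul, zero_smul,
        add_zero]
    refine ⟨⟨hyp e₁ (g.1 *ᵥ w) hw' a ha, ⟨a, k1⟩, ?_⟩, ⟨hyp y w hw a ha, ⟨x₁, h1⟩, h2⟩,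
      hyp_mul g hw hw' ha hgy rfl, ?_, ?_, ?_, h3⟩
    · rw [k2]; simp [om_e₂]
    · rw [k1]; simp
    · rw [k2]; simp
    · rw [h1]; simp
  by_cases h1 : om y e₁ = 0
  · have y2 : y (Sum.inr 0) = 0 := by simpa [om] using h1
    by_cases h2 : om y e₂ = 0
    · -- Here `y` lies in `⟨e₁, e₂⟩`, and its partner is a multiple of `f₂`.
      have y3 : y (Sum.inr 1) = 0 := by simpa [om] using h2
      have y1 : y (Sum.inl 1) ≠ 0 := fun y1 => hy0 (y (Sum.inl 0)) (by
        apply vec_ext <;> simp [y1, y2, y3])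
      have hw : om y ((y (Sum.inl 1))⁻¹ • f₂) = 1 := by simp [om, y1]
      have k : (hyp y ((y (Sum.inl 1))⁻¹ • f₂) hw a ha).1 *ᵥ e₂ =
          e₂ + ((y (Sum.inl 1))⁻¹ * (a + 1)) • y := by
        rw [hyp_mulVec, om_comm e₂ y, h2, om_smul_right]; simp [om]
      obtain ⟨h, h', r1, r2, r3, r4, r5⟩ := key _ hw 1 a (by
        rw [one_smul, hyp_mulVec_of_om_eq_zero hw ha (by rw [om_comm, h1]) (by simp [om])]) (by
        rw [k, om_e₂]; simp [y3]) (by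
        rw [k]; simp
        rw [mul_right_comm, inv_mul_cancel₀ y1, one_mul, ← add_assoc, add_comm 1 a, add_assoc,
          CharTwo.add_self_eq_zero, add_zero])
      exact ⟨h, h', r1, r2, r3, Or.inr (Or.inl ⟨r4, r5⟩)⟩
    · have hw : om y ((om y e₂)⁻¹ • e₂) = 1 := by rw [om_smul_right, inv_mul_cancel₀ h2]
      have k : (hyp y ((om y e₂)⁻¹ • e₂) hw a ha).1 *ᵥ e₂ = a⁻¹ • e₂ := by
        have := hyp_mulVec_right hw ha
        rwa [mulVec_smul, smul_comm, (smul_right_injective _ (inv_ne_zero h2)).eq_iff] at this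
      obtain ⟨h, h', r1, r2, r3, r4, r5⟩ := key _ hw 1 a⁻¹ (by
        rw [one_smul, hyp_mulVec_of_om_eq_zero hw ha (by rw [om_comm, h1])
          (by rw [om_smul_right]; simp [om])]) (by
        rw [k, om_smul_right, om_self, mul_zero]) (by rw [k]; simp)
      exact ⟨h, h', r1, r2, r3, Or.inr (Or.inr ⟨r4, r5⟩)⟩
  · have hw : om y ((om y e₁)⁻¹ • e₁) = 1 := by rw [om_smul_right, inv_mul_cancel₀ h1]
    have k : (hyp y ((om y e₁)⁻¹ • e₁) hw a ha).1 *ᵥ e₁ = a⁻¹ • e₁ := by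
      have := hyp_mulVec_right hw ha
      rwa [mulVec_smul, smul_comm, (smul_right_injective _ (inv_ne_zero h1)).eq_iff] at this
    have k2 : (hyp y ((om y e₁)⁻¹ • e₁) hw a ha).1 *ᵥ e₂ =
        e₂ + (om e₂ y * (a⁻¹ + 1) * (om y e₁)⁻¹) • e₁ := by
      rw [hyp_mulVec, om_smul_right, show om (e₂ : Fin 2 ⊕ Fin 2 → F) e₁ = 0 by simp [om],
        mul_zero, zero_mul, zero_smul, add_zero, smul_smul]
    obtain ⟨h, h', r1, r2, r3, r4, r5⟩ := key _ hw a⁻¹ 1 k (by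
      rw [k2]; simp [om_e₂]) (by rw [k2]; simp)
    exact ⟨h, h', r1, r2, r3, Or.inl ⟨r4, r5⟩⟩

/-- For `g` in the stabilizer of `⟨e₁⟩` but outside the Borel subgroup there is a one-parameter
torus on which the diagonal entries `(g₁₁, g₂₂)` are `(1, a)` and `(1, a⁻¹)`. -/
theorem exists_borel_of_notMem_borel {g : Sp 2 F} (hg : g ∈ parabolic F) (hg' : g ∉ borel F) {a : F}
    (ha : a ≠ 0) : ∃ h h' : borel F, (h : Sp 2 F) * g = g * h' ∧
      (h.1.1 *ᵥ e₁) (Sum.inl 0) = 1 ∧ (h.1.1 *ᵥ e₂) (Sum.inl 1) = a ∧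
      (h'.1.1 *ᵥ e₁) (Sum.inl 0) = 1 ∧ (h'.1.1 *ᵥ e₂) (Sum.inl 1) = a⁻¹ := by
  set y := g⁻¹.1 *ᵥ e₂ with hy
  have hgy : g.1 *ᵥ y = e₂ := mulVec_inv_mulVec _ _
  have h2 : om y e₂ ≠ 0 := fun h => hg' ⟨hg, by rw [← om_inv_mulVec, h]⟩
  have h1 : om e₁ y = 0 := om_e₁_mulVec (inv_mem hg) (by simp [om])
  have h12 : om (e₁ : Fin 2 ⊕ Fin 2 → F) e₂ = 0 := by simp [om]
  have hw : om y ((om y e₂)⁻¹ • e₂) = 1 := by rw [om_smul_right, inv_mul_cancel₀ h2]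
  have hw' : om e₂ (g.1 *ᵥ ((om y e₂)⁻¹ • e₂)) = 1 := by
    rw [← om_inv_mulVec, hw]
  have k1 : (hyp y ((om y e₂)⁻¹ • e₂) hw a ha).1 *ᵥ e₁ = e₁ :=
    hyp_mulVec_of_om_eq_zero hw ha h1 (by rw [om_smul_right, h12, mul_zero])
  have k2 : (hyp y ((om y e₂)⁻¹ • e₂) hw a ha).1 *ᵥ e₂ = a⁻¹ • e₂ := by
    have := hyp_mulVec_right hw ha
    rwa [mulVec_smul, smul_comm, (smul_right_injective _ (inv_ne_zero h2)).eq_iff] at this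
  have k3 : (hyp e₂ (g.1 *ᵥ ((om y e₂)⁻¹ • e₂)) hw' a ha).1 *ᵥ e₁ = e₁ :=
    hyp_mulVec_of_om_eq_zero hw' ha h12 (om_e₁_mulVec hg (by rw [om_smul_right, h12, mul_zero]))
  have k4 := hyp_mulVec_left hw' ha
  have m1 : hyp y ((om y e₂)⁻¹ • e₂) hw a ha ∈ borel F :=
    ⟨⟨1, by rw [k1, one_smul]⟩, by rw [k2, om_smul_right, om_self, mul_zero]⟩
  have m2 : hyp e₂ (g.1 *ᵥ ((om y e₂)⁻¹ • e₂)) hw' a ha ∈ borel F :=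
    ⟨⟨1, by rw [k3, one_smul]⟩, by rw [k4, om_smul_right, om_self, mul_zero]⟩
  refine ⟨⟨_, m2⟩, ⟨_, m1⟩, hyp_mul g hw hw' ha hgy rfl, ?_, ?_, ?_, ?_⟩
  · rw [k3]; simp
  · rw [k4]; simp
  · rw [k1]; simp
  · rw [k2]; simp

variable [Finite F]

theorem exists_mul_mul_of_notMem_borel {p p' : Sp 2 F} (hp : p ∈ parabolic F)
    (hp' : p' ∈ parabolic F) (hpB : p ∉ borel F) (hpB' : p' ∉ borel F) :
    ∃ b ∈ borel F, ∃ b' ∈ borel F, p' = b * p * b' := by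
  have t0 : (p.1 *ᵥ e₂) (Sum.inr 1) ≠ 0 := fun h => hpB ⟨hp, by rw [om_e₂, h]⟩
  have t0' : (p'.1 *ᵥ e₂) (Sum.inr 1) ≠ 0 := fun h => hpB' ⟨hp', by rw [om_e₂, h]⟩
  obtain ⟨c, hc⟩ := exists_sq (((p.1 *ᵥ e₂) (Sum.inl 1) * (p'.1 *ᵥ e₂) (Sum.inr 1) +
    (p.1 *ᵥ e₂) (Sum.inr 1) * (p'.1 *ᵥ e₂) (Sum.inl 1)) /
      ((p.1 *ᵥ e₂) (Sum.inr 1) * (p'.1 *ᵥ e₂) (Sum.inr 1)))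
  rw [eq_div_iff (mul_ne_zero t0 t0')] at hc
  have hb1 : (tv (c • e₂ : Fin 2 ⊕ Fin 2 → F)).1 *ᵥ e₁ = e₁ :=
    tv_mulVec_of_om_eq_zero (by simp [om])
  have hb : tv (c • e₂ : Fin 2 ⊕ Fin 2 → F) ∈ borel F :=
    ⟨⟨1, by rw [hb1, one_smul]⟩, by
      rw [tv_mulVec_of_om_eq_zero (by rw [om_smul_right, om_self, mul_zero]), om_self]⟩
  have hbp := mul_mem hb.1 hp
  refine ⟨_, hb, (tv (c • e₂) * p)⁻¹ * p', ⟨mul_mem (inv_mem hbp) hp', ?_⟩, by group⟩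
  rw [mul_mulVec, om_comm, om_inv_mulVec, om_comm, mul_mulVec, tv_mulVec, om_add_left,
    om_mulVec_e₂ hp hp', om_smul_left, om_smul_left, om_e₂, om_smul_right, om_comm _ e₂, om_e₂]
  linear_combination hc + ((p.1 *ᵥ e₂) (Sum.inl 1) * (p'.1 *ᵥ e₂) (Sum.inr 1) +
    (p.1 *ᵥ e₂) (Sum.inr 1) * (p'.1 *ᵥ e₂) (Sum.inl 1)) * CharTwo.two_eq_zero (R := F)

variable (F) in
theorem index_parabolic : (parabolic F).index * (Nat.card F - 1) = Nat.card F ^ 4 - 1 := by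
  have he : (e₁ : Fin 2 ⊕ Fin 2 → F) ≠ 0 := by simp
  have key : ∀ g h : Sp 2 F, Projectivization.mk F (g.1 *ᵥ e₁) (mulVec_ne_zero g he) =
      Projectivization.mk F (h.1 *ᵥ e₁) (mulVec_ne_zero h he) ↔ g⁻¹ * h ∈ parabolic F := by
    intro g h
    rw [Projectivization.mk_eq_mk_iff', ← inv_mem_iff, _root_.mul_inv_rev, inv_inv]
    refine exists_congr fun a => ⟨fun ha => ?_, fun ha => ?_⟩
    · rw [mul_mulVec, ← ha, mulVec_smul, inv_mulVec_mulVec]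
    · rw [← mulVec_smul, ← ha, mul_mulVec, mulVec_inv_mulVec]
  let φ : Sp 2 F ⧸ parabolic F → Projectivization F (Fin 2 ⊕ Fin 2 → F) :=
    Quotient.lift (fun g : Sp 2 F => Projectivization.mk F (g.1 *ᵥ e₁) (mulVec_ne_zero g he))
      fun g h hgh => (key g h).2 (QuotientGroup.leftRel_apply.1 hgh)
  have hφ : Function.Bijective φ := by
    refine ⟨fun x y => ?_, fun x => ?_⟩
    · induction x using QuotientGroup.induction_on with | _ g
      induction y using QuotientGroup.induction_on with | _ h
      exact fun hgh => QuotientGroup.eq.2 ((key g h).1 hgh)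
    · induction x using Projectivization.ind with | _ v hv
      obtain ⟨g, hg⟩ := exists_mulVec_eq he hv
      exact ⟨QuotientGroup.mk g,
        (Projectivization.mk_eq_mk_iff' _ _ _ _ _).2 ⟨1, by rw [hg, one_smul]⟩⟩
  rw [Subgroup.index, Nat.card_congr (Equiv.ofBijective φ hφ), ← Projectivization.card,
    Nat.card_fun, Nat.card_sum, Nat.card_fin]

omit [Finite F] in
theorem mulVec_e₂_ne_zero {g : Sp 2 F} (hg : g ∈ parabolic F)
    (h : (g.1 *ᵥ e₂) (Sum.inr 1) = 0) : (g.1 *ᵥ e₂) (Sum.inl 1) ≠ 0 := by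
  intro h0
  have h1 : om (g.1 *ᵥ e₂) (g.1 *ᵥ f₂) = 1 := by rw [om_mulVec]; simp [om]
  rw [mulVec_e₂ hg (by rw [om_e₂, h]), h0, zero_smul, add_zero, om_smul_left,
    om_e₁_mulVec hg (by simp [om]), mul_zero] at h1
  exact zero_ne_one h1

variable (F) in
theorem relIndex_borel : (borel F).relIndex (parabolic F) = Nat.card F + 1 := by
  classical
  -- The point of the projective line that belongs to the image of `e₂` modulo `e₁`.
  let φ₀ : parabolic F → Option F := fun p => if (p.1.1 *ᵥ e₂) (Sum.inr 1) = 0 then none else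
    some ((p.1.1 *ᵥ e₂) (Sum.inl 1) / (p.1.1 *ᵥ e₂) (Sum.inr 1))
  have key : ∀ g h : parabolic F, φ₀ g = φ₀ h ↔
      g⁻¹ * h ∈ (borel F).subgroupOf (parabolic F) := by
    intro g h
    have h1 : g⁻¹ * h ∈ (borel F).subgroupOf (parabolic F) ↔
        om (g.1.1 *ᵥ e₂) (h.1.1 *ᵥ e₂) = 0 := by
      rw [Subgroup.mem_subgroupOf, om_comm, ← om_inv_mulVec, om_comm, ← mul_mulVec]
      exact ⟨fun h => h.2, fun h' => ⟨(g⁻¹ * h).2, h'⟩⟩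
    rw [h1, om_mulVec_e₂ g.2 h.2]
    have hg := mulVec_e₂_ne_zero g.2
    have hh := mulVec_e₂_ne_zero h.2
    simp only [φ₀]
    generalize (g.1.1 *ᵥ e₂) (Sum.inl 1) = s at *
    generalize (g.1.1 *ᵥ e₂) (Sum.inr 1) = t at *
    generalize (h.1.1 *ᵥ e₂) (Sum.inl 1) = s' at *
    generalize (h.1.1 *ᵥ e₂) (Sum.inr 1) = t' at *
    split_ifs with h2 h3 h3
    · simp [h2, h3]
    · simp [h2, h3, hg h2]
    · simp [h2, h3, hh h3]
    · rw [Option.some_inj, div_eq_div_iff h2 h3, CharTwo.add_eq_zero, mul_comm s' t]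
  let φ : parabolic F ⧸ (borel F).subgroupOf (parabolic F) → Option F :=
    Quotient.lift φ₀ fun g h hgh => (key g h).2 (QuotientGroup.leftRel_apply.1 hgh)
  have hφ : Function.Bijective φ := by
    refine ⟨fun x y => ?_, fun x => ?_⟩
    · induction x using QuotientGroup.induction_on with | _ g
      induction y using QuotientGroup.induction_on with | _ h
      exact fun hgh => QuotientGroup.eq.2 ((key g h).1 hgh)
    · suffices ∃ p, φ₀ p = x by
        obtain ⟨p, hp⟩ := this
        exact ⟨QuotientGroup.mk p, hp⟩
      rcases x with _ | x
      · refine ⟨1, if_pos ?_⟩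
        rw [Subgroup.coe_one, one_mulVec']; simp
      · obtain ⟨c, hc⟩ := exists_sq (x + 1)
        have hp : (tv (c • e₂ : Fin 2 ⊕ Fin 2 → F) * tv f₂).1 *ᵥ e₁ = e₁ := by
          rw [mul_mulVec, tv_mulVec_of_om_eq_zero (u := f₂) (by simp [om]),
            tv_mulVec_of_om_eq_zero (by simp [om])]
        have hp2 : (tv (c • e₂ : Fin 2 ⊕ Fin 2 → F) * tv f₂).1 *ᵥ e₂ = x • e₂ + f₂ := by
          have h1 : (1 : F) + (x + 1) = x := by
            linear_combination CharTwo.two_eq_zero (R := F)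
          rw [mul_mulVec, tv_mulVec, tv_mulVec]
          apply vec_ext <;> simp [om, hc, h1]
        refine ⟨⟨_, 1, by rw [hp, one_smul]⟩, ?_⟩
        simp only [φ₀]
        rw [hp2]
        simp
  rw [Subgroup.relIndex, Subgroup.index, Nat.card_congr (Equiv.ofBijective φ hφ),
    Finite.card_option]

variable (F) in
theorem index_borel :
    (borel F).index = (Nat.card F + 1) * (parabolic F).index := by
  rw [← relIndex_borel, Subgroup.relIndex_mul_index borel_le_parabolic]

theorem index_parabolic_eq : (parabolic F).index = (Nat.card F + 1) * (Nat.card F ^ 2 + 1) := by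
  have h := index_parabolic F
  have h1 : 1 < Nat.card F := Finite.one_lt_card
  obtain ⟨r, hr⟩ : ∃ r, Nat.card F = r + 2 := ⟨Nat.card F - 2, by omega⟩
  rw [hr] at h ⊢
  refine Nat.eq_of_mul_eq_mul_right (show 0 < r + 2 - 1 by omega) (h.trans ?_)
  have h2 : r + 2 - 1 = r + 1 := by omega
  rw [h2]
  refine Nat.sub_eq_of_eq_add ?_
  ring

omit [CharP F 2] in
variable (F) in
/-- A multiplicative character of a finite field of maximal order and an element at which it takes
a primitive root of unity as its value. -/
theorem exists_mulChar_pow_ne_one : ∃ (α : MulChar F ℂ) (a : F), a ≠ 0 ∧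
    ∀ k, k ≠ 0 → k < Nat.card F - 1 → α a ^ k ≠ 1 := by
  classical
  have := Fintype.ofFinite F
  obtain ⟨g, hg⟩ := IsCyclic.exists_generator (α := Fˣ)
  have hn : Fintype.card Fˣ ≠ 0 := Fintype.card_ne_zero
  have hζ := Complex.isPrimitiveRoot_exp _ hn
  obtain ⟨ζ, hζ'⟩ := hζ.isUnit hn
  have hmem : ζ ∈ rootsOfUnity (Fintype.card Fˣ) ℂ := by
    rw [mem_rootsOfUnity', hζ', hζ.pow_eq_one]
  refine ⟨MulChar.ofRootOfUnity hmem hg, g, g.ne_zero, fun k hk0 hk => ?_⟩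
  rw [MulChar.ofRootOfUnity_spec, hζ']
  refine hζ.pow_ne_one_of_pos_of_lt hk0 ?_
  rwa [Fintype.card_units, ← Nat.card_eq_fintype_card]

/-- The principal series character induced from a linear character of the Borel subgroup whose
restriction to the diagonal torus is moved by every nontrivial element of the Weyl group. -/
theorem exists_irrChar_of_six_le_card (hF : 6 ≤ Nat.card F) :
    ∃ χ ∈ IrrChar (Sp 2 F), χ 1 = (((Nat.card F + 1) ^ 2 * (Nat.card F ^ 2 + 1) : ℕ) : ℂ) := by
  obtain ⟨α, a, ha, hα⟩ := exists_mulChar_pow_ne_one F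
  have hinv : α a * α a⁻¹ = 1 := by rw [← map_mul, mul_inv_cancel₀ ha, map_one]
  obtain ⟨χ, hχ, h1⟩ := exists_irrChar_index (borel F) (borelChar α (α * α)) fun g hg => by
    by_cases hgP : g ∈ parabolic F
    · obtain ⟨h, h', h0, h1, h2, h3, h4⟩ := exists_borel_of_notMem_borel hgP hg ha
      refine ⟨h, h', h0, fun hh => ?_⟩
      simp only [borelChar, MonoidHom.coe_mk, OneHom.coe_mk, h1, h2, h3, h4, map_one, one_mul,
        MulChar.mul_apply] at hh
      exact hα 4 (by omega) (by omega) (by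
        linear_combination α a ^ 2 * hh + (α a * α a⁻¹ + 1) * hinv)
    · obtain ⟨h, h', h0, h1, h2, h3⟩ := exists_borel_of_notMem_parabolic hgP ha
      refine ⟨h, h', h0, fun hh => ?_⟩
      rcases h3 with ⟨h3, h4⟩ | ⟨h3, h4⟩ | ⟨h3, h4⟩ <;>
        simp only [borelChar, MonoidHom.coe_mk, OneHom.coe_mk, h1, h2, h3, h4, map_one, one_mul,
          mul_one, MulChar.mul_apply] at hh
      · exact hα 2 (by omega) (by omega) (by linear_combination α a * hh + hinv)
      · refine hα 1 (by omega) (by omega) ?_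
        have : α a ≠ 0 := left_ne_zero_of_mul_eq_one hinv
        rw [pow_one]
        exact mul_left_cancel₀ this (by rw [mul_one, ← hh])
      · exact hα 3 (by omega) (by omega) (by
          linear_combination α a ^ 2 * hh + (α a * α a⁻¹ + 1) * hinv)
  refine ⟨χ, hχ, ?_⟩
  rw [h1, index_borel, index_parabolic_eq]
  congr 1
  ring

/-- The character `g ↦ α (g₁₁)` of the Borel subgroup extends to the stabilizer of `⟨e₁⟩`, so that
the induced character splits; the part that is not induced from the extension is irreducible. -/
theorem exists_irrChar_of_four_le_card (hF : 4 ≤ Nat.card F) :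
    ∃ χ ∈ IrrChar (Sp 2 F),
      χ 1 = ((Nat.card F * (Nat.card F + 1) * (Nat.card F ^ 2 + 1) : ℕ) : ℂ) := by
  obtain ⟨α, a, ha, hα⟩ := exists_mulChar_pow_ne_one F
  have hinv : α a * α a⁻¹ = 1 := by rw [← map_mul, mul_inv_cancel₀ ha, map_one]
  have hlt : borel F < parabolic F := by
    refine lt_of_le_of_ne borel_le_parabolic fun h => ?_
    have h1 := relIndex_borel F
    rw [h, Subgroup.relIndex_self] at h1
    omega
  obtain ⟨χ, hχ, h1⟩ := exists_irrChar_index_sub (borel F) (parabolic F) hlt (parabolicChar α)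
    (fun g hg => by
      obtain ⟨h, h', h0, h1, h2, h3⟩ := exists_borel_of_notMem_parabolic hg ha
      refine ⟨h, h', h0, fun hh => ?_⟩
      change α ((h.1.1 *ᵥ e₁) (Sum.inl 0)) = α ((h'.1.1 *ᵥ e₁) (Sum.inl 0)) at hh
      rcases h3 with ⟨h3, -⟩ | ⟨h3, -⟩ | ⟨h3, -⟩ <;> rw [h1, h3] at hh
      · exact hα 2 (by omega) (by omega) (by linear_combination α a * hh + hinv)
      · exact hα 1 (by omega) (by omega) (by rw [pow_one, hh, map_one])
      · exact hα 1 (by omega) (by omega) (by rw [pow_one, hh, map_one]))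
    fun p hp p' hp' hpB hpB' => exists_mul_mul_of_notMem_borel hp hp' hpB hpB'
  refine ⟨χ, hχ, ?_⟩
  rw [h1, index_borel, index_parabolic_eq]
  push_cast
  ring

end SymplecticFour

/-! ### Conclusion -/

open SymplecticFour FiniteGroupCharacters WreathTwo in
theorem totalCharacter_sp2Wreath_one {F : Type*} [Field F] [Finite F] [CharP F 2] :
    totalCharacter (sp2Wreath F) 1 =
      (Nat.card F : ℂ) ^ 4 + (Nat.card F : ℂ) ^ 3 - (Nat.card F : ℂ) := by
  have h1 : 1 ≤ Nat.card F ^ 2 := Nat.one_le_pow _ _ Nat.card_pos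
  obtain ⟨i⟩ := nonempty_sp2Wreath_equiv F
  rw [totalCharacter_one_congr i, totalCharacter_wreath_one, totalCharacter_one_congr sp1Equiv,
    SpecialLinearTwo.totalCharacter_one_eq, Nat.card_congr sp1Equiv.toEquiv,
    SpecialLinearTwo.card_eq, Nat.cast_mul, Nat.cast_sub h1]
  push_cast
  ring

open SymplecticFour FiniteGroupCharacters in
theorem mainTheorem2 {F : Type*} [Field F] [Finite F] (e q : ℕ) (he : 1 < e)
    (hq : q = 2 ^ e) (hF : Nat.card F = q) :
    -- the subgroups are maximal, and are what their names say
    IsCoatom (sp2Wreath F) ∧ IsCoatom (soPlus F) ∧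
    Nonempty (sp2Wreath F ≃* (Sp 1 F ≀ᵣ Multiplicative (ZMod 2))) ∧
    Nonempty (sp2Wreath F ≃* soPlus F) ∧
    -- neither is a strong Gelfand subgroup
    ¬ IsStrongGelfandSubgroup (sp2Wreath F) ∧
    ¬ IsStrongGelfandSubgroup (soPlus F) ∧
    -- the degree of the total character
    totalCharacter (sp2Wreath F) 1 = (q : ℂ) ^ 4 + (q : ℂ) ^ 3 - (q : ℂ) ∧
    -- it is smaller than the degree of some irreducible character of the whole group
    (∃ χ ∈ IrrChar (Sp 2 F), ∃ d : ℕ, χ 1 = (d : ℂ) ∧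
      (q : ℤ) ^ 4 + (q : ℤ) ^ 3 - (q : ℤ) < (d : ℤ) ∧
      (2 < e → d = (q + 1) ^ 2 * (q ^ 2 + 1)) ∧
      (e = 2 → d = 340)) := by
  have hchar : CharP F 2 := by
    have := Fintype.ofFinite F
    obtain ⟨p, hp⟩ := CharP.exists F
    obtain ⟨n, hp', hn⟩ := FiniteField.card F p
    rw [← Nat.card_eq_fintype_card, hF, hq] at hn
    have : p ∣ 2 := hp'.dvd_of_dvd_pow (hn ▸ dvd_pow_self p n.ne_zero : p ∣ 2 ^ e)
    rwa [(Nat.prime_dvd_prime_iff_eq hp' Nat.prime_two).1 this] at hp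
  have h4 : 4 ≤ q := by
    rw [hq]; exact Nat.pow_le_pow_right (n := 2) (by norm_num) he
  have htot := totalCharacter_sp2Wreath_one (F := F)
  rw [hF] at htot
  obtain ⟨χ, hχ, d, hd, hlt, hd1, hd2⟩ : ∃ χ ∈ IrrChar (Sp 2 F), ∃ d : ℕ, χ 1 = (d : ℂ) ∧
      (q : ℤ) ^ 4 + (q : ℤ) ^ 3 - (q : ℤ) < (d : ℤ) ∧
      (2 < e → d = (q + 1) ^ 2 * (q ^ 2 + 1)) ∧ (e = 2 → d = 340) := by
    by_cases he2 : e = 2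
    · obtain ⟨χ, hχ, h⟩ := exists_irrChar_of_four_le_card (F := F) (by rw [hF]; exact h4)
      have hq4 : q = 4 := by rw [hq, he2]; norm_num
      rw [hF, hq4] at h
      exact ⟨χ, hχ, 340, h, by rw [hq4]; norm_num, fun h => by omega, fun _ => rfl⟩
    · have h8 : 8 ≤ q := by
        rw [hq]; exact Nat.pow_le_pow_right (n := 2) (i := 3) (by norm_num) (by omega)
      obtain ⟨χ, hχ, h⟩ := exists_irrChar_of_six_le_card (F := F) (by rw [hF]; omega)
      rw [hF] at h
      refine ⟨χ, hχ, _, h, ?_, fun _ => rfl, fun h => absurd h he2⟩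
      push_cast
      nlinarith [sq_nonneg (q : ℤ), pow_nonneg (Int.natCast_nonneg q) 3]
  -- A strong Gelfand subgroup would bound the degree of `χ` by the total degree.
  have hno : ∀ H : Subgroup (Sp 2 F), totalCharacter H 1 = totalCharacter (sp2Wreath F) 1 →
      ¬ IsStrongGelfandSubgroup H := by
    intro H hH hsg
    have h1 := degree_le_of_isStrongGelfandSubgroup H hsg hχ
    have h2 : totalCharacter H 1 = (((q : ℝ) ^ 4 + (q : ℝ) ^ 3 - (q : ℝ) : ℝ) : ℂ) := by
      rw [hH, htot]; push_cast; rfl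
    rw [hd, h2, Complex.natCast_re, Complex.ofReal_re] at h1
    exact absurd h1 (not_le.2 (by exact_mod_cast hlt))
  obtain ⟨i⟩ := nonempty_sp2Wreath_equiv_soPlus F
  exact ⟨isCoatom_sp2Wreath F, isCoatom_soPlus (by rw [hF]; exact h4), nonempty_sp2Wreath_equiv F,
    nonempty_sp2Wreath_equiv_soPlus F, hno _ rfl, hno _ (totalCharacter_one_congr i).symm, htot,
    χ, hχ, d, hd, hlt, hd1, hd2⟩
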